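/- Let $I=(1/2,3/2)$, let $Q'=(a_1,b_1)\times(a_2,b_2)\subset\mathbb{R}^2$ be a bounded open rectangle, $Q=I\times Q'$, and write $x=(x_1,x')\in I\times Q'$. All functions are complex-valued. Let $A'$ be the Dirichlet Laplacian on $Q'$, that is $A'u=-\Delta_{x'}u$ with domain $D(A')=\{u\in H^1_0(Q');\ \Delta_{x'}u\in L^2(Q')\}$; its spectrum consists of eigenvalues. Let $\Lambda$ be the set of $\lambda\in\mathbb{R}$ with $|\lambda|\ge 4$ such that $\lambda^2$ is not an eigenvalue of $A'$. Write $\|\cdot\|_2$ for the norm of $L^2(Q)$, $\|u\|_{H^1}=(\|u\|_2^2+\|\nabla u\|_2^2)^{1/2}$ for the norm of $H^1(Q)$, and, for finite $r_1,r_2\ge 1$, $$\|f\|_{r_1,r_2}=\Big(\int_I\|f(x_1,\cdot)\|_{L^{r_2}(Q')}^{r_1}\,dx_1\Big)^{1/r_1}.$$ There are a constant $C_0>0$ depending only on $Q$ and, for each $\alpha\in(0,1/2)$, a constant $C>0$ depending only on $Q$ and $\alpha$, such that for every $\lambda\in\Lambda$ there is a linear operator $E_\lambda:L^2(Q)\to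 H^2(Q)$ with the following properties: 1. $e^{\lambda x_1}(-\Delta)e^{-\lambda x_1}E_\lambda f=f$ for all $f\in L^2(Q)$; 2. $E_\lambda\, e^{\lambda x_1}(-\Delta)e^{-\lambda x_1}f=f$ for all $f\in C_0^\infty(Q)$; 3. $\|E_\lambda f\|_2\le C_0|\lambda|^{-1}\|f\|_2$ for all $f\in L^2(Q)$; 4. $\|E_\lambda f\|_{H^1}\le C_0\|f\|_2$ for all $f\in L^2(Q)$; 5. whenever $0<\alpha<1/2$, $2<r<2/\alpha-2$, $p'=2+\alpha(r-2)$, $\theta=\alpha r/p'$, $\tilde p'=1/\theta$, and $p,\tilde p\in(1,2)$ are the exponents conjugate to $p',\tilde p'$ (that is $1/p+1/p'=1$ and $1/\tilde p+1/\tilde p'=1$), one has $\|E_\lambda f\|_{\tilde p',p'}\le C\|f\|_{\tilde p,p}$ for all $f\in L^2(Q)$, where $C$ is the constant belonging to $\alpha$. -/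

import Mathlib

open Set Filter Topology MeasureTheory
open scoped ENNReal ContDiff

noncomputable section

section General

variable {V : Type*} [NormedAddCommGroup V] [NormedSpace ℝ V] [MeasureSpace V]
variable {ι : Type*} [Fintype ι]

/-- `φ ∈ C₀^∞(U)`, as a function on the whole space. -/
def IsTestFunction (U : Set V) (φ : V → ℂ) : Prop :=
  ContDiff ℝ ∞ φ ∧ HasCompactSupport φ ∧ tsupport φ ⊆ U

/-- The classical Laplacian `∑ i, ∂_{e i} ∂_{e i} φ` for the coordinate directions `e`. -/
def classicalLaplacian (e : ι → V) (φ : V → ℂ) (x : V) : ℂ :=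
  ∑ i, fderiv ℝ (fun y => fderiv ℝ φ y (e i)) x (e i)

/-- `g` is the weak derivative of `u` in the direction `v` on `U`. -/
def HasWeakDeriv (U : Set V) (v : V) (u g : V → ℂ) : Prop :=
  LocallyIntegrableOn u U volume ∧ LocallyIntegrableOn g U volume ∧
    ∀ φ : V → ℂ, IsTestFunction U φ →
      ∫ x in U, u x * fderiv ℝ φ x v = -∫ x in U, g x * φ x

/-- `Δ u = g` on `U` in the sense of distributions. -/
def HasWeakLaplacian (U : Set V) (e : ι → V) (u g : V → ℂ) : Prop :=
  LocallyIntegrableOn u U volume ∧ LocallyIntegrableOn g U volume ∧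
    ∀ φ : V → ℂ, IsTestFunction U φ →
      ∫ x in U, u x * classicalLaplacian e φ x = ∫ x in U, g x * φ x

/-- The norm of `H¹(U)`, `(‖u‖₂² + ∑ i, ‖∂ᵢ u‖₂²)^{1/2}`, as an extended real. Weak derivatives
are unique up to null sets, so the infimum is over one value, or over none, and is then `∞`. -/
def h1Norm (U : Set V) (e : ι → V) (u : V → ℂ) : ℝ≥0∞ :=
  ⨅ (g : ι → V → ℂ) (_ : ∀ i, HasWeakDeriv U (e i) u (g i)),
    (eLpNorm u 2 (volume.restrict U) ^ 2 +
      ∑ i, eLpNorm (g i) 2 (volume.restrict U) ^ 2) ^ (1 / 2 : ℝ)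

/-- `u ∈ H²(U)`: `u` and its weak derivatives of first and second order are in `L²(U)`. -/
def MemH2 (U : Set V) (e : ι → V) (u : V → ℂ) : Prop :=
  MemLp u 2 (volume.restrict U) ∧
    ∃ (g : ι → V → ℂ) (h : ι → ι → V → ℂ),
      (∀ i, MemLp (g i) 2 (volume.restrict U) ∧ HasWeakDeriv U (e i) u (g i)) ∧
      (∀ i j, MemLp (h i j) 2 (volume.restrict U) ∧ HasWeakDeriv U (e j) (g i) (h i j))

/-- `u ∈ H₀¹(U)`: `u` is in `H¹(U)` and is a limit in `H¹(U)` of functions in `C₀^∞(U)`. -/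
def MemH10 (U : Set V) (e : ι → V) (u : V → ℂ) : Prop :=
  MemLp u 2 (volume.restrict U) ∧
    ∃ g : ι → V → ℂ,
      (∀ i, MemLp (g i) 2 (volume.restrict U) ∧ HasWeakDeriv U (e i) u (g i)) ∧
      ∃ φ : ℕ → V → ℂ, (∀ n, IsTestFunction U (φ n)) ∧
        Tendsto (fun n => eLpNorm (fun x => φ n x - u x) 2 (volume.restrict U)) atTop (𝓝 0) ∧
        ∀ i, Tendsto
          (fun n => eLpNorm (fun x => fderiv ℝ (φ n) x (e i) - g i x) 2 (volume.restrict U))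
          atTop (𝓝 0)

/-- `u` is in the domain `{u ∈ H₀¹(U) ; Δ u ∈ L²(U)}` of the Dirichlet operator `-Δ`, and
`-Δ u = g`. -/
def IsDirichletNegLaplacian (U : Set V) (e : ι → V) (u g : V → ℂ) : Prop :=
  MemH10 U e u ∧ MemLp g 2 (volume.restrict U) ∧ HasWeakLaplacian U e u (fun x => -g x)

/-- `μ` is an eigenvalue of the Dirichlet operator `-Δ` on `U`. -/
def IsDirichletEigenvalue (U : Set V) (e : ι → V) (μ : ℝ) : Prop :=
  ∃ u : V → ℂ, IsDirichletNegLaplacian U e u (fun x => (μ : ℂ) * u x) ∧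
    ¬ (u =ᵐ[volume.restrict U] 0)

end General

/-- The coordinate directions of the plane, points being written `x' = (x₂, x₃)`. -/
def frame2 : Fin 2 → ℝ × ℝ := ![(1, 0), (0, 1)]

/-- The coordinate directions of space, points being written `x = (x₁, x') = (x₁, x₂, x₃)`. -/
def frame3 : Fin 3 → ℝ × ℝ × ℝ := ![(1, 0, 0), (0, 1, 0), (0, 0, 1)]

/-- The interval `I = (1/2, 3/2)`. -/
def intervalI : Set ℝ := Ioo (1 / 2) (3 / 2)

/-- The rectangle `Q' = (a₁, b₁) × (a₂, b₂)`. -/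
def rectQ' (a₁ b₁ a₂ b₂ : ℝ) : Set (ℝ × ℝ) := Ioo a₁ b₁ ×ˢ Ioo a₂ b₂

/-- The box `Q = I × Q'`. -/
def boxQ (a₁ b₁ a₂ b₂ : ℝ) : Set (ℝ × ℝ × ℝ) := intervalI ×ˢ rectQ' a₁ b₁ a₂ b₂

/-- The complex Hilbert space `L²(Q)`. -/
abbrev L2Q (a₁ b₁ a₂ b₂ : ℝ) : Type :=
  Lp ℂ 2 ((volume : Measure (ℝ × ℝ × ℝ)).restrict (boxQ a₁ b₁ a₂ b₂))

/-- The norm of `L^{r₁}(I, L^{r₂}(Q'))`, for finite exponents, as an extended real. -/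
def mixedNorm (I : Set ℝ) (Q' : Set (ℝ × ℝ)) (r₁ r₂ : ℝ) (f : ℝ × ℝ × ℝ → ℂ) : ℝ≥0∞ :=
  (∫⁻ x₁ in I, eLpNorm (fun x' : ℝ × ℝ => f (x₁, x')) (ENNReal.ofReal r₂)
    (volume.restrict Q') ^ r₁) ^ (1 / r₁)

/-- The conjugated Laplacian `e^{l x₁} (-Δ) e^{-l x₁} φ` of a smooth function `φ`. -/
def conjLaplacian (l : ℝ) (φ : ℝ × ℝ × ℝ → ℂ) (x : ℝ × ℝ × ℝ) : ℂ :=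
  (Real.exp (l * x.1) : ℂ) *
    -classicalLaplacian frame3 (fun y => (Real.exp (-l * y.1) : ℂ) * φ y) x

/-- `e^{l x₁} (-Δ) e^{-l x₁} u = f` almost everywhere on `Q`, the Laplacian being weak. -/
def HasWeakConjLaplacian (Q : Set (ℝ × ℝ × ℝ)) (l : ℝ) (u f : ℝ × ℝ × ℝ → ℂ) : Prop :=
  ∃ g : ℝ × ℝ × ℝ → ℂ,
    HasWeakLaplacian Q frame3 (fun x => (Real.exp (-l * x.1) : ℂ) * u x) g ∧
    ∀ᵐ x ∂(volume.restrict Q), (Real.exp (l * x.1) : ℂ) * -g x = f x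

end

/-!
The operator `e^{l x₁} (-Δ) e^{-l x₁} = -(∂₁ - l)² - Δ'` separates in the Dirichlet eigenfunctions
`φ_n` of the rectangle: on `v(x₁) φ_n(x')` it acts as `-(d/dt - l)² + μ_n²` on `v`, with `μ_n²` the
eigenvalue. That ordinary differential operator has the fundamental solution `greenKernel 0 l μ`,
made of one-sided exponentials and of absolute value at most `exp (-||l| - μ| |t|) / (2 μ)`.
`solutionOp` expands `f ∈ L²(Q)` in the modes (`isHilbertSum_modeEmb`, which rests on the
completeness of the sines in `L¹`), convolves the `n`-th coefficient on `I` with the kernel for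
`μ_n`, and sums up again.

*Regularity and the `L²` bounds.* The kernel is `O(1 / |l|)` and its derivative is `O(1)`, uniformly
in `μ`; near `μ = |l|` this only uses that `I` is bounded, and for small `μ` the two exponentials
cancel. Together with `μ ‖G f‖ ≤ ‖f‖` for the convolution `G` this gives the `L²` and `H¹` bounds.
With bounds of order `μ⁻²` that depend on `l`, all weak derivatives of second order are in `L²`, and
the equation holds mode by mode. See `exists_derivatives_solutionOp`.

*Left inverse.* Reflecting the kernel changes the sign of `l`, so the adjoint of the operator for `l`
is the operator for `-l`. Pairing `E P φ`, where `P` is the conjugated Laplacian and `φ` a test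
function, with an arbitrary function and moving both `E` and `P` to the other side reduces the claim
to the right inverse property for `-l`; see `solutionOp_conjLaplacian`.

*The mixed norm.* For fixed `x₁` and `y₁ ∈ I` with `t = x₁ - y₁`, the map taking `f(y₁, ·)` to
`∑ κ_n(t) ⟨f(y₁, ·), φ_n⟩ φ_n` is bounded from `L^p(Q')` to `L^{p'}(Q')` by interpolation between
`L² → L²`, with norm `sup |κ_n(t)| ≤ 2 / |l|`, and `L¹ → L^∞`, with norm at most a multiple of
`∑ |κ_n(t)| ≤ A |l| / |t|` because the `φ_n` are uniformly bounded; the last sum is estimated through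
the growth `μ_n ≥ c (n₁ + n₂ + 1)`. The interpolation is done by hand in `sum_mul_norm_mul_norm_le`.
Since `p' ≤ 4`, the resulting power of `|l|` is not positive, and there remains the singular factor
`|t| ^ (-(1 - 2 / p'))`. Hölder's inequality in `y₁` finishes the estimate: the relations between the
exponents make the `q'`-th power of that factor equal to `|t| ^ (-(1 - 2 / r))`, which is integrable,
with an integral of at most `r < 2 / α`.
-/

/-! ### Trigonometric systems on an interval -/

/-- The frequency `(j + 1) π / (b - a)` of the `j`-th Dirichlet or Neumann mode of `(a, b)`. -/
noncomputable def freq (a b : ℝ) (j : ℕ) : ℝ := (j + 1) * Real.pi / (b - a)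

/-- The `j`-th sine (`σ = true`) or cosine (`σ = false`) mode of the interval `(a, b)`. The
constant cosine does not occur, so that both systems are indexed alike. -/
noncomputable def trig (σ : Bool) (a b : ℝ) (j : ℕ) (x : ℝ) : ℝ :=
  bif σ then Real.sin (freq a b j * (x - a)) else Real.cos (freq a b j * (x - a))

lemma freq_pos {a b : ℝ} (h : a < b) (j : ℕ) : 0 < freq a b j := by
  have := sub_pos.2 h
  unfold freq
  positivity

lemma abs_trig_le_one (σ : Bool) (a b : ℝ) (j : ℕ) (x : ℝ) : |trig σ a b j x| ≤ 1 := by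
  cases σ
  · exact Real.abs_cos_le_one _
  · exact Real.abs_sin_le_one _

lemma contDiff_trig (σ : Bool) (a b : ℝ) (j : ℕ) : ContDiff ℝ ∞ (trig σ a b j) := by
  cases σ
  · exact Real.contDiff_cos.comp (contDiff_const.mul (contDiff_id.sub contDiff_const))
  · exact Real.contDiff_sin.comp (contDiff_const.mul (contDiff_id.sub contDiff_const))

lemma continuous_trig (σ : Bool) (a b : ℝ) (j : ℕ) : Continuous (trig σ a b j) :=
  (contDiff_trig σ a b j).continuous

/-- The sign with which the derivative of one trigonometric system is the other one. -/
def trigSign (σ : Bool) : ℝ := bif σ then 1 else -1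

lemma hasDerivAt_trig (σ : Bool) (a b : ℝ) (j : ℕ) (x : ℝ) :
    HasDerivAt (trig σ a b j) (trigSign σ * freq a b j * trig (!σ) a b j x) x := by
  have h : HasDerivAt (fun y => freq a b j * (y - a)) (freq a b j) x := by
    simpa using ((hasDerivAt_id x).sub_const a).const_mul (freq a b j)
  cases σ
  · exact h.cos.congr_deriv (by simp [trig, trigSign, mul_comm])
  · exact h.sin.congr_deriv (by simp [trig, trigSign, mul_comm])

lemma integral_cos_int_mul {a b : ℝ} (h : a < b) {m : ℤ} (hm : m ≠ 0) :
    ∫ x in a..b, Real.cos (m * (Real.pi / (b - a)) * (x - a)) = 0 := by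
  have hL := sub_pos.2 h
  have hc : (m * (Real.pi / (b - a)) : ℝ) ≠ 0 :=
    mul_ne_zero (Int.cast_ne_zero.2 hm) (by positivity)
  have e : ∀ x, (m * (Real.pi / (b - a)) * (x - a) : ℝ)
      = m * (Real.pi / (b - a)) * x - m * (Real.pi / (b - a)) * a := fun x => by ring
  simp_rw [e]
  rw [intervalIntegral.integral_comp_mul_sub Real.cos hc, integral_cos]
  have : m * (Real.pi / (b - a)) * b - m * (Real.pi / (b - a)) * a = m * Real.pi := by
    field_simp
  rw [this, sub_self, Real.sin_int_mul_pi, Real.sin_zero, sub_zero, smul_zero]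

lemma integral_trig_mul_trig {a b : ℝ} (h : a < b) (σ : Bool) (j k : ℕ) :
    ∫ x in a..b, trig σ a b j x * trig σ a b k x = if j = k then (b - a) / 2 else 0 := by
  have key : ∀ x, trig σ a b j x * trig σ a b k x
      = 1 / 2 * Real.cos (((j : ℤ) - (k : ℤ) : ℤ) * (Real.pi / (b - a)) * (x - a))
        + (-trigSign σ / 2) * Real.cos (((j : ℤ) + (k : ℤ) + 2 : ℤ) * (Real.pi / (b - a)) * (x - a)) := by
    intro x
    have e1 : (((j : ℤ) - (k : ℤ) : ℤ) * (Real.pi / (b - a)) * (x - a) : ℝ)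
        = freq a b j * (x - a) - freq a b k * (x - a) := by
      simp only [freq]; push_cast; ring
    have e2 : (((j : ℤ) + (k : ℤ) + 2 : ℤ) * (Real.pi / (b - a)) * (x - a) : ℝ)
        = freq a b j * (x - a) + freq a b k * (x - a) := by
      simp only [freq]; push_cast; ring
    rw [e1, e2, Real.cos_sub, Real.cos_add]
    cases σ <;> simp [trig, trigSign] <;> ring
  simp_rw [key]
  rw [intervalIntegral.integral_add, intervalIntegral.integral_const_mul,
    intervalIntegral.integral_const_mul, integral_cos_int_mul h (m := (j : ℤ) + k + 2) (by omega)]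
  · split_ifs with hjk
    · subst hjk
      simp
      ring
    · rw [integral_cos_int_mul h (by omega)]
      simp
  all_goals exact (by fun_prop : Continuous _).intervalIntegrable _ _

/-- The sines are complete in `L¹(a, b)`: their products with polynomials in
`cos (π (x - a) / (b - a))` are again combinations of sines, and these polynomials are dense among
the continuous functions because that cosine is a homeomorphism of `[a, b]` onto `[-1, 1]`. -/
lemma ae_eq_zero_of_integral_mul_sin_eq_zero {a b : ℝ} (hab : a < b) {h : ℝ → ℂ}
    (hh : IntegrableOn h (Ioo a b)) (h0 : ∀ j, ∫ x in Ioo a b, h x * (trig true a b j x : ℂ) = 0) :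
    h =ᵐ[volume.restrict (Ioo a b)] 0 := by
  have hL := sub_pos.2 hab
  set κ := Real.pi / (b - a) with hκ
  have hκ0 : 0 < κ := by positivity
  set c : ℝ → ℝ := fun x => Real.cos (κ * (x - a)) with hc
  set s : ℕ → ℝ → ℝ := fun k x => Real.sin (k * (κ * (x - a))) with hs
  have hcc : Continuous c := by fun_prop
  have hsc : ∀ k, Continuous (s k) := fun k => by fun_prop
  have hint : ∀ {g : ℝ → ℝ} {D : ℝ}, Continuous g → (∀ x ∈ Ioo a b, |g x| ≤ D) →
      IntegrableOn (fun x => h x * (g x : ℂ)) (Ioo a b) := by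
    intro g D hg hD
    refine Integrable.mul_bdd (c := D) hh (by fun_prop) ?_
    refine (ae_restrict_iff' measurableSet_Ioo).2 (ae_of_all _ fun x hx => ?_)
    simpa using hD x hx
  have hbd : ∀ j k x, |s k x * c x ^ j| ≤ 1 := by
    intro j k x
    rw [abs_mul, abs_pow]
    exact mul_le_one₀ (Real.abs_sin_le_one _) (by positivity)
      (pow_le_one₀ (abs_nonneg _) (Real.abs_cos_le_one _))
  have step : ∀ j k, ∫ x in Ioo a b, h x * ((s k x * c x ^ j : ℝ) : ℂ) = 0 := by
    intro j
    induction j with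
    | zero =>
      intro k
      rcases k with _ | k
      · simp [hs]
      · rw [← h0 k]
        congr 1; ext x
        simp only [hs, trig, freq, hκ, pow_zero, mul_one, cond_true]
        congr 3; push_cast; ring
    | succ j ih =>
      intro k
      rcases k with _ | k
      · simp [hs]
      · have e : ∀ x, h x * ((s (k + 1) x * c x ^ (j + 1) : ℝ) : ℂ)
            = (1 / 2 : ℂ) * (h x * ((s (k + 2) x * c x ^ j : ℝ) : ℂ))
              + (1 / 2 : ℂ) * (h x * ((s k x * c x ^ j : ℝ) : ℂ)) := by
          intro x
          have : s (k + 1) x * c x = 1 / 2 * s (k + 2) x + 1 / 2 * s k x := by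
            simp only [hs, hc]
            have e1 : ((k + 2 : ℕ) : ℝ) * (κ * (x - a))
              = ((k + 1 : ℕ) : ℝ) * (κ * (x - a)) + κ * (x - a) := by push_cast; ring
            have e2 : (k : ℝ) * (κ * (x - a))
              = ((k + 1 : ℕ) : ℝ) * (κ * (x - a)) - κ * (x - a) := by push_cast; ring
            rw [e1, e2, Real.sin_add, Real.sin_sub]; ring
          rw [pow_succ', ← mul_assoc, this]; push_cast; ring
        simp_rw [e]
        rw [integral_add, integral_const_mul, integral_const_mul, ih, ih]
        · simp
        · exact (hint (by fun_prop) fun x _ => hbd j (k + 2) x).const_mul _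
        · exact (hint (by fun_prop) fun x _ => hbd j k x).const_mul _
  have hpoly : ∀ p : Polynomial ℝ, ∫ x in Ioo a b, h x * ((s 1 x * p.eval (c x) : ℝ) : ℂ) = 0 := by
    intro p
    have e : ∀ x, h x * ((s 1 x * p.eval (c x) : ℝ) : ℂ)
        = ∑ i ∈ Finset.range (p.natDegree + 1),
          (p.coeff i : ℂ) * (h x * ((s 1 x * c x ^ i : ℝ) : ℂ)) := by
      intro x
      rw [Polynomial.eval_eq_sum_range]
      push_cast
      rw [Finset.mul_sum, Finset.mul_sum]
      exact Finset.sum_congr rfl fun i _ => by ring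
    simp_rw [e]
    rw [integral_finsetSum]
    · simp_rw [integral_const_mul, step]; simp
    · exact fun i _ => (hint (by fun_prop) fun x _ => hbd i 1 x).const_mul _
  have hcont : ∀ G : ℝ → ℝ, Continuous G → ∫ x in Ioo a b, h x * ((s 1 x * G x : ℝ) : ℂ) = 0 := by
    intro G hG
    set F : ℝ → ℝ := fun y => G (a + Real.arccos y / κ) with hF
    have hFc : Continuous F := by
      have := Real.continuous_arccos
      fun_prop
    have hFG : ∀ x ∈ Ioo a b, F (c x) = G x := by
      intro x hx
      simp only [hF, hc]
      rw [Real.arccos_cos (by have := sub_pos.2 hx.1; positivity)]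
      · congr 1; field_simp; ring
      · rw [hκ, div_mul_eq_mul_div, div_le_iff₀ hL]
        exact mul_le_mul_of_nonneg_left (by linarith [hx.2]) Real.pi_pos.le
    have hI : 0 ≤ ∫ x in Ioo a b, ‖h x‖ := by positivity
    refine norm_le_zero_iff.1 (le_of_forall_pos_le_add fun ε hε => ?_)
    obtain ⟨p, hp⟩ := exists_polynomial_near_of_continuousOn (-1) 1 F hFc.continuousOn
      (ε / ((∫ x in Ioo a b, ‖h x‖) + 1)) (by positivity)
    have hcm : ∀ x, c x ∈ Icc (-1 : ℝ) 1 := fun x => Real.cos_mem_Icc _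
    have e : ∫ x in Ioo a b, h x * ((s 1 x * G x : ℝ) : ℂ)
        = ∫ x in Ioo a b, h x * ((s 1 x * (F (c x) - p.eval (c x)) : ℝ) : ℂ) := by
      rw [← sub_zero (∫ x in Ioo a b, h x * ((s 1 x * G x : ℝ) : ℂ)), ← hpoly p, ← integral_sub]
      · refine setIntegral_congr_fun measurableSet_Ioo fun x hx => ?_
        simp only [hFG x hx]; push_cast; ring
      · obtain ⟨D, hD⟩ := (isCompact_Icc (a := a) (b := b)).exists_bound_of_continuousOn
          (f := fun x => s 1 x * G x) (by fun_prop)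
        exact hint (by fun_prop) fun x hx => hD x (Ioo_subset_Icc_self hx)
      · obtain ⟨D, hD⟩ := (isCompact_Icc (a := a) (b := b)).exists_bound_of_continuousOn
          (f := fun x => s 1 x * p.eval (c x)) (by fun_prop)
        exact hint (by fun_prop) fun x hx => hD x (Ioo_subset_Icc_self hx)
    rw [e, zero_add]
    set δ := ε / ((∫ x in Ioo a b, ‖h x‖) + 1)
    calc _ ≤ ∫ x in Ioo a b, δ * ‖h x‖ := by
          refine norm_integral_le_of_norm_le (hh.norm.const_mul _) (ae_of_all _ fun x => ?_)
          rw [norm_mul, mul_comm, Complex.norm_real, norm_mul]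
          refine mul_le_mul_of_nonneg_right ?_ (norm_nonneg _)
          calc _ ≤ 1 * δ := mul_le_mul (Real.abs_sin_le_one _)
                (by rw [Real.norm_eq_abs, abs_sub_comm]; exact (hp _ (hcm x)).le)
                (norm_nonneg _) zero_le_one
            _ = δ := one_mul _
      _ = δ * ∫ x in Ioo a b, ‖h x‖ := integral_const_mul _ _
      _ ≤ ε := by
          rw [div_mul_eq_mul_div, div_le_iff₀ (by positivity)]
          nlinarith
  have hz := isOpen_Ioo.ae_eq_zero_of_integral_contDiff_smul_eq_zero (μ := volume)
    (f := fun x => h x * (s 1 x : ℂ)) (U := Ioo a b)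
    (IntegrableOn.locallyIntegrableOn (hint (hsc 1) fun x _ => Real.abs_sin_le_one _)) (by
      intro g hg _ hgU
      have : ∫ x, g x • (h x * (s 1 x : ℂ)) = ∫ x in Ioo a b, g x • (h x * (s 1 x : ℂ)) := by
        refine (setIntegral_eq_integral_of_forall_compl_eq_zero fun x hx => ?_).symm
        rw [image_eq_zero_of_notMem_tsupport fun hx' => hx (hgU hx'), zero_smul]
      rw [this, ← hcont g hg.continuous]
      congr 1; ext x
      simp only [Complex.real_smul]; push_cast; ring)
  refine (ae_restrict_iff' measurableSet_Ioo).2 (hz.mono fun x hx hxU => ?_)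
  have hsx : s 1 x ≠ 0 := by
    refine (Real.sin_pos_of_pos_of_lt_pi ?_ ?_).ne'
    · have := sub_pos.2 hxU.1
      push_cast; positivity
    · push_cast
      rw [one_mul, hκ, div_mul_eq_mul_div, div_lt_iff₀ hL]
      exact mul_lt_mul_of_pos_left (by linarith [hxU.2]) Real.pi_pos
  simpa [hsx] using hx hxU

/-! ### Test functions and weak derivatives -/

lemma IsTestFunction.mul_left {V : Type*} [NormedAddCommGroup V] [NormedSpace ℝ V]
    {U : Set V} {φ ρ : V → ℂ} (hφ : IsTestFunction U φ) (hρ : ContDiff ℝ ∞ ρ) :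
    IsTestFunction U (fun x => ρ x * φ x) :=
  ⟨hρ.mul hφ.1, hφ.2.1.mul_left, tsupport_mul_subset_right.trans hφ.2.2⟩

lemma IsTestFunction.fderiv_apply {V : Type*} [NormedAddCommGroup V] [NormedSpace ℝ V]
    {U : Set V} {φ : V → ℂ} (hφ : IsTestFunction U φ) (e : V) :
    IsTestFunction U (fun x => fderiv ℝ φ x e) :=
  ⟨(hφ.1.fderiv_right (by simp)).clm_apply contDiff_const, hφ.2.1.fderiv_apply ℝ e,
    (tsupport_fderiv_apply_subset ℝ e).trans hφ.2.2⟩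

lemma IsTestFunction.conj {V : Type*} [NormedAddCommGroup V] [NormedSpace ℝ V]
    {U : Set V} {φ : V → ℂ} (hφ : IsTestFunction U φ) :
    IsTestFunction U (fun x => (starRingEnd ℂ) (φ x)) := by
  refine ⟨Complex.conjCLE.contDiff.comp hφ.1, hφ.2.1.comp_left (map_zero _), ?_⟩
  refine subset_trans (closure_mono ?_) hφ.2.2
  exact fun x hx hx' => hx (by simp only [hx', map_zero])

lemma IsTestFunction.differentiable {V : Type*} [NormedAddCommGroup V] [NormedSpace ℝ V]
    {U : Set V} {φ : V → ℂ} (hφ : IsTestFunction U φ) : Differentiable ℝ φ :=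
  hφ.1.differentiable (by simp)

lemma IsTestFunction.exists_bound {V : Type*} [NormedAddCommGroup V] [NormedSpace ℝ V]
    {U : Set V} {φ : V → ℂ} (hφ : IsTestFunction U φ) : ∃ C, ∀ x, ‖φ x‖ ≤ C :=
  hφ.1.continuous.bounded_above_of_compact_support hφ.2.1

lemma IsTestFunction.integrableOn_mul {V : Type*} [NormedAddCommGroup V] [NormedSpace ℝ V]
    [FiniteDimensional ℝ V] [MeasureSpace V] [BorelSpace V] {U : Set V} {φ u : V → ℂ}
    (hφ : IsTestFunction U φ) (hu : LocallyIntegrableOn u U) :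
    IntegrableOn (fun x => u x * φ x) U := by
  obtain ⟨C, hC⟩ := hφ.exists_bound
  have hK := hu.integrableOn_compact_subset hφ.2.2 hφ.2.1
  have : IntegrableOn (fun x => u x * φ x) (tsupport φ) :=
    Integrable.mul_bdd hK hφ.1.continuous.aestronglyMeasurable (ae_of_all _ hC)
  refine ((integrableOn_iff_integrable_of_support_subset fun x hx => ?_).1 this).integrableOn
  exact subset_tsupport φ fun h => hx (by simp [h])

lemma IsTestFunction.slice_right {V W : Type*} [NormedAddCommGroup V] [NormedSpace ℝ V]
    [NormedAddCommGroup W] [NormedSpace ℝ W] {U : Set V} {U' : Set W} {φ : V × W → ℂ}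
    (hφ : IsTestFunction (U ×ˢ U') φ) (x : V) : IsTestFunction U' (fun y => φ (x, y)) := by
  have hc : Continuous fun y : W => (x, y) := by fun_prop
  have hs := tsupport_comp_subset_preimage φ hc
  refine ⟨hφ.1.comp (contDiff_const.prodMk contDiff_id), ?_, fun y hy => (hφ.2.2 (hs hy)).2⟩
  exact (hφ.2.1.isCompact.image continuous_snd).of_isClosed_subset (isClosed_tsupport _)
    fun y hy => ⟨(x, y), hs hy, rfl⟩

lemma IsTestFunction.slice_left {V W : Type*} [NormedAddCommGroup V] [NormedSpace ℝ V]
    [NormedAddCommGroup W] [NormedSpace ℝ W] {U : Set V} {U' : Set W} {φ : V × W → ℂ}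
    (hφ : IsTestFunction (U ×ˢ U') φ) (y : W) : IsTestFunction U (fun x => φ (x, y)) := by
  have hc : Continuous fun x : V => (x, y) := by fun_prop
  have hs := tsupport_comp_subset_preimage φ hc
  refine ⟨hφ.1.comp (contDiff_id.prodMk contDiff_const), ?_, fun x hx => (hφ.2.2 (hs hx)).1⟩
  exact (hφ.2.1.isCompact.image continuous_fst).of_isClosed_subset (isClosed_tsupport _)
    fun x hx => ⟨(x, y), hs hx, rfl⟩

lemma fderiv_slice_right {V W : Type*} [NormedAddCommGroup V] [NormedSpace ℝ V]
    [NormedAddCommGroup W] [NormedSpace ℝ W] {φ : V × W → ℂ} (hφ : Differentiable ℝ φ)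
    (x : V) (y e : W) : fderiv ℝ (fun y => φ (x, y)) y e = fderiv ℝ φ (x, y) (0, e) := by
  have h := (hφ (x, y)).hasFDerivAt.comp y ((hasFDerivAt_const x y).prodMk (hasFDerivAt_id y))
  have := h.fderiv
  simp only [Function.comp_def] at this
  rw [this]; simp

lemma fderiv_slice_left {V W : Type*} [NormedAddCommGroup V] [NormedSpace ℝ V]
    [NormedAddCommGroup W] [NormedSpace ℝ W] {φ : V × W → ℂ} (hφ : Differentiable ℝ φ)
    (x e : V) (y : W) : fderiv ℝ (fun x => φ (x, y)) x e = fderiv ℝ φ (x, y) (e, 0) := by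
  have h := (hφ (x, y)).hasFDerivAt.comp (f := fun x => (x, y)) x
    ((hasFDerivAt_id x).prodMk (hasFDerivAt_const y x))
  have := h.fderiv
  simp only [Function.comp_def] at this
  rw [this]; simp

lemma hasWeakDeriv_of_contDiff {V : Type*} [NormedAddCommGroup V] [NormedSpace ℝ V]
    [FiniteDimensional ℝ V] [MeasureSpace V] [BorelSpace V] [(volume : Measure V).IsAddHaarMeasure]
    {U : Set V} {u : V → ℂ} (hu : ContDiff ℝ 1 u) (e : V) :
    HasWeakDeriv U e u (fun x => fderiv ℝ u x e) := by
  have hu' : Continuous fun x => fderiv ℝ u x e :=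
    (hu.continuous_fderiv (by simp)).clm_apply continuous_const
  refine ⟨hu.continuous.locallyIntegrable.locallyIntegrableOn _,
    hu'.locallyIntegrable.locallyIntegrableOn _, fun φ hφ => ?_⟩
  have hφ' := hφ.fderiv_apply e
  rw [setIntegral_eq_integral_of_forall_compl_eq_zero, setIntegral_eq_integral_of_forall_compl_eq_zero]
  · refine integral_mul_fderiv_eq_neg_fderiv_mul_of_integrable ?_ ?_ ?_
      (fun x _ => hu.differentiable (by simp) x) (fun x _ => hφ.differentiable x)
    · exact (hu'.mul hφ.1.continuous).integrable_of_hasCompactSupport hφ.2.1.mul_left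
    · exact (hu.continuous.mul hφ'.1.continuous).integrable_of_hasCompactSupport hφ'.2.1.mul_left
    · exact (hu.continuous.mul hφ.1.continuous).integrable_of_hasCompactSupport hφ.2.1.mul_left
  · intro x hx
    rw [image_eq_zero_of_notMem_tsupport fun h => hx (hφ.2.2 h), mul_zero]
  · intro x hx
    rw [image_eq_zero_of_notMem_tsupport (f := fun x => fderiv ℝ φ x e)
      fun h => hx (hφ'.2.2 h), mul_zero]

lemma HasWeakDeriv.congr {V : Type*} [NormedAddCommGroup V] [NormedSpace ℝ V]
    [MeasureSpace V] {U : Set V} {e : V} {u g u' g' : V → ℂ}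
    (h : HasWeakDeriv U e u g)
    (hu : u =ᵐ[volume.restrict U] u') (hg : g =ᵐ[volume.restrict U] g') :
    HasWeakDeriv U e u' g' := by
  have aux : ∀ {f f' : V → ℂ}, f =ᵐ[volume.restrict U] f' → LocallyIntegrableOn f U →
      LocallyIntegrableOn f' U := by
    intro f f' hff hf x hx
    obtain ⟨s, hs, hfs⟩ := hf x hx
    refine ⟨s ∩ U, inter_mem hs self_mem_nhdsWithin, (hfs.mono_set inter_subset_left).congr ?_⟩
    exact ae_mono (Measure.restrict_mono inter_subset_right le_rfl) hff
  refine ⟨aux hu h.1, aux hg h.2.1, fun φ hφ => ?_⟩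
  have e1 : ∫ x in U, u' x * fderiv ℝ φ x e = ∫ x in U, u x * fderiv ℝ φ x e :=
    integral_congr_ae (hu.mono fun x hx => by simp only [hx])
  have e2 : ∫ x in U, g' x * φ x = ∫ x in U, g x * φ x :=
    integral_congr_ae (hg.mono fun x hx => by simp only [hx])
  rw [e1, e2, h.2.2 φ hφ]

/-- The product rule for a weak derivative and a smooth factor. -/
lemma HasWeakDeriv.smooth_mul {V : Type*} [NormedAddCommGroup V] [NormedSpace ℝ V]
    [FiniteDimensional ℝ V] [MeasureSpace V] [BorelSpace V] {U : Set V} (hU : IsOpen U) {e : V}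
    {u g ρ : V → ℂ} (h : HasWeakDeriv U e u g) (hρ : ContDiff ℝ ∞ ρ) :
    HasWeakDeriv U e (fun x => ρ x * u x) (fun x => ρ x * g x + fderiv ℝ ρ x e * u x) := by
  have hρ' : ContDiff ℝ ∞ (fun x => fderiv ℝ ρ x e) :=
    (hρ.fderiv_right (by simp)).clm_apply contDiff_const
  have hm : ∀ {ρ f : V → ℂ}, ContDiff ℝ ∞ ρ → LocallyIntegrableOn f U →
      LocallyIntegrableOn (fun x => ρ x * f x) U := fun hρ hf => by
    have := FiniteDimensional.proper ℝ V
    exact hf.continuousOn_mul hρ.continuous.continuousOn hU.isLocallyClosed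
  refine ⟨hm hρ h.1, (hm hρ h.2.1).add (hm hρ' h.1), fun φ hφ => ?_⟩
  have hd : ∀ x, fderiv ℝ (fun x => ρ x * φ x) x e = ρ x * fderiv ℝ φ x e + fderiv ℝ ρ x e * φ x := by
    intro x
    have := ((hρ.differentiable (by simp) x).hasFDerivAt.mul (hφ.differentiable x).hasFDerivAt).fderiv
    rw [show (fun x => ρ x * φ x) = ρ * φ from rfl, this]
    simp [mul_comm]
  have i1 := (hφ.mul_left hρ).integrableOn_mul h.2.1
  have i2 := ((hφ.mul_left hρ).fderiv_apply e).integrableOn_mul h.1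
  have i3 := (hφ.mul_left hρ').integrableOn_mul h.1
  calc ∫ x in U, ρ x * u x * fderiv ℝ φ x e
      = ∫ x in U, (u x * fderiv ℝ (fun x => ρ x * φ x) x e - u x * (fderiv ℝ ρ x e * φ x)) := by
        congr 1; ext x; rw [hd]; ring
    _ = -∫ x in U, (g x * (ρ x * φ x) + u x * (fderiv ℝ ρ x e * φ x)) := by
        rw [integral_sub i2 i3, integral_add i1 i3, h.2.2 _ (hφ.mul_left hρ)]; ring
    _ = _ := by
        congr 2; ext x; ring

/-- Weak derivatives of a tensor product in a direction of the second factor. -/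
lemma HasWeakDeriv.tensor_right {V W : Type*} [NormedAddCommGroup V] [NormedSpace ℝ V]
    [FiniteDimensional ℝ V] [MeasureSpace V] [BorelSpace V] [SFinite (volume : Measure V)]
    [NormedAddCommGroup W] [NormedSpace ℝ W] [FiniteDimensional ℝ W] [MeasureSpace W]
    [BorelSpace W] [SFinite (volume : Measure W)] {U : Set V} {U' : Set W} {e : W}
    {v : V → ℂ} {ψ ψ' : W → ℂ} (hv : IntegrableOn v U) (hψ : IntegrableOn ψ U')
    (hψ' : IntegrableOn ψ' U') (h : HasWeakDeriv U' e ψ ψ') :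
    HasWeakDeriv (U ×ˢ U') (0, e) (fun x : V × W => v x.1 * ψ x.2) (fun x => v x.1 * ψ' x.2) := by
  have hi : ∀ {ψ : W → ℂ}, IntegrableOn ψ U' →
      IntegrableOn (fun x : V × W => v x.1 * ψ x.2) (U ×ˢ U') := fun hψ => by
    rw [IntegrableOn, Measure.volume_eq_prod, ← Measure.prod_restrict]
    exact hv.mul_prod hψ
  refine ⟨(hi hψ).locallyIntegrableOn, (hi hψ').locallyIntegrableOn, fun φ hφ => ?_⟩
  have i1 := (hφ.fderiv_apply (0, e)).integrableOn_mul (hi hψ).locallyIntegrableOn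
  have i2 := hφ.integrableOn_mul (hi hψ').locallyIntegrableOn
  rw [Measure.volume_eq_prod] at i1 i2 ⊢
  rw [setIntegral_prod _ i1, setIntegral_prod _ i2, ← integral_neg]
  congr 1; ext x
  simp_rw [mul_assoc, integral_const_mul, ← fderiv_slice_right hφ.differentiable]
  rw [h.2.2 _ (hφ.slice_right x), mul_neg]

/-- Weak derivatives of a tensor product in a direction of the first factor. -/
lemma HasWeakDeriv.tensor_left {V W : Type*} [NormedAddCommGroup V] [NormedSpace ℝ V]
    [FiniteDimensional ℝ V] [MeasureSpace V] [BorelSpace V] [SFinite (volume : Measure V)]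
    [NormedAddCommGroup W] [NormedSpace ℝ W] [FiniteDimensional ℝ W] [MeasureSpace W]
    [BorelSpace W] [SFinite (volume : Measure W)] {U : Set V} {U' : Set W} {e : V}
    {v v' : V → ℂ} {ψ : W → ℂ} (hv : IntegrableOn v U) (hv' : IntegrableOn v' U)
    (hψ : IntegrableOn ψ U') (h : HasWeakDeriv U e v v') :
    HasWeakDeriv (U ×ˢ U') (e, 0) (fun x : V × W => v x.1 * ψ x.2) (fun x => v' x.1 * ψ x.2) := by
  have hi : ∀ {v : V → ℂ}, IntegrableOn v U →
      IntegrableOn (fun x : V × W => v x.1 * ψ x.2) (U ×ˢ U') := fun hv => by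
    rw [IntegrableOn, Measure.volume_eq_prod, ← Measure.prod_restrict]
    exact hv.mul_prod hψ
  refine ⟨(hi hv).locallyIntegrableOn, (hi hv').locallyIntegrableOn, fun φ hφ => ?_⟩
  have i1 := (hφ.fderiv_apply (e, 0)).integrableOn_mul (hi hv).locallyIntegrableOn
  have i2 := hφ.integrableOn_mul (hi hv').locallyIntegrableOn
  rw [IntegrableOn, Measure.volume_eq_prod, ← Measure.prod_restrict] at i1 i2
  rw [Measure.volume_eq_prod, ← Measure.prod_restrict, integral_prod_symm _ i1,
    integral_prod_symm _ i2, ← integral_neg]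
  congr 1; ext y
  simp_rw [mul_assoc, mul_left_comm _ (ψ y), integral_const_mul,
    ← fderiv_slice_left hφ.differentiable]
  rw [h.2.2 _ (hφ.slice_left y), mul_neg]

lemma hasSum_integral_mul {X ι : Type*} [MeasurableSpace X] {μ : Measure X} {F : ι → Lp ℂ 2 μ}
    {u : Lp ℂ 2 μ} (h : HasSum F u) {χ : X → ℂ} (hχ : MemLp χ 2 μ) :
    HasSum (fun n => ∫ x, F n x * χ x ∂μ) (∫ x, u x * χ x ∂μ) := by
  have hχ' : MemLp (fun x => (starRingEnd ℂ) (χ x)) 2 μ := hχ.star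
  have key : ∀ f : Lp ℂ 2 μ, innerSL ℂ (hχ'.toLp) f = ∫ x, f x * χ x ∂μ := by
    intro f
    rw [innerSL_apply_apply, L2.inner_def]
    refine integral_congr_ae (hχ'.coeFn_toLp.mono fun x hx => ?_)
    simp [hx]
  simpa only [key] using h.mapL (innerSL ℂ (hχ'.toLp))

lemma IsTestFunction.memLp {V : Type*} [NormedAddCommGroup V] [NormedSpace ℝ V]
    [FiniteDimensional ℝ V] [MeasureSpace V] [BorelSpace V]
    [IsFiniteMeasureOnCompacts (volume : Measure V)] {U : Set V} {φ : V → ℂ}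
    (hφ : IsTestFunction U φ) (p : ℝ≥0∞) : MemLp φ p (volume.restrict U) :=
  (hφ.1.continuous.memLp_of_hasCompactSupport hφ.2.1).restrict U

lemma Lp.integrableOn {V : Type*} [MeasureSpace V] {U : Set V} (hU : volume U ≠ ⊤)
    (u : Lp ℂ 2 ((volume : Measure V).restrict U)) : IntegrableOn u U := by
  have : IsFiniteMeasure ((volume : Measure V).restrict U) := ⟨by simpa using hU.lt_top⟩
  exact (Lp.memLp u).integrable (by norm_num)

/-- Weak derivatives may be taken term by term in `L²`-convergent series. -/
lemma HasWeakDeriv.of_hasSum {V ι : Type*} [NormedAddCommGroup V] [NormedSpace ℝ V]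
    [FiniteDimensional ℝ V] [MeasureSpace V] [BorelSpace V]
    [IsFiniteMeasureOnCompacts (volume : Measure V)] {U : Set V} (hU : volume U ≠ ⊤) {e : V}
    {F G : ι → Lp ℂ 2 ((volume : Measure V).restrict U)}
    {u g : Lp ℂ 2 ((volume : Measure V).restrict U)} (hF : HasSum F u) (hG : HasSum G g)
    (h : ∀ n, HasWeakDeriv U e (F n) (G n)) : HasWeakDeriv U e u g := by
  refine ⟨(Lp.integrableOn hU u).locallyIntegrableOn, (Lp.integrableOn hU g).locallyIntegrableOn,
    fun φ hφ => ?_⟩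
  refine (hasSum_integral_mul hF ((hφ.fderiv_apply e).memLp 2)).unique ?_
  simp_rw [(h _).2.2 φ hφ]
  exact (hasSum_integral_mul hG (hφ.memLp 2)).neg

/-! ### The Green kernel of the conjugated operator in one variable -/

/-- The coefficient of `e^{(l + μ) t}` on `t < 0` in `greenKernel l μ`. -/
noncomputable def greenCoeff (l μ : ℝ) : ℝ := if -μ < l then 1 / (2 * μ) else 0

/-- The restriction to `t < 0` of `greenKernel l μ`, and of its derivative for `i = 1`. -/
noncomputable def greenNeg (i : ℕ) (l μ t : ℝ) : ℝ :=
  greenCoeff l μ * ((l + μ) ^ i * Real.exp ((l + μ) * t))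
    - (1 / (2 * μ) - greenCoeff (-l) μ) * ((l - μ) ^ i * Real.exp ((l - μ) * t))

/-- The restriction to `t ≥ 0` of `greenKernel l μ`, and of its derivative for `i = 1`. -/
noncomputable def greenPos (i : ℕ) (l μ t : ℝ) : ℝ :=
  -(1 / (2 * μ) - greenCoeff l μ) * ((l + μ) ^ i * Real.exp ((l + μ) * t))
    + greenCoeff (-l) μ * ((l - μ) ^ i * Real.exp ((l - μ) * t))

/-- The function that is `p` on the negative and `q` on the nonnegative half-line. -/
noncomputable def glue (p q : ℝ → ℝ) (t : ℝ) : ℝ := if t < 0 then p t else q t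

/-- The fundamental solution of `-(d/dt - l)² + μ²` that is bounded on the line (`i = 0`), and its
derivatives off the origin. It is the combination of the bounded one-sided exponentials
`e^{(l ± μ) t}`; each of these lives on the half-line on which it decays. -/
noncomputable def greenKernel (i : ℕ) (l μ : ℝ) : ℝ → ℝ := glue (greenNeg i l μ) (greenPos i l μ)

lemma hasDerivAt_greenNeg (i : ℕ) (l μ t : ℝ) :
    HasDerivAt (greenNeg i l μ) (greenNeg (i + 1) l μ t) t := by
  have h : ∀ a : ℝ, HasDerivAt (fun t => Real.exp (a * t)) (a * Real.exp (a * t)) t := fun a => by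
    simpa [mul_comm] using ((hasDerivAt_id t).const_mul a).exp
  refine ((((h (l + μ)).const_mul _).const_mul _).sub
    (((h (l - μ)).const_mul _).const_mul _)).congr_deriv ?_
  simp only [greenNeg]; ring

lemma hasDerivAt_greenPos (i : ℕ) (l μ t : ℝ) :
    HasDerivAt (greenPos i l μ) (greenPos (i + 1) l μ t) t := by
  have h : ∀ a : ℝ, HasDerivAt (fun t => Real.exp (a * t)) (a * Real.exp (a * t)) t := fun a => by
    simpa [mul_comm] using ((hasDerivAt_id t).const_mul a).exp
  refine ((((h (l + μ)).const_mul _).const_mul _).add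
    (((h (l - μ)).const_mul _).const_mul _)).congr_deriv ?_
  simp only [greenPos]; ring

lemma measurable_greenKernel (i : ℕ) (l μ : ℝ) : Measurable (greenKernel i l μ) :=
  Measurable.ite measurableSet_Iio
    (continuous_iff_continuousAt.2 fun t => (hasDerivAt_greenNeg i l μ t).continuousAt).measurable
    (continuous_iff_continuousAt.2 fun t => (hasDerivAt_greenPos i l μ t).continuousAt).measurable

lemma greenKernel_zero_jump (l μ : ℝ) : greenPos 0 l μ 0 - greenNeg 0 l μ 0 = 0 := by
  simp only [greenPos, greenNeg, mul_zero, Real.exp_zero]; ring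

lemma greenKernel_one_jump {μ : ℝ} (hμ : 0 < μ) (l : ℝ) :
    greenPos 1 l μ 0 - greenNeg 1 l μ 0 = -1 := by
  simp only [greenPos, greenNeg, mul_zero, Real.exp_zero]; field_simp; ring

lemma greenKernel_two (l μ t : ℝ) :
    greenKernel 2 l μ t = 2 * l * greenKernel 1 l μ t + (μ ^ 2 - l ^ 2) * greenKernel 0 l μ t := by
  simp only [greenKernel, glue]
  split_ifs <;> simp only [greenNeg, greenPos] <;> ring

/-- Transposing the kernel amounts to changing the sign of `l`. -/
lemma greenKernel_neg (l μ t : ℝ) : greenKernel 0 (-l) μ t = greenKernel 0 l μ (-t) := by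
  have e1 : (-l + μ) * t = (l - μ) * -t := by ring
  have e2 : (-l - μ) * t = (l + μ) * -t := by ring
  rcases lt_trichotomy t 0 with h | rfl | h
  · rw [greenKernel, greenKernel, glue, glue, if_pos h, if_neg (by linarith), greenNeg, greenPos,
      neg_neg, e1, e2]
    ring
  · rw [greenKernel, greenKernel, glue, glue, if_neg (lt_irrefl _), if_neg (by simp), greenPos,
      greenPos, neg_neg, e1, e2]
    simp only [neg_zero, mul_zero, Real.exp_zero]; ring
  · rw [greenKernel, greenKernel, glue, glue, if_neg (by linarith), if_pos (by linarith), greenNeg,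
      greenPos, neg_neg, e1, e2]
    ring

lemma greenKernel_eq_of_lt {l μ : ℝ} (h : |l| < μ) (i : ℕ) (t : ℝ) :
    greenKernel i l μ t = if t < 0 then (l + μ) ^ i * Real.exp (-((μ + l) * |t|)) / (2 * μ)
      else (l - μ) ^ i * Real.exp (-((μ - l) * |t|)) / (2 * μ) := by
  obtain ⟨h1, h2⟩ := abs_lt.1 h
  rw [greenKernel, glue]
  simp only [greenNeg, greenPos, greenCoeff, if_pos h1, neg_lt_neg_iff, if_pos h2, sub_self,
    neg_zero, zero_mul, sub_zero, zero_add]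
  split_ifs with ht
  · rw [abs_of_neg ht]; ring_nf
  · rw [abs_of_nonneg (not_lt.1 ht)]; ring_nf

lemma greenKernel_eq_of_le {l μ : ℝ} (hμ : 0 < μ) (h : μ ≤ |l|) (i : ℕ) (t : ℝ) :
    |greenKernel i l μ t| = 0 ∨ |greenKernel i l μ t| =
      |(|l| - μ) ^ i * Real.exp (-((|l| - μ) * |t|)) - (|l| + μ) ^ i * Real.exp (-((|l| + μ) * |t|))|
        / (2 * μ) := by
  have aux : ∀ x y : ℝ, x = y / (2 * μ) ∨ x = -(y / (2 * μ)) → |x| = |y| / (2 * μ) := by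
    rintro x y (rfl | rfl)
    · rw [abs_div, abs_of_pos (by positivity : 0 < 2 * μ)]
    · rw [abs_neg, abs_div, abs_of_pos (by positivity : 0 < 2 * μ)]
  rcases le_total 0 l with hl | hl
  · rw [abs_of_nonneg hl] at h ⊢
    simp only [greenKernel, glue]
    split_ifs with ht
    · right
      simp only [greenNeg, greenCoeff, if_pos (show -μ < l by linarith),
        if_neg (show ¬ -μ < -l by linarith), abs_of_neg ht]
      exact aux _ _ (Or.inr (by ring_nf))
    · left
      simp only [greenPos, greenCoeff, if_pos (show -μ < l by linarith),
        if_neg (show ¬ -μ < -l by linarith), abs_eq_zero]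
      ring
  · rw [abs_of_nonpos hl] at h ⊢
    simp only [greenKernel, glue]
    split_ifs with ht
    · left
      simp only [greenNeg, greenCoeff, if_pos (show -μ < -l by linarith),
        if_neg (show ¬ -μ < l by linarith), abs_eq_zero]
      ring
    · right
      simp only [greenPos, greenCoeff, if_pos (show -μ < -l by linarith),
        if_neg (show ¬ -μ < l by linarith), abs_of_nonneg (not_lt.1 ht)]
      have e1 : (l + μ) ^ i = (-1) ^ i * (-l - μ) ^ i := by rw [← mul_pow]; ring
      have e2 : (l - μ) ^ i = (-1) ^ i * (-l + μ) ^ i := by rw [← mul_pow]; ring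
      rw [e1, e2]
      refine aux _ _ ?_
      rcases neg_one_pow_eq_or ℝ i with h1 | h1 <;> rw [h1]
      · right; ring_nf
      · left; ring_nf

lemma abs_greenKernel_zero_le {μ : ℝ} (hμ : 0 < μ) (l t : ℝ) :
    |greenKernel 0 l μ t| ≤ Real.exp (-(|(|l| - μ)| * |t|)) / (2 * μ) := by
  rcases lt_or_ge (|l|) μ with h | h
  · have h1 := le_abs_self l
    have h2 := neg_abs_le l
    rw [greenKernel_eq_of_lt h, abs_of_neg (sub_neg.2 h)]
    split_ifs <;>
    · simp only [pow_zero, one_mul]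
      rw [abs_of_nonneg (by positivity)]
      gcongr
      linarith
  · rw [abs_of_nonneg (sub_nonneg.2 h)]
    rcases greenKernel_eq_of_le hμ h 0 t with h0 | h0 <;> rw [h0]
    · positivity
    · simp only [pow_zero, one_mul]
      gcongr
      rw [abs_of_nonneg (sub_nonneg.2 (by gcongr; linarith))]
      linarith [Real.exp_pos (-((|l| + μ) * |t|))]

lemma abs_greenKernel_zero_le_inv {μ : ℝ} (hμ : 0 < μ) (l t : ℝ) :
    |greenKernel 0 l μ t| ≤ 1 / (2 * μ) := by
  refine (abs_greenKernel_zero_le hμ l t).trans ?_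
  gcongr
  exact Real.exp_le_one_iff.2 (by simp; positivity)

/-- The kernel is `O(1 / |l|)` uniformly in `μ`; for small `μ` the two exponentials cancel. -/
lemma abs_greenKernel_zero_le_inv_abs {l μ : ℝ} (hl : l ≠ 0) (hμ : 0 < μ) (t : ℝ) :
    |greenKernel 0 l μ t| ≤ 2 / |l| := by
  have hL : 0 < |l| := abs_pos.2 hl
  rcases le_total (|l|) (2 * μ) with h | h
  · refine (abs_greenKernel_zero_le_inv hμ l t).trans ?_
    calc 1 / (2 * μ) ≤ 1 / |l| := by gcongr
      _ ≤ 2 / |l| := by gcongr; norm_num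
  · rcases greenKernel_eq_of_le hμ (by linarith) 0 t with h0 | h0 <;> rw [h0]
    · positivity
    · simp only [pow_zero, one_mul]
      set s := |t|
      have hs : 0 ≤ s := abs_nonneg t
      have e : Real.exp (-((|l| + μ) * s)) = Real.exp (-((|l| - μ) * s)) * Real.exp (-(2 * μ * s)) := by
        rw [← Real.exp_add]; ring_nf
      rw [abs_of_nonneg (sub_nonneg.2 (by gcongr; linarith)), e, ← mul_one_sub]
      have h1 : 1 - Real.exp (-(2 * μ * s)) ≤ 2 * μ * s := by
        linarith [Real.add_one_le_exp (-(2 * μ * s))]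
      have h2 : Real.exp (-((|l| - μ) * s)) ≤ Real.exp (-(|l| * s / 2)) := by
        gcongr; nlinarith
      have h3 : |l| * s / 2 * Real.exp (-(|l| * s / 2)) ≤ 1 := by
        rw [Real.exp_neg, ← div_eq_mul_inv, div_le_one (Real.exp_pos _)]
        linarith [Real.add_one_le_exp (|l| * s / 2)]
      have h4 : 0 ≤ 1 - Real.exp (-(2 * μ * s)) :=
        sub_nonneg.2 (Real.exp_le_one_iff.2 (by simp; positivity))
      calc _ ≤ Real.exp (-(|l| * s / 2)) * (2 * μ * s) / (2 * μ) := by gcongr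
        _ = 2 / |l| * (|l| * s / 2 * Real.exp (-(|l| * s / 2))) := by field_simp
        _ ≤ 2 / |l| * 1 := by gcongr
        _ = 2 / |l| := mul_one _

lemma abs_greenKernel_one_le {l μ : ℝ} (hl : l ≠ 0) (hμ : 0 < μ) (t : ℝ) :
    |greenKernel 1 l μ t| ≤ 3 := by
  have hL : 0 < |l| := abs_pos.2 hl
  have hs : 0 ≤ |t| := abs_nonneg t
  rcases lt_or_ge (|l|) μ with h | h
  · have h1 := le_abs_self l
    have h2 := neg_abs_le l
    rw [greenKernel_eq_of_lt h]
    have aux : ∀ c d : ℝ, |c| ≤ 2 * μ → 0 ≤ d → |c ^ 1 * Real.exp (-d) / (2 * μ)| ≤ 3 := by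
      intro c d hc hd
      rw [abs_div, abs_mul, pow_one, Real.abs_exp, abs_of_pos (by positivity : 0 < 2 * μ),
        div_le_iff₀ (by positivity)]
      have : Real.exp (-d) ≤ 1 := Real.exp_le_one_iff.2 (by linarith)
      nlinarith [abs_nonneg c, Real.exp_pos (-d)]
    split_ifs
    · exact aux _ _ (abs_le.2 ⟨by linarith, by linarith⟩) (mul_nonneg (by linarith) hs)
    · exact aux _ _ (abs_le.2 ⟨by linarith, by linarith⟩) (mul_nonneg (by linarith) hs)
  · have b0 := abs_greenKernel_zero_le_inv_abs hl hμ t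
    -- The derivative differs from `l` times the kernel by a mean of two decaying exponentials.
    have key : |greenKernel 1 l μ t - l * greenKernel 0 l μ t| ≤ 1 := by
      obtain ⟨A, hA⟩ : ∃ A : ℝ, |A| ≤ 1 / (2 * μ) ∧ ∃ x y : ℝ, x ≤ 0 ∧ y ≤ 0 ∧
          greenKernel 1 l μ t - l * greenKernel 0 l μ t = A * μ * (Real.exp x + Real.exp y) := by
        have hc : |1 / (2 * μ)| ≤ 1 / (2 * μ) := (abs_of_nonneg (by positivity)).le
        rcases le_total 0 l with hl0 | hl0
        · rw [abs_of_nonneg hl0] at h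
          simp only [greenKernel, glue]
          split_ifs with ht
          · refine ⟨_, hc, (l + μ) * t, (l - μ) * t, by nlinarith, by nlinarith, ?_⟩
            simp only [greenNeg, greenCoeff, if_pos (show -μ < l by linarith),
              if_neg (show ¬ -μ < -l by linarith)]
            ring
          · refine ⟨0, by simp; positivity, 0, 0, le_rfl, le_rfl, ?_⟩
            simp only [greenPos, greenCoeff, if_pos (show -μ < l by linarith),
              if_neg (show ¬ -μ < -l by linarith)]
            ring
        · rw [abs_of_nonpos hl0] at h
          simp only [greenKernel, glue]
          split_ifs with ht
          · refine ⟨0, by simp; positivity, 0, 0, le_rfl, le_rfl, ?_⟩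
            simp only [greenNeg, greenCoeff, if_pos (show -μ < -l by linarith),
              if_neg (show ¬ -μ < l by linarith)]
            ring
          · have ht := not_lt.1 ht
            refine ⟨_, (abs_neg _).trans_le hc, (l + μ) * t, (l - μ) * t, by nlinarith, by nlinarith, ?_⟩
            simp only [greenPos, greenCoeff, if_pos (show -μ < -l by linarith),
              if_neg (show ¬ -μ < l by linarith)]
            ring
      obtain ⟨hA, x, y, hx, hy, e⟩ := hA
      rw [e, abs_mul, abs_mul, abs_of_pos hμ, abs_of_pos (by positivity : 0 < Real.exp x + Real.exp y)]
      have := Real.exp_le_one_iff.2 hx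
      have := Real.exp_le_one_iff.2 hy
      calc |A| * μ * (Real.exp x + Real.exp y) ≤ 1 / (2 * μ) * μ * (1 + 1) := by gcongr
        _ = 1 := by field_simp; norm_num
    have : |l * greenKernel 0 l μ t| ≤ 2 := by
      rw [abs_mul]
      calc _ ≤ |l| * (2 / |l|) := by gcongr
        _ = 2 := by field_simp
    have := abs_add_le (greenKernel 1 l μ t - l * greenKernel 0 l μ t) (l * greenKernel 0 l μ t)
    rw [sub_add_cancel] at this
    linarith

lemma abs_greenKernel_le_exp {l μ : ℝ} (hμ : 0 < μ) (h : 2 * |l| ≤ μ) {i : ℕ} (hi : i ≤ 1) (t : ℝ) :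
    μ ^ (1 - i) * |greenKernel i l μ t| ≤ Real.exp (-(μ / 2 * |t|)) := by
  have h1 := le_abs_self l
  have h2 := neg_abs_le l
  have aux : ∀ c d : ℝ, |c| ≤ 2 * μ → μ / 2 ≤ d →
      μ ^ (1 - i) * |c ^ i * Real.exp (-(d * |t|)) / (2 * μ)| ≤ Real.exp (-(μ / 2 * |t|)) := by
    intro c d hc hd
    have hc' : |c| ^ i ≤ (2 * μ) ^ i := by gcongr
    have h2 : (μ ^ (1 - i) * (2 * μ) ^ i : ℝ) ≤ 2 * μ := by
      interval_cases i
      · simp; linarith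
      · simp
    rw [abs_div, abs_mul, abs_pow, Real.abs_exp, abs_of_pos (by positivity : 0 < 2 * μ)]
    calc _ ≤ μ ^ (1 - i) * ((2 * μ) ^ i * Real.exp (-(μ / 2 * |t|)) / (2 * μ)) := by gcongr
      _ = (μ ^ (1 - i) * (2 * μ) ^ i) * Real.exp (-(μ / 2 * |t|)) / (2 * μ) := by ring
      _ ≤ (2 * μ) * Real.exp (-(μ / 2 * |t|)) / (2 * μ) := by gcongr
      _ = _ := by field_simp
  rw [greenKernel_eq_of_lt (by linarith [abs_nonneg l, mul_pos hμ hμ])]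
  split_ifs
  · exact aux _ _ (abs_le.2 ⟨by linarith, by linarith⟩) (by linarith)
  · exact aux _ _ (abs_le.2 ⟨by linarith, by linarith⟩) (by linarith)

/-! ### Convolution operators on the interval -/

/-- The complex Hilbert space `L²(I)`. -/
abbrev L2I : Type := Lp ℂ 2 ((volume : Measure ℝ).restrict intervalI)

/-- Bounded measurable convolution kernels. -/
def IsBoundedKernel (k : ℝ → ℝ) : Prop := Measurable k ∧ ∃ D, ∀ t, |k t| ≤ D

/-- The convolution `∫_I k(x - y) f(y) dy`. -/
noncomputable def kernelConv (k : ℝ → ℝ) (f : ℝ → ℂ) (x : ℝ) : ℂ :=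
  ∫ y in intervalI, (k (x - y) : ℂ) * f y

lemma volume_intervalI : volume intervalI = 1 := by
  rw [intervalI, Real.volume_Ioo]; norm_num

lemma measurableSet_intervalI : MeasurableSet intervalI := measurableSet_Ioo

instance isProbabilityMeasure_intervalI : IsProbabilityMeasure ((volume : Measure ℝ).restrict intervalI) :=
  ⟨by rw [Measure.restrict_apply_univ, volume_intervalI]⟩

lemma sub_mem_of_mem_intervalI {x y : ℝ} (hx : x ∈ intervalI) (hy : y ∈ intervalI) :
    x - y ∈ Ioo (-1 : ℝ) 1 := by
  obtain ⟨h1, h2⟩ := hx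
  obtain ⟨h3, h4⟩ := hy
  constructor <;> linarith

lemma L2I.integrable (f : L2I) : Integrable f (volume.restrict intervalI) :=
  (Lp.memLp f).integrable (by norm_num)

lemma IsBoundedKernel.integrable_mul {k : ℝ → ℝ} (hk : IsBoundedKernel k) {f : ℝ → ℂ}
    (hf : Integrable f (volume.restrict intervalI)) (x : ℝ) :
    Integrable (fun y => (k (x - y) : ℂ) * f y) (volume.restrict intervalI) := by
  obtain ⟨hm, D, hD⟩ := hk
  refine hf.bdd_mul (c := D) ?_ (ae_of_all _ fun y => by simpa using hD (x - y))
  exact (Complex.measurable_ofReal.comp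
    (hm.comp (measurable_const.sub measurable_id))).aestronglyMeasurable

lemma IsBoundedKernel.stronglyMeasurable_conv {k : ℝ → ℝ} (hk : IsBoundedKernel k) (f : L2I) :
    StronglyMeasurable (kernelConv k f) := by
  refine StronglyMeasurable.integral_prod_right (f := fun x y => (k (x - y) : ℂ) * f y) ?_
  refine (Measurable.stronglyMeasurable ?_).mul ((Lp.stronglyMeasurable f).comp_measurable measurable_snd)
  exact Complex.measurable_ofReal.comp (hk.1.comp (measurable_fst.sub measurable_snd))

lemma IsBoundedKernel.memLp_conv {k : ℝ → ℝ} (hk : IsBoundedKernel k) (f : L2I) :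
    MemLp (kernelConv k f) 2 (volume.restrict intervalI) := by
  obtain ⟨D, hD⟩ := hk.2
  refine MemLp.of_bound (C := ∫ y in intervalI, D * ‖f y‖)
    (hk.stronglyMeasurable_conv f).aestronglyMeasurable (ae_of_all _ fun x => ?_)
  refine norm_integral_le_of_norm_le (f.integrable.norm.const_mul D) (ae_of_all _ fun y => ?_)
  rw [norm_mul, Complex.norm_real]
  exact mul_le_mul_of_nonneg_right (hD _) (norm_nonneg _)

/-- Convolution with a bounded kernel, as an operator on `L²(I)`. -/
noncomputable def convOp (k : ℝ → ℝ) (hk : IsBoundedKernel k) : L2I →ₗ[ℂ] L2I where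
  toFun f := (hk.memLp_conv f).toLp
  map_add' f g := by
    rw [← MemLp.toLp_add]
    refine MemLp.toLp_congr _ _ (ae_of_all _ fun x => ?_)
    rw [Pi.add_apply, kernelConv, kernelConv, kernelConv,
      ← integral_add (hk.integrable_mul f.integrable x) (hk.integrable_mul g.integrable x)]
    refine integral_congr_ae ((Lp.coeFn_add f g).mono fun y hy => ?_)
    simp only [hy, Pi.add_apply, mul_add]
  map_smul' c f := by
    rw [RingHom.id_apply, ← MemLp.toLp_const_smul]
    refine MemLp.toLp_congr _ _ (ae_of_all _ fun x => ?_)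
    rw [Pi.smul_apply, kernelConv, kernelConv, smul_eq_mul, ← integral_const_mul]
    refine integral_congr_ae ((Lp.coeFn_smul c f).mono fun y hy => ?_)
    simp only [hy, Pi.smul_apply, smul_eq_mul]; ring

lemma coeFn_convOp {k : ℝ → ℝ} (hk : IsBoundedKernel k) (f : L2I) :
    convOp k hk f =ᵐ[volume.restrict intervalI] kernelConv k f := (hk.memLp_conv f).coeFn_toLp

lemma setLIntegral_sub_left_le (F : ℝ → ℝ≥0∞) {x : ℝ} (hx : x ∈ intervalI) :
    ∫⁻ y in intervalI, F (x - y) ≤ ∫⁻ t in Ioo (-1 : ℝ) 1, F t := by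
  rw [← lintegral_indicator measurableSet_intervalI, ← lintegral_indicator measurableSet_Ioo,
    ← lintegral_sub_left_eq_self ((Ioo (-1 : ℝ) 1).indicator F) x]
  refine lintegral_mono fun y => ?_
  by_cases hy : y ∈ intervalI
  · rw [indicator_of_mem hy, indicator_of_mem (sub_mem_of_mem_intervalI hx hy)]
  · simp [hy]

lemma setLIntegral_sub_right_le (F : ℝ → ℝ≥0∞) {y : ℝ} (hy : y ∈ intervalI) :
    ∫⁻ x in intervalI, F (x - y) ≤ ∫⁻ t in Ioo (-1 : ℝ) 1, F t := by
  rw [← lintegral_indicator measurableSet_intervalI, ← lintegral_indicator measurableSet_Ioo,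
    ← lintegral_sub_right_eq_self ((Ioo (-1 : ℝ) 1).indicator F) y]
  refine lintegral_mono fun x => ?_
  by_cases hx : x ∈ intervalI
  · rw [indicator_of_mem hx, indicator_of_mem (sub_mem_of_mem_intervalI hx hy)]
  · simp [hx]

/-- Young's inequality: convolution is bounded on `L²(I)` by the `L¹` norm of its kernel. -/
lemma norm_convOp_le {k : ℝ → ℝ} (hk : IsBoundedKernel k) {B : ℝ} (hB : 0 ≤ B)
    (h : ∫⁻ t in Ioo (-1 : ℝ) 1, ‖k t‖ₑ ≤ ENNReal.ofReal B) (f : L2I) :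
    ‖convOp k hk f‖ ≤ B * ‖f‖ := by
  have hkm : Measurable fun p : ℝ × ℝ => ‖k (p.1 - p.2)‖ₑ :=
    (hk.1.comp (measurable_fst.sub measurable_snd)).enorm
  have hfm : Measurable fun y => ‖f y‖ₑ := (Lp.stronglyMeasurable f).measurable.enorm
  have pt : ∀ x ∈ intervalI, ‖kernelConv k f x‖ₑ ^ 2 ≤
      ENNReal.ofReal B * ∫⁻ y in intervalI, ‖k (x - y)‖ₑ * ‖f y‖ₑ ^ 2 := by
    intro x hx
    have hkx : Measurable fun y => ‖k (x - y)‖ₑ := hkm.comp measurable_prodMk_left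
    calc ‖kernelConv k f x‖ₑ ^ 2
        ≤ (∫⁻ y in intervalI, ‖k (x - y)‖ₑ ^ (1 / 2 : ℝ) * (‖k (x - y)‖ₑ * ‖f y‖ₑ ^ 2) ^ (1 / 2 : ℝ)) ^ 2 := by
          gcongr
          refine (enorm_integral_le_lintegral_enorm _).trans (lintegral_mono fun y => le_of_eq ?_)
          rw [enorm_mul, show ‖(k (x - y) : ℂ)‖ₑ = ‖k (x - y)‖ₑ by simp [enorm_eq_nnnorm]]
          rw [ENNReal.mul_rpow_of_nonneg _ _ (by norm_num), ← mul_assoc,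
            ← ENNReal.rpow_add_of_nonneg _ _ (by norm_num) (by norm_num), ← ENNReal.rpow_natCast_mul]
          norm_num
      _ ≤ ((∫⁻ y in intervalI, ‖k (x - y)‖ₑ) ^ (1 / 2 : ℝ) *
            (∫⁻ y in intervalI, ‖k (x - y)‖ₑ * ‖f y‖ₑ ^ 2) ^ (1 / 2 : ℝ)) ^ 2 := by
          gcongr
          exact ENNReal.lintegral_mul_norm_pow_le hkx.aemeasurable
            (hkx.mul (hfm.pow_const 2)).aemeasurable (by norm_num) (by norm_num) (by norm_num)
      _ = (∫⁻ y in intervalI, ‖k (x - y)‖ₑ) * ∫⁻ y in intervalI, ‖k (x - y)‖ₑ * ‖f y‖ₑ ^ 2 := by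
          rw [mul_pow, ← ENNReal.rpow_mul_natCast, ← ENNReal.rpow_mul_natCast]; norm_num
      _ ≤ _ := by
          gcongr
          exact (setLIntegral_sub_left_le (fun t => ‖k t‖ₑ) hx).trans h
  have main : ∫⁻ x in intervalI, ‖kernelConv k f x‖ₑ ^ 2 ≤
      ENNReal.ofReal B ^ 2 * ∫⁻ y in intervalI, ‖f y‖ₑ ^ 2 := by
    calc _ ≤ ∫⁻ x in intervalI, ENNReal.ofReal B * ∫⁻ y in intervalI, ‖k (x - y)‖ₑ * ‖f y‖ₑ ^ 2 :=
          setLIntegral_mono' measurableSet_intervalI pt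
      _ = ENNReal.ofReal B * ∫⁻ x in intervalI, ∫⁻ y in intervalI, ‖k (x - y)‖ₑ * ‖f y‖ₑ ^ 2 :=
          lintegral_const_mul' _ _ ENNReal.ofReal_ne_top
      _ = ENNReal.ofReal B * ∫⁻ y in intervalI, ∫⁻ x in intervalI, ‖k (x - y)‖ₑ * ‖f y‖ₑ ^ 2 := by
          rw [lintegral_lintegral_swap]
          exact (hkm.mul ((hfm.comp measurable_snd).pow_const 2)).aemeasurable
      _ ≤ ENNReal.ofReal B * ∫⁻ y in intervalI, ENNReal.ofReal B * ‖f y‖ₑ ^ 2 := by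
          gcongr ENNReal.ofReal B * ?_
          refine setLIntegral_mono' measurableSet_intervalI fun y hy => ?_
          rw [lintegral_mul_const _ (show Measurable fun x => ‖k (x - y)‖ₑ from
            hkm.comp measurable_prodMk_right)]
          gcongr
          exact (setLIntegral_sub_right_le (fun t => ‖k t‖ₑ) hy).trans h
      _ = _ := by rw [lintegral_const_mul' _ _ ENNReal.ofReal_ne_top, sq, mul_assoc]
  have h2 : ∀ g : ℝ → ℂ, eLpNorm g 2 (volume.restrict intervalI) ^ 2
      = ∫⁻ x in intervalI, ‖g x‖ₑ ^ 2 := by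
    intro g
    have := eLpNorm_nnreal_pow_eq_lintegral (f := g) (μ := volume.restrict intervalI)
      (p := 2) two_ne_zero
    simpa using this
  have fin : eLpNorm (kernelConv k f) 2 (volume.restrict intervalI) ≤
      ENNReal.ofReal B * eLpNorm f 2 (volume.restrict intervalI) := by
    refine (ENNReal.pow_le_pow_left_iff two_ne_zero).1 ?_
    rw [mul_pow, h2, h2]
    exact main
  rw [Lp.norm_def, Lp.norm_def, ← ENNReal.toReal_ofReal hB, ← ENNReal.toReal_mul,
    eLpNorm_congr_ae (coeFn_convOp hk f)]
  exact ENNReal.toReal_mono (ENNReal.mul_ne_top ENNReal.ofReal_ne_top (Lp.eLpNorm_ne_top f)) fin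

lemma norm_convOp_le_of_bound {k : ℝ → ℝ} (hk : IsBoundedKernel k) {D : ℝ}
    (h : ∀ t, |k t| ≤ D) (f : L2I) : ‖convOp k hk f‖ ≤ 2 * D * ‖f‖ := by
  have hD : 0 ≤ D := (abs_nonneg _).trans (h 0)
  refine norm_convOp_le hk (by positivity) ?_ f
  calc ∫⁻ t in Ioo (-1 : ℝ) 1, ‖k t‖ₑ ≤ ∫⁻ t in Ioo (-1 : ℝ) 1, ENNReal.ofReal D := by
        refine lintegral_mono fun t => ?_
        rw [Real.enorm_eq_ofReal_abs]
        exact ENNReal.ofReal_le_ofReal (h t)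
    _ = ENNReal.ofReal (2 * D) := by
        rw [setLIntegral_const, Real.volume_Ioo, ← ENNReal.ofReal_mul hD]; ring_nf

lemma IsBoundedKernel.integrable_prod {k : ℝ → ℝ} (hk : IsBoundedKernel k) {f g : ℝ → ℂ}
    (hf : Integrable f (volume.restrict intervalI)) (hg : Integrable g (volume.restrict intervalI)) :
    Integrable (fun p : ℝ × ℝ => (k (p.1 - p.2) : ℂ) * (g p.1 * f p.2))
      ((volume.restrict intervalI).prod (volume.restrict intervalI)) := by
  obtain ⟨hm, D, hD⟩ := hk
  refine (hg.mul_prod hf).bdd_mul (c := D) ?_ (ae_of_all _ fun p => by simpa using hD _)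
  exact (Complex.measurable_ofReal.comp
    (hm.comp (measurable_fst.sub measurable_snd))).aestronglyMeasurable

lemma integral_kernelConv_mul {k : ℝ → ℝ} (hk : IsBoundedKernel k) {f g : ℝ → ℂ}
    (hf : Integrable f (volume.restrict intervalI)) (hg : Integrable g (volume.restrict intervalI)) :
    ∫ x in intervalI, kernelConv k f x * g x
      = ∫ y in intervalI, f y * ∫ x in intervalI, (k (x - y) : ℂ) * g x := by
  have e1 : ∀ x, kernelConv k f x * g x = ∫ y in intervalI, (k (x - y) : ℂ) * (g x * f y) := by
    intro x
    rw [kernelConv, ← integral_mul_const]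
    congr 1; ext y; ring
  have e2 : ∀ y, f y * ∫ x in intervalI, (k (x - y) : ℂ) * g x
      = ∫ x in intervalI, (k (x - y) : ℂ) * (g x * f y) := by
    intro y
    rw [← integral_const_mul]
    congr 1; ext y; ring
  simp_rw [e1, e2]
  exact integral_integral_swap (hk.integrable_prod hf hg)

/-- Reflecting the real kernel gives the adjoint operator. -/
lemma inner_convOp {k k' : ℝ → ℝ} (hk : IsBoundedKernel k) (hk' : IsBoundedKernel k')
    (h : ∀ t, k' t = k (-t)) (f g : L2I) :
    inner ℂ (convOp k hk f) g = inner ℂ f (convOp k' hk' g) := by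
  have e1 : inner ℂ f (convOp k' hk' g)
      = ∫ x in intervalI, kernelConv k' g x * (starRingEnd ℂ) (f x) := by
    rw [L2.inner_def]
    exact integral_congr_ae ((coeFn_convOp hk' g).mono fun x hx => by
      simp only [RCLike.inner_apply, hx])
  have hfc : Integrable (fun x => (starRingEnd ℂ) (f x)) (volume.restrict intervalI) :=
    (LinearIsometryEquiv.integrable_comp_iff Complex.conjLIE).2 f.integrable
  rw [e1, integral_kernelConv_mul hk' g.integrable hfc, L2.inner_def]
  refine integral_congr_ae ((coeFn_convOp hk f).mono fun x hx => ?_)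
  simp only [RCLike.inner_apply, hx]
  rw [kernelConv, ← integral_conj]
  congr 2; ext y
  simp [h]

/-- Integration by parts against a kernel that jumps at the origin. -/
lemma integral_glue_mul_deriv {p q p' q' : ℝ → ℝ} (hp : ∀ t, HasDerivAt p (p' t) t)
    (hq : ∀ t, HasDerivAt q (q' t) t) (hp' : Continuous p') (hq' : Continuous q') {χ : ℝ → ℂ}
    (hχ : IsTestFunction intervalI χ) {y : ℝ} (hy : y ∈ intervalI) :
    ∫ x in intervalI, (glue p q (x - y) : ℂ) * deriv χ x
      = -(∫ x in intervalI, (glue p' q' (x - y) : ℂ) * χ x) - ((q 0 - p 0 : ℝ) : ℂ) * χ y := by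
  have hχ' : Continuous (deriv χ) := hχ.1.continuous_deriv (by simp)
  have hpc : Continuous p := continuous_iff_continuousAt.2 fun t => (hp t).continuousAt
  have hqc : Continuous q := continuous_iff_continuousAt.2 fun t => (hq t).continuousAt
  have hends : χ (1 / 2) = 0 ∧ χ (3 / 2) = 0 := by
    constructor <;> refine image_eq_zero_of_notMem_tsupport fun h => ?_
    · exact lt_irrefl _ (hχ.2.2 h).1
    · exact lt_irrefl _ (hχ.2.2 h).2
  have split : ∀ {p q : ℝ → ℝ} {g : ℝ → ℂ}, Continuous p → Continuous q → Continuous g →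
      ∫ x in intervalI, (glue p q (x - y) : ℂ) * g x
        = (∫ x in (1 / 2)..y, (p (x - y) : ℂ) * g x) + ∫ x in y..(3 / 2), (q (x - y) : ℂ) * g x := by
    intro p q g hp hq hg
    have e : Ioo (1 / 2 : ℝ) (3 / 2) = Ioo (1 / 2) y ∪ Ico y (3 / 2) :=
      (Ioo_union_Ico_eq_Ioo hy.1 hy.2.le).symm
    have i1 : IntegrableOn (fun x => (p (x - y) : ℂ) * g x) (Ioo (1 / 2) y) :=
      ((by fun_prop : Continuous _).integrableOn_Icc (a := 1 / 2) (b := y)).mono_set Ioo_subset_Icc_self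
    have i2 : IntegrableOn (fun x => (q (x - y) : ℂ) * g x) (Ico y (3 / 2)) :=
      ((by fun_prop : Continuous _).integrableOn_Icc (a := y) (b := 3 / 2)).mono_set Ico_subset_Icc_self
    have c1 : EqOn (fun x => (p (x - y) : ℂ) * g x) (fun x => (glue p q (x - y) : ℂ) * g x)
        (Ioo (1 / 2) y) := fun x hx => by simp [glue, hx.2]
    have c2 : EqOn (fun x => (q (x - y) : ℂ) * g x) (fun x => (glue p q (x - y) : ℂ) * g x)
        (Ico y (3 / 2)) := fun x hx => by simp [glue, hx.1]
    rw [intervalI, e, setIntegral_union _ measurableSet_Ico (i1.congr_fun c1 measurableSet_Ioo)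
        (i2.congr_fun c2 measurableSet_Ico),
      ← setIntegral_congr_fun measurableSet_Ioo c1, ← setIntegral_congr_fun measurableSet_Ico c2,
      intervalIntegral.integral_of_le hy.1.le, intervalIntegral.integral_of_le hy.2.le,
      integral_Ioc_eq_integral_Ioo, integral_Ioc_eq_integral_Ioo, integral_Ico_eq_integral_Ioo]
    exact disjoint_left.2 fun x h1 h2 => absurd h1.2 (not_lt.2 h2.1)
  have parts : ∀ {p p' : ℝ → ℝ}, (∀ t, HasDerivAt p (p' t) t) → Continuous p' → ∀ a b : ℝ,
      ∫ x in a..b, (p (x - y) : ℂ) * deriv χ x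
        = (p (b - y) : ℂ) * χ b - (p (a - y) : ℂ) * χ a - ∫ x in a..b, (p' (x - y) : ℂ) * χ x := by
    intro p p' hp hp' a b
    refine intervalIntegral.integral_mul_deriv_eq_deriv_mul
      (fun x _ => ?_) (fun x _ => (hχ.differentiable x).hasDerivAt)
      ((by fun_prop : Continuous _).intervalIntegrable _ _) (hχ'.intervalIntegrable _ _)
    exact ((hp (x - y)).comp_sub_const x y).ofReal_comp
  rw [split hpc hqc hχ', split hp' hq' hχ.1.continuous, parts hp hp', parts hq hq', hends.1, hends.2,
    sub_self]
  push_cast; ring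

/-- The weak derivative of a convolution with a kernel that jumps at the origin. -/
lemma hasWeakDeriv_convOp {p q p' q' : ℝ → ℝ} (hp : ∀ t, HasDerivAt p (p' t) t)
    (hq : ∀ t, HasDerivAt q (q' t) t) (hp' : Continuous p') (hq' : Continuous q')
    (hk : IsBoundedKernel (glue p q)) (hk' : IsBoundedKernel (glue p' q')) (f : L2I) :
    HasWeakDeriv intervalI 1 (convOp _ hk f) (convOp _ hk' f + ((q 0 - p 0 : ℝ) : ℂ) • f : L2I) := by
  have hv : volume intervalI ≠ ⊤ := by simp [volume_intervalI]
  refine ⟨(Lp.integrableOn hv _).locallyIntegrableOn, (Lp.integrableOn hv _).locallyIntegrableOn,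
    fun χ hχ => ?_⟩
  have hχ' := hχ.fderiv_apply (1 : ℝ)
  have iχ : Integrable χ (volume.restrict intervalI) := (hχ.memLp 2).integrable (by norm_num)
  have iχ' : Integrable (fun x => fderiv ℝ χ x 1) (volume.restrict intervalI) :=
    (hχ'.memLp 2).integrable (by norm_num)
  have ifχ := hχ.integrableOn_mul (Lp.integrableOn hv f).locallyIntegrableOn
  have ikχ := hχ.integrableOn_mul (Lp.integrableOn hv (convOp _ hk' f)).locallyIntegrableOn
  have e2 : ∫ x in intervalI, (convOp _ hk' f + ((q 0 - p 0 : ℝ) : ℂ) • f : L2I) x * χ x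
      = (∫ x in intervalI, kernelConv (glue p' q') f x * χ x)
        + ∫ x in intervalI, ((q 0 - p 0 : ℝ) : ℂ) * (f x * χ x) := by
    have : ∫ x in intervalI, kernelConv (glue p' q') f x * χ x
        = ∫ x in intervalI, convOp _ hk' f x * χ x :=
      integral_congr_ae ((coeFn_convOp hk' f).mono fun x hx => by simp only [hx])
    rw [this, ← integral_add ikχ (ifχ.const_mul _)]
    refine integral_congr_ae ?_
    filter_upwards [Lp.coeFn_add (convOp _ hk' f) (((q 0 - p 0 : ℝ) : ℂ) • f),
      Lp.coeFn_smul ((q 0 - p 0 : ℝ) : ℂ) f] with x h1 h2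
    simp only [h1, Pi.add_apply, h2, Pi.smul_apply, smul_eq_mul]; ring
  have e1 : ∫ x in intervalI, convOp _ hk f x * fderiv ℝ χ x 1
      = ∫ x in intervalI, kernelConv (glue p q) f x * fderiv ℝ χ x 1 :=
    integral_congr_ae ((coeFn_convOp hk f).mono fun x hx => by simp only [hx])
  rw [e1, e2, integral_kernelConv_mul hk f.integrable iχ', integral_kernelConv_mul hk' f.integrable iχ,
    ← integral_add _ (ifχ.const_mul _), ← integral_neg]
  · refine setIntegral_congr_fun measurableSet_intervalI fun y hy => ?_
    simp only [fderiv_apply_one_eq_deriv]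
    rw [integral_glue_mul_deriv hp hq hp' hq' hχ hy]
    ring
  · refine ((hk'.integrable_prod f.integrable iχ).integral_prod_right).congr (ae_of_all _ fun y => ?_)
    simp only
    rw [← integral_const_mul]
    congr 1; ext x; ring

/-! ### Bounds for the Green operators -/

lemma isBoundedKernel_green_zero {μ : ℝ} (hμ : 0 < μ) (l : ℝ) :
    IsBoundedKernel (greenKernel 0 l μ) :=
  ⟨measurable_greenKernel 0 l μ, _, abs_greenKernel_zero_le_inv hμ l⟩

lemma isBoundedKernel_green_one {l μ : ℝ} (hl : l ≠ 0) (hμ : 0 < μ) :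
    IsBoundedKernel (greenKernel 1 l μ) :=
  ⟨measurable_greenKernel 1 l μ, _, abs_greenKernel_one_le hl hμ⟩

/-- The solution operator of `-(d/dt - l)² + μ²` on `L²(I)` given by the Green kernel. -/
noncomputable def greenOp (l : ℝ) {μ : ℝ} (hμ : 0 < μ) : L2I →ₗ[ℂ] L2I :=
  convOp (greenKernel 0 l μ) (isBoundedKernel_green_zero hμ l)

/-- The derivative of `greenOp`. -/
noncomputable def greenDerivOp {l μ : ℝ} (hl : l ≠ 0) (hμ : 0 < μ) : L2I →ₗ[ℂ] L2I :=
  convOp (greenKernel 1 l μ) (isBoundedKernel_green_one hl hμ)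

lemma norm_greenOp_le {l μ : ℝ} (hl : l ≠ 0) (hμ : 0 < μ) (f : L2I) :
    ‖greenOp l hμ f‖ ≤ 4 / |l| * ‖f‖ := by
  refine (norm_convOp_le_of_bound _ (abs_greenKernel_zero_le_inv_abs hl hμ) f).trans_eq ?_
  ring

lemma mul_norm_greenOp_le (l : ℝ) {μ : ℝ} (hμ : 0 < μ) (f : L2I) :
    μ * ‖greenOp l hμ f‖ ≤ ‖f‖ := by
  calc _ ≤ μ * (2 * (1 / (2 * μ)) * ‖f‖) := by
        gcongr
        exact norm_convOp_le_of_bound _ (abs_greenKernel_zero_le_inv hμ l) f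
    _ = ‖f‖ := by field_simp

lemma norm_greenDerivOp_le {l μ : ℝ} (hl : l ≠ 0) (hμ : 0 < μ) (f : L2I) :
    ‖greenDerivOp hl hμ f‖ ≤ 6 * ‖f‖ := by
  refine (norm_convOp_le_of_bound _ (abs_greenKernel_one_le hl hμ) f).trans_eq ?_
  ring

lemma lintegral_exp_neg_abs_le {c : ℝ} (hc : 0 < c) :
    ∫⁻ t in Ioo (-1 : ℝ) 1, ENNReal.ofReal (Real.exp (-(c * |t|))) ≤ ENNReal.ofReal (2 / c) := by
  have hcont : Continuous fun t : ℝ => Real.exp (-(c * |t|)) := by fun_prop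
  have hi : IntegrableOn (fun t : ℝ => Real.exp (-(c * |t|))) (Ioo (-1) 1) :=
    hcont.integrableOn_Icc.mono_set Ioo_subset_Icc_self
  rw [← ofReal_integral_eq_lintegral_ofReal hi (ae_of_all _ fun t => (Real.exp_pos _).le)]
  refine ENNReal.ofReal_le_ofReal ?_
  rw [← integral_Ioc_eq_integral_Ioo, ← intervalIntegral.integral_of_le (by norm_num),
    ← intervalIntegral.integral_add_adjacent_intervals (b := 0)
      (hcont.intervalIntegrable _ _) (hcont.intervalIntegrable _ _)]
  have e1 : ∫ t in (-1 : ℝ)..0, Real.exp (-(c * |t|)) = ∫ t in (0 : ℝ)..1, Real.exp (-(c * |t|)) := by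
    have := intervalIntegral.integral_comp_neg (a := 0) (b := 1) fun t : ℝ => Real.exp (-(c * |t|))
    simp only [abs_neg, neg_zero] at this
    exact this.symm
  have e2 : ∫ t in (0 : ℝ)..1, Real.exp (-(c * |t|)) = ∫ t in (0 : ℝ)..1, Real.exp (-c * t) :=
    intervalIntegral.integral_congr fun t ht => by
      rw [uIcc_of_le zero_le_one] at ht
      simp only [abs_of_nonneg ht.1]; ring_nf
  rw [e1, e2, intervalIntegral.integral_comp_mul_left Real.exp (by linarith), integral_exp]
  simp only [mul_zero, mul_one, Real.exp_zero, smul_eq_mul]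
  have : (-c)⁻¹ * (Real.exp (-c) - 1) + (-c)⁻¹ * (Real.exp (-c) - 1) = 2 * (1 - Real.exp (-c)) / c := by
    field_simp; ring
  rw [this]
  gcongr
  linarith [Real.exp_pos (-c)]

/-- For `μ ≥ 2 |l|` the kernels decay at the rate `μ / 2`, so that their `L¹` norms are smaller than
their suprema by a factor of order `μ`. -/
lemma pow_mul_norm_conv_green_le {l μ : ℝ} (hμ : 0 < μ) (h : 2 * |l| ≤ μ) {i : ℕ} (hi : i ≤ 1)
    (hk : IsBoundedKernel (greenKernel i l μ)) (f : L2I) :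
    μ ^ (2 - i) * ‖convOp _ hk f‖ ≤ 4 * ‖f‖ := by
  have hB : ‖convOp _ hk f‖ ≤ 4 / μ ^ (2 - i) * ‖f‖ := by
    refine norm_convOp_le hk (by positivity) ?_ f
    calc ∫⁻ t in Ioo (-1 : ℝ) 1, ‖greenKernel i l μ t‖ₑ
        ≤ ∫⁻ t in Ioo (-1 : ℝ) 1, ENNReal.ofReal (1 / μ ^ (1 - i)) *
            ENNReal.ofReal (Real.exp (-(μ / 2 * |t|))) := by
          refine lintegral_mono fun t => ?_
          rw [Real.enorm_eq_ofReal_abs, ← ENNReal.ofReal_mul (by positivity)]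
          refine ENNReal.ofReal_le_ofReal ?_
          rw [one_div_mul_eq_div, le_div_iff₀ (by positivity), mul_comm]
          exact abs_greenKernel_le_exp hμ h hi t
      _ = ENNReal.ofReal (1 / μ ^ (1 - i)) *
            ∫⁻ t in Ioo (-1 : ℝ) 1, ENNReal.ofReal (Real.exp (-(μ / 2 * |t|))) :=
          lintegral_const_mul' _ _ ENNReal.ofReal_ne_top
      _ ≤ ENNReal.ofReal (1 / μ ^ (1 - i)) * ENNReal.ofReal (2 / (μ / 2)) := by
          gcongr
          exact lintegral_exp_neg_abs_le (by positivity)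
      _ = ENNReal.ofReal (4 / μ ^ (2 - i)) := by
          rw [← ENNReal.ofReal_mul (by positivity), show 2 - i = (1 - i) + 1 by omega, pow_succ]
          congr 1; field_simp; norm_num
  calc _ ≤ μ ^ (2 - i) * (4 / μ ^ (2 - i) * ‖f‖) := by gcongr
    _ = _ := by field_simp

lemma sq_mul_norm_greenOp_le (l : ℝ) {μ : ℝ} (hμ : 0 < μ) (f : L2I) :
    μ ^ 2 * ‖greenOp l hμ f‖ ≤ (12 * |l| + 4) * ‖f‖ := by
  have hn := norm_nonneg f
  have hl := abs_nonneg l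
  rcases le_total (2 * |l|) μ with h | h
  · refine (pow_mul_norm_conv_green_le hμ h zero_le_one _ f).trans ?_
    gcongr; linarith
  · calc _ = μ * (μ * ‖greenOp l hμ f‖) := by ring
      _ ≤ (2 * |l|) * ‖f‖ := by
          gcongr
          exact mul_norm_greenOp_le l hμ f
      _ ≤ _ := by gcongr; linarith

lemma mul_norm_greenDerivOp_le {l μ : ℝ} (hl : l ≠ 0) (hμ : 0 < μ) (f : L2I) :
    μ * ‖greenDerivOp hl hμ f‖ ≤ (12 * |l| + 4) * ‖f‖ := by
  have hn := norm_nonneg f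
  have hl' := abs_nonneg l
  rcases le_total (2 * |l|) μ with h | h
  · have := pow_mul_norm_conv_green_le hμ h le_rfl (isBoundedKernel_green_one hl hμ) f
    simp only [Nat.add_one_sub_one, pow_one] at this
    refine this.trans ?_
    gcongr; linarith
  · calc _ ≤ (2 * |l|) * (6 * ‖f‖) := by
          gcongr
          exact norm_greenDerivOp_le hl hμ f
      _ = (12 * |l|) * ‖f‖ := by ring
      _ ≤ _ := by gcongr; linarith

lemma continuous_greenNeg (i : ℕ) (l μ : ℝ) : Continuous (greenNeg i l μ) :=
  continuous_iff_continuousAt.2 fun t => (hasDerivAt_greenNeg i l μ t).continuousAt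

lemma continuous_greenPos (i : ℕ) (l μ : ℝ) : Continuous (greenPos i l μ) :=
  continuous_iff_continuousAt.2 fun t => (hasDerivAt_greenPos i l μ t).continuousAt

lemma hasWeakDeriv_greenOp {l μ : ℝ} (hl : l ≠ 0) (hμ : 0 < μ) (f : L2I) :
    HasWeakDeriv intervalI 1 (greenOp l hμ f) (greenDerivOp hl hμ f) := by
  have := hasWeakDeriv_convOp (hasDerivAt_greenNeg 0 l μ) (hasDerivAt_greenPos 0 l μ)
    (continuous_greenNeg 1 l μ) (continuous_greenPos 1 l μ) (isBoundedKernel_green_zero hμ l)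
    (isBoundedKernel_green_one hl hμ) f
  rw [greenKernel_zero_jump, Complex.ofReal_zero, zero_smul, add_zero] at this
  exact this

/-- The differential equation for `greenOp`. The term `-f` comes from the jump of the derivative of
the kernel at the origin. -/
lemma hasWeakDeriv_greenDerivOp {l μ : ℝ} (hl : l ≠ 0) (hμ : 0 < μ) (f : L2I) :
    HasWeakDeriv intervalI 1 (greenDerivOp hl hμ f)
      (((2 * l : ℝ) : ℂ) • greenDerivOp hl hμ f + ((μ ^ 2 - l ^ 2 : ℝ) : ℂ) • greenOp l hμ f - f : L2I) := by
  have hk2 : IsBoundedKernel (greenKernel 2 l μ) := by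
    refine ⟨measurable_greenKernel 2 l μ, |2 * l| * 3 + |μ ^ 2 - l ^ 2| * (1 / (2 * μ)), fun t => ?_⟩
    rw [greenKernel_two]
    refine (abs_add_le _ _).trans ?_
    rw [abs_mul (2 * l), abs_mul (μ ^ 2 - l ^ 2)]
    gcongr
    · exact abs_greenKernel_one_le hl hμ t
    · exact abs_greenKernel_zero_le_inv hμ l t
  have := hasWeakDeriv_convOp (hasDerivAt_greenNeg 1 l μ) (hasDerivAt_greenPos 1 l μ)
    (continuous_greenNeg 2 l μ) (continuous_greenPos 2 l μ) (isBoundedKernel_green_one hl hμ)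
    hk2 f
  have e : convOp (glue (greenNeg 2 l μ) (greenPos 2 l μ)) hk2 f
      = ((2 * l : ℝ) : ℂ) • greenDerivOp hl hμ f + ((μ ^ 2 - l ^ 2 : ℝ) : ℂ) • greenOp l hμ f := by
    refine Lp.ext ?_
    filter_upwards [coeFn_convOp hk2 f, coeFn_convOp (isBoundedKernel_green_one hl hμ) f,
      coeFn_convOp (isBoundedKernel_green_zero hμ l) f,
      Lp.coeFn_add (((2 * l : ℝ) : ℂ) • greenDerivOp hl hμ f)
        (((μ ^ 2 - l ^ 2 : ℝ) : ℂ) • greenOp l hμ f),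
      Lp.coeFn_smul ((2 * l : ℝ) : ℂ) (greenDerivOp hl hμ f),
      Lp.coeFn_smul ((μ ^ 2 - l ^ 2 : ℝ) : ℂ) (greenOp l hμ f)] with x h1 h2 h3 h4 h5 h6
    rw [h4, Pi.add_apply, h5, h6, Pi.smul_apply, Pi.smul_apply, greenDerivOp, greenOp, h2, h3]
    refine h1.trans ?_
    simp only [kernelConv, smul_eq_mul]
    rw [← integral_const_mul, ← integral_const_mul, ← integral_add]
    · refine integral_congr_ae (ae_of_all _ fun y => ?_)
      simp only [greenKernel_two]
      push_cast; ring
    · exact ((isBoundedKernel_green_one hl hμ).integrable_mul f.integrable x).const_mul _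
    · exact ((isBoundedKernel_green_zero hμ l).integrable_mul f.integrable x).const_mul _
  rw [greenKernel_one_jump hμ, e, Complex.ofReal_neg, Complex.ofReal_one, neg_one_smul,
    ← sub_eq_add_neg] at this
  exact this

lemma inner_greenOp {l μ : ℝ} (hμ : 0 < μ) (f g : L2I) :
    inner ℂ (greenOp l hμ f) g = inner ℂ f (greenOp (-l) hμ g) :=
  inner_convOp _ _ (greenKernel_neg l μ) f g

/-! ### Separation of variables on the box -/

/-- The normalised product of a trigonometric mode of `(a₁, b₁)` and one of `(a₂, b₂)`. For
`σ = τ = true` these are the Dirichlet eigenfunctions of the rectangle; the other systems occur as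
their derivatives. -/
noncomputable def mode (a₁ b₁ a₂ b₂ : ℝ) (σ τ : Bool) (n : ℕ × ℕ) (x : ℝ × ℝ) : ℝ :=
  2 / √((b₁ - a₁) * (b₂ - a₂)) * (trig σ a₁ b₁ n.1 x.1 * trig τ a₂ b₂ n.2 x.2)

/-- The square root of the Dirichlet eigenvalue of the rectangle of index `n`. -/
noncomputable def modeFreq (a₁ b₁ a₂ b₂ : ℝ) (n : ℕ × ℕ) : ℝ :=
  √(freq a₁ b₁ n.1 ^ 2 + freq a₂ b₂ n.2 ^ 2)

variable {a₁ b₁ a₂ b₂ : ℝ}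

lemma modeFreq_pos (h₁ : a₁ < b₁) (h₂ : a₂ < b₂) (n : ℕ × ℕ) : 0 < modeFreq a₁ b₁ a₂ b₂ n := by
  have := freq_pos h₁ n.1
  have := freq_pos h₂ n.2
  exact Real.sqrt_pos.2 (by positivity)

lemma modeFreq_sq (n : ℕ × ℕ) :
    modeFreq a₁ b₁ a₂ b₂ n ^ 2 = freq a₁ b₁ n.1 ^ 2 + freq a₂ b₂ n.2 ^ 2 :=
  Real.sq_sqrt (by positivity)

lemma contDiff_mode (σ τ : Bool) (n : ℕ × ℕ) : ContDiff ℝ ∞ (mode a₁ b₁ a₂ b₂ σ τ n) :=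
  contDiff_const.mul (((contDiff_trig σ a₁ b₁ n.1).comp contDiff_fst).mul
    ((contDiff_trig τ a₂ b₂ n.2).comp contDiff_snd))

lemma continuous_mode (σ τ : Bool) (n : ℕ × ℕ) : Continuous (mode a₁ b₁ a₂ b₂ σ τ n) :=
  (contDiff_mode σ τ n).continuous

lemma abs_mode_le (σ τ : Bool) (n : ℕ × ℕ) (x : ℝ × ℝ) :
    |mode a₁ b₁ a₂ b₂ σ τ n x| ≤ 2 / √((b₁ - a₁) * (b₂ - a₂)) := by
  rw [mode, abs_mul, abs_mul, abs_of_nonneg (by positivity : 0 ≤ 2 / √((b₁ - a₁) * (b₂ - a₂)))]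
  refine mul_le_of_le_one_right (by positivity) ?_
  exact mul_le_one₀ (abs_trig_le_one _ _ _ _ _) (abs_nonneg _) (abs_trig_le_one _ _ _ _ _)

lemma volume_rectQ' : volume (rectQ' a₁ b₁ a₂ b₂) = ENNReal.ofReal (b₁ - a₁) * ENNReal.ofReal (b₂ - a₂) := by
  rw [rectQ', Measure.volume_eq_prod, Measure.prod_prod, Real.volume_Ioo, Real.volume_Ioo]

instance isFiniteMeasure_rectQ' :
    IsFiniteMeasure ((volume : Measure (ℝ × ℝ)).restrict (rectQ' a₁ b₁ a₂ b₂)) :=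
  ⟨by rw [Measure.restrict_apply_univ, volume_rectQ']; finiteness⟩

lemma restrict_rectQ' : (volume : Measure (ℝ × ℝ)).restrict (rectQ' a₁ b₁ a₂ b₂)
    = (volume.restrict (Ioo a₁ b₁)).prod (volume.restrict (Ioo a₂ b₂)) := by
  rw [rectQ', Measure.volume_eq_prod, Measure.prod_restrict]

lemma restrict_boxQ : (volume : Measure (ℝ × ℝ × ℝ)).restrict (boxQ a₁ b₁ a₂ b₂)
    = (volume.restrict intervalI).prod (volume.restrict (rectQ' a₁ b₁ a₂ b₂)) := by
  rw [boxQ, Measure.volume_eq_prod, Measure.prod_restrict]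

-- The measure occurs in the type of the elements of `L²(Q)`, so that `restrict_boxQ` cannot be used
-- for rewriting there; the following forms can.
lemma integrable_boxQ_iff {E : Type*} [NormedAddCommGroup E] {g : ℝ × ℝ × ℝ → E} : IntegrableOn g (boxQ a₁ b₁ a₂ b₂) ↔
    Integrable g ((volume.restrict intervalI).prod (volume.restrict (rectQ' a₁ b₁ a₂ b₂))) := by
  rw [IntegrableOn, restrict_boxQ]

lemma ae_boxQ_iff {p : ℝ × ℝ × ℝ → Prop} : (∀ᵐ x ∂volume.restrict (boxQ a₁ b₁ a₂ b₂), p x) ↔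
    ∀ᵐ x ∂(volume.restrict intervalI).prod (volume.restrict (rectQ' a₁ b₁ a₂ b₂)), p x := by
  rw [restrict_boxQ]

lemma integral_boxQ {g : ℝ × ℝ × ℝ → ℂ} (hg : IntegrableOn g (boxQ a₁ b₁ a₂ b₂)) :
    ∫ x in boxQ a₁ b₁ a₂ b₂, g x = ∫ x in intervalI, ∫ y in rectQ' a₁ b₁ a₂ b₂, g (x, y) := by
  rw [integrable_boxQ_iff] at hg
  rw [restrict_boxQ, integral_prod _ hg]

lemma volume_boxQ_ne_top : volume (boxQ a₁ b₁ a₂ b₂) ≠ ⊤ := by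
  rw [boxQ, Measure.volume_eq_prod, Measure.prod_prod, volume_rectQ', volume_intervalI]
  finiteness

instance isFiniteMeasure_boxQ :
    IsFiniteMeasure ((volume : Measure (ℝ × ℝ × ℝ)).restrict (boxQ a₁ b₁ a₂ b₂)) :=
  ⟨by rw [Measure.restrict_apply_univ]; exact volume_boxQ_ne_top.lt_top⟩

lemma isOpen_boxQ : IsOpen (boxQ a₁ b₁ a₂ b₂) := isOpen_Ioo.prod (isOpen_Ioo.prod isOpen_Ioo)

lemma memLp_mode (σ τ : Bool) (n : ℕ × ℕ) (p : ℝ≥0∞) :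
    MemLp (fun x => (mode a₁ b₁ a₂ b₂ σ τ n x : ℂ)) p (volume.restrict (rectQ' a₁ b₁ a₂ b₂)) :=
  MemLp.of_bound (Complex.continuous_ofReal.comp (continuous_mode σ τ n)).aestronglyMeasurable _
    (ae_of_all _ fun x => by simpa using abs_mode_le σ τ n x)

lemma integral_mode_mul_mode (h₁ : a₁ < b₁) (h₂ : a₂ < b₂) (σ τ : Bool) (n m : ℕ × ℕ) :
    ∫ x in rectQ' a₁ b₁ a₂ b₂, mode a₁ b₁ a₂ b₂ σ τ n x * mode a₁ b₁ a₂ b₂ σ τ m x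
      = if n = m then 1 else 0 := by
  have hL₁ := sub_pos.2 h₁
  have hL₂ := sub_pos.2 h₂
  have e : ∀ x : ℝ × ℝ, mode a₁ b₁ a₂ b₂ σ τ n x * mode a₁ b₁ a₂ b₂ σ τ m x
      = 4 / ((b₁ - a₁) * (b₂ - a₂)) * ((trig σ a₁ b₁ n.1 x.1 * trig σ a₁ b₁ m.1 x.1)
        * (trig τ a₂ b₂ n.2 x.2 * trig τ a₂ b₂ m.2 x.2)) := by
    intro x
    have : (2 / √((b₁ - a₁) * (b₂ - a₂))) ^ 2 = 4 / ((b₁ - a₁) * (b₂ - a₂)) := by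
      rw [div_pow, Real.sq_sqrt (by positivity)]; norm_num
    rw [← this, mode, mode]; ring
  simp_rw [e, integral_const_mul]
  rw [restrict_rectQ', integral_prod_mul (fun x => trig σ a₁ b₁ n.1 x * trig σ a₁ b₁ m.1 x)
    (fun y => trig τ a₂ b₂ n.2 y * trig τ a₂ b₂ m.2 y), ← integral_Ioc_eq_integral_Ioo,
    ← integral_Ioc_eq_integral_Ioo, ← intervalIntegral.integral_of_le h₁.le,
    ← intervalIntegral.integral_of_le h₂.le, integral_trig_mul_trig h₁, integral_trig_mul_trig h₂]
  rcases n with ⟨j, k⟩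
  rcases m with ⟨j', k'⟩
  by_cases hj : j = j' <;> by_cases hk : k = k' <;> simp [hj, hk]
  field_simp; norm_num

lemma memLp_tensor (σ τ : Bool) (n : ℕ × ℕ) (v : L2I) :
    MemLp (fun x : ℝ × ℝ × ℝ => v x.1 * (mode a₁ b₁ a₂ b₂ σ τ n x.2 : ℂ)) 2
      (volume.restrict (boxQ a₁ b₁ a₂ b₂)) := by
  rw [restrict_boxQ]
  have hm := memLp_mode (a₁ := a₁) (b₁ := b₁) (a₂ := a₂) (b₂ := b₂) σ τ n 2
  rw [memLp_two_iff_integrable_sq_norm]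
  · simp_rw [norm_mul, mul_pow]
    exact ((memLp_two_iff_integrable_sq_norm (Lp.aestronglyMeasurable v)).1 (Lp.memLp v)).mul_prod
      ((memLp_two_iff_integrable_sq_norm hm.1).1 hm)
  · exact (Lp.aestronglyMeasurable v).comp_fst.mul hm.1.comp_snd

/-- The map `v ↦ v ⊗ ψ` from `L²(I)` to `L²(Q)`, for a mode `ψ`. -/
noncomputable def modeTensor (σ τ : Bool) (n : ℕ × ℕ) : L2I →ₗ[ℂ] L2Q a₁ b₁ a₂ b₂ where
  toFun v := (memLp_tensor σ τ n v).toLp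
  map_add' v w := by
    rw [← MemLp.toLp_add]
    refine MemLp.toLp_congr _ _ ?_
    rw [restrict_boxQ]
    refine (Measure.quasiMeasurePreserving_fst.ae (Lp.coeFn_add v w)).mono fun x hx => ?_
    simp only [hx, Pi.add_apply, add_mul]
  map_smul' c v := by
    rw [RingHom.id_apply, ← MemLp.toLp_const_smul]
    refine MemLp.toLp_congr _ _ ?_
    rw [restrict_boxQ]
    refine (Measure.quasiMeasurePreserving_fst.ae (Lp.coeFn_smul c v)).mono fun x hx => ?_
    simp only [hx, Pi.smul_apply, smul_eq_mul, mul_assoc]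

lemma coeFn_modeTensor (σ τ : Bool) (n : ℕ × ℕ) (v : L2I) :
    (modeTensor σ τ n v : L2Q a₁ b₁ a₂ b₂) =ᵐ[volume.restrict (boxQ a₁ b₁ a₂ b₂)]
      fun x => v x.1 * (mode a₁ b₁ a₂ b₂ σ τ n x.2 : ℂ) := (memLp_tensor σ τ n v).coeFn_toLp

lemma inner_modeTensor (h₁ : a₁ < b₁) (h₂ : a₂ < b₂) (σ τ : Bool) (n m : ℕ × ℕ) (v w : L2I) :
    inner ℂ (modeTensor σ τ n v : L2Q a₁ b₁ a₂ b₂) (modeTensor σ τ m w)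
      = if n = m then inner ℂ v w else 0 := by
  have e : inner ℂ (modeTensor σ τ n v : L2Q a₁ b₁ a₂ b₂) (modeTensor σ τ m w)
      = ∫ x in boxQ a₁ b₁ a₂ b₂, inner ℂ (v x.1) (w x.1) *
        ((mode a₁ b₁ a₂ b₂ σ τ n x.2 * mode a₁ b₁ a₂ b₂ σ τ m x.2 : ℝ) : ℂ) := by
    rw [L2.inner_def]
    refine integral_congr_ae ?_
    filter_upwards [coeFn_modeTensor σ τ n v, coeFn_modeTensor σ τ m w] with x h1 h2
    simp only [h1, h2, RCLike.inner_apply, map_mul, Complex.conj_ofReal]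
    push_cast; ring
  rw [e, restrict_boxQ, integral_prod_mul (fun x => inner ℂ (v x) (w x)) (fun y : ℝ × ℝ =>
    ((mode a₁ b₁ a₂ b₂ σ τ n y * mode a₁ b₁ a₂ b₂ σ τ m y : ℝ) : ℂ)), integral_complex_ofReal,
    integral_mode_mul_mode h₁ h₂, ← L2.inner_def]
  split_ifs <;> simp

/-- The map `v ↦ v ⊗ ψ` as an isometry. -/
noncomputable def modeEmb (h₁ : a₁ < b₁) (h₂ : a₂ < b₂) (σ τ : Bool) (n : ℕ × ℕ) :
    L2I →ₗᵢ[ℂ] L2Q a₁ b₁ a₂ b₂ :=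
  (modeTensor σ τ n).isometryOfInner fun v w => by rw [inner_modeTensor h₁ h₂, if_pos rfl]

lemma orthogonalFamily_modeEmb (h₁ : a₁ < b₁) (h₂ : a₂ < b₂) (σ τ : Bool) :
    OrthogonalFamily ℂ (fun _ : ℕ × ℕ => L2I) (modeEmb h₁ h₂ σ τ) := fun n m hnm v w => by
  change inner ℂ (modeTensor σ τ n v) (modeTensor σ τ m w) = 0
  rw [inner_modeTensor h₁ h₂, if_neg hnm]

lemma inner_modeTensor_left (σ τ : Bool) (n : ℕ × ℕ) (v : L2I) (f : L2Q a₁ b₁ a₂ b₂) :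
    inner ℂ (modeTensor σ τ n v) f = ∫ x in intervalI, (starRingEnd ℂ) (v x) *
      ∫ y in rectQ' a₁ b₁ a₂ b₂, f (x, y) * (mode a₁ b₁ a₂ b₂ σ τ n y : ℂ) := by
  have hi : Integrable (fun x : ℝ × ℝ × ℝ => (starRingEnd ℂ) (v x.1 * (mode a₁ b₁ a₂ b₂ σ τ n x.2 : ℂ))
      * f x) (volume.restrict (boxQ a₁ b₁ a₂ b₂)) :=
    (memLp_tensor σ τ n v).star.integrable_mul (Lp.memLp f)
  have e : inner ℂ (modeTensor σ τ n v) f = ∫ x in boxQ a₁ b₁ a₂ b₂,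
      (starRingEnd ℂ) (v x.1 * (mode a₁ b₁ a₂ b₂ σ τ n x.2 : ℂ)) * f x := by
    rw [L2.inner_def]
    refine integral_congr_ae ((coeFn_modeTensor σ τ n v).mono fun x hx => ?_)
    simp only [hx, RCLike.inner_apply]; ring
  rw [e, integral_boxQ hi]
  congr 1; ext x
  rw [← integral_const_mul]
  congr 1; ext y
  simp only [map_mul, Complex.conj_ofReal]; ring

lemma L2Q.integrable (f : L2Q a₁ b₁ a₂ b₂) : Integrable f
    ((volume.restrict intervalI).prod (volume.restrict (rectQ' a₁ b₁ a₂ b₂))) :=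
  integrable_boxQ_iff.1 ((Lp.memLp f).integrable (by norm_num))

lemma ae_eq_zero_of_ae_ae {X Y : Type*} [MeasurableSpace X] [MeasurableSpace Y] {μ : Measure X}
    {ν : Measure Y} [SFinite μ] [SFinite ν] {g : X × Y → ℂ}
    (hg : AEStronglyMeasurable g (μ.prod ν)) (h : ∀ᵐ x ∂μ, ∀ᵐ y ∂ν, g (x, y) = 0) :
    g =ᵐ[μ.prod ν] 0 := by
  have : ∫⁻ z, ‖g z‖ₑ ∂μ.prod ν = 0 := by
    rw [lintegral_prod _ hg.enorm, ← lintegral_zero (μ := μ)]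
    refine lintegral_congr_ae (h.mono fun x hx => ?_)
    simp only
    rw [← lintegral_zero (μ := ν)]
    exact lintegral_congr_ae (hx.mono fun y hy => by simp [hy])
  exact ((lintegral_eq_zero_iff' hg.enorm).1 this).mono fun z hz => enorm_eq_zero.1 hz

/-- The Dirichlet modes are complete in `L¹` of the rectangle. -/
lemma ae_eq_zero_of_integral_mul_mode_eq_zero (h₁ : a₁ < b₁) (h₂ : a₂ < b₂) {g : ℝ × ℝ → ℂ}
    (hg : Integrable g (volume.restrict (rectQ' a₁ b₁ a₂ b₂)))
    (h0 : ∀ n, ∫ y in rectQ' a₁ b₁ a₂ b₂, g y * (mode a₁ b₁ a₂ b₂ true true n y : ℂ) = 0) :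
    g =ᵐ[volume.restrict (rectQ' a₁ b₁ a₂ b₂)] 0 := by
  have hL₁ := sub_pos.2 h₁
  have hL₂ := sub_pos.2 h₂
  rw [restrict_rectQ'] at hg ⊢
  have htr : ∀ {a b : ℝ} (j : ℕ) {ν : Measure ℝ},
      AEStronglyMeasurable (fun x => (trig true a b j x : ℂ)) ν := fun j ν =>
    (Complex.continuous_ofReal.comp (continuous_trig true _ _ j)).aestronglyMeasurable
  have hgk : ∀ k, Integrable (fun y : ℝ × ℝ => g y * (trig true a₂ b₂ k y.2 : ℂ))
      ((volume.restrict (Ioo a₁ b₁)).prod (volume.restrict (Ioo a₂ b₂))) := fun k =>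
    hg.mul_bdd (c := 1) (htr k).comp_snd (ae_of_all _ fun y => by simpa using abs_trig_le_one _ _ _ _ _)
  have inner0 : ∀ k, (fun x => ∫ y in Ioo a₂ b₂, g (x, y) * (trig true a₂ b₂ k y : ℂ))
      =ᵐ[volume.restrict (Ioo a₁ b₁)] 0 := by
    intro k
    refine ae_eq_zero_of_integral_mul_sin_eq_zero h₁ (hgk k).integral_prod_left fun j => ?_
    have hc : ((2 / √((b₁ - a₁) * (b₂ - a₂)) : ℝ) : ℂ) ≠ 0 :=
      Complex.ofReal_ne_zero.2 (by positivity)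
    refine (mul_eq_zero.1 ?_).resolve_left hc
    rw [← h0 (j, k), restrict_rectQ', ← integral_const_mul, integral_prod]
    · congr 1; ext x
      rw [← integral_mul_const, ← integral_const_mul]
      congr 1; ext y
      simp only [mode]; push_cast; ring
    · refine hg.mul_bdd (c := 2 / √((b₁ - a₁) * (b₂ - a₂))) ?_
        (ae_of_all _ fun y => by simpa using abs_mode_le _ _ _ _)
      exact (Complex.continuous_ofReal.comp (continuous_mode _ _ _)).aestronglyMeasurable
  have hz : ∀ᵐ x ∂volume.restrict (Ioo a₁ b₁), ∀ᵐ y ∂volume.restrict (Ioo a₂ b₂), g (x, y) = 0 := by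
    filter_upwards [ae_all_iff.2 inner0, hg.prod_right_ae] with x hx hi
    exact ae_eq_zero_of_integral_mul_sin_eq_zero h₂ hi hx
  exact ae_eq_zero_of_ae_ae hg.1 hz

/-- `L²(Q)` is the Hilbert sum of the spaces `L²(I) ⊗ ψ`, where `ψ` runs through the Dirichlet
modes. -/
lemma isHilbertSum_modeEmb (h₁ : a₁ < b₁) (h₂ : a₂ < b₂) :
    IsHilbertSum ℂ (fun _ : ℕ × ℕ => L2I) (modeEmb h₁ h₂ true true) := by
  refine IsHilbertSum.mk (orthogonalFamily_modeEmb h₁ h₂ true true) ?_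
  rw [top_le_iff, Submodule.topologicalClosure_eq_top_iff, Submodule.eq_bot_iff]
  intro f hf
  have horth : ∀ n v, inner ℂ (modeTensor true true n v) f = 0 := fun n v =>
    (Submodule.mem_orthogonal _ f).1 hf _
      (Submodule.mem_iSup_of_mem n ⟨v, rfl⟩)
  have hfi := f.integrable
  have hfm : ∀ n, Integrable (fun x : ℝ × ℝ × ℝ => f x * (mode a₁ b₁ a₂ b₂ true true n x.2 : ℂ))
      ((volume.restrict intervalI).prod (volume.restrict (rectQ' a₁ b₁ a₂ b₂))) := fun n =>
    hfi.mul_bdd (c := 2 / √((b₁ - a₁) * (b₂ - a₂)))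
      (memLp_mode true true n 2).1.comp_snd (ae_of_all _ fun y => by simpa using abs_mode_le _ _ _ _)
  have hc : ∀ n, (fun x => ∫ y in rectQ' a₁ b₁ a₂ b₂, f (x, y) * (mode a₁ b₁ a₂ b₂ true true n y : ℂ))
      =ᵐ[volume.restrict intervalI] 0 := by
    intro n
    refine (hfm n).integral_prod_left.ae_eq_zero_of_forall_setIntegral_eq_zero fun s hs _ => ?_
    have hs1 : MemLp (s.indicator fun _ => (1 : ℂ)) 2 (volume.restrict intervalI) :=
      (memLp_const 1).indicator hs
    rw [← horth n hs1.toLp, inner_modeTensor_left, ← integral_indicator hs]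
    refine integral_congr_ae (hs1.coeFn_toLp.mono fun x hx => ?_)
    simp only [hx]
    by_cases hxs : x ∈ s <;> simp [hxs]
  have : (f : ℝ × ℝ × ℝ → ℂ) =ᵐ[volume.restrict (boxQ a₁ b₁ a₂ b₂)] 0 := by
    refine ae_boxQ_iff.2 ?_
    refine ae_eq_zero_of_ae_ae hfi.1 ?_
    filter_upwards [ae_all_iff.2 hc, hfi.prod_right_ae] with x hx hi
    exact ae_eq_zero_of_integral_mul_mode_eq_zero h₁ h₂ hi hx
  exact Lp.eq_zero_iff_ae_eq_zero.2 this

/-! ### Operators acting mode by mode -/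

/-- The coefficients in `L²(I)` of a function in `L²(Q)` with respect to the Dirichlet modes. -/
noncomputable def modeCoeff (h₁ : a₁ < b₁) (h₂ : a₂ < b₂) :
    L2Q a₁ b₁ a₂ b₂ ≃ₗᵢ[ℂ] lp (fun _ : ℕ × ℕ => L2I) 2 :=
  (isHilbertSum_modeEmb h₁ h₂).linearIsometryEquiv

lemma hasSum_modeCoeff (h₁ : a₁ < b₁) (h₂ : a₂ < b₂) (f : L2Q a₁ b₁ a₂ b₂) :
    HasSum (fun n => (modeTensor true true n (modeCoeff h₁ h₂ f n) : L2Q a₁ b₁ a₂ b₂)) f := by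
  have := (isHilbertSum_modeEmb h₁ h₂).hasSum_linearIsometryEquiv_symm (modeCoeff h₁ h₂ f)
  rwa [modeCoeff, LinearIsometryEquiv.symm_apply_apply] at this

lemma hasSum_norm_modeCoeff (h₁ : a₁ < b₁) (h₂ : a₂ < b₂) (f : L2Q a₁ b₁ a₂ b₂) :
    HasSum (fun n => ‖modeCoeff h₁ h₂ f n‖ ^ 2) (‖f‖ ^ 2) := by
  have := lp.hasSum_norm (p := 2) (by norm_num) (modeCoeff h₁ h₂ f)
  rw [LinearIsometryEquiv.norm_map] at this
  simpa using this

lemma memℓp_modeCoeff (h₁ : a₁ < b₁) (h₂ : a₂ < b₂) {D : ℕ × ℕ → L2I →ₗ[ℂ] L2I} {B : ℝ}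
    (hD : ∀ n v, ‖D n v‖ ≤ B * ‖v‖) (f : L2Q a₁ b₁ a₂ b₂) :
    Memℓp (fun n => D n (modeCoeff h₁ h₂ f n)) 2 := by
  refine memℓp_gen ?_
  simp only [ENNReal.toReal_ofNat, Real.rpow_ofNat]
  refine ((hasSum_norm_modeCoeff h₁ h₂ f).summable.mul_left (B ^ 2)).of_nonneg_of_le
    (fun n => by positivity) fun n => ?_
  rw [← mul_pow]
  exact pow_le_pow_left₀ (norm_nonneg _) (hD _ _) 2

/-- The operator `∑ c_n ⊗ φ_n ↦ ∑ D_n c_n ⊗ ψ_n` on `L²(Q)`, where the `φ_n` are the Dirichlet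
modes, `ψ_n` are the modes of type `(σ, τ)` and the operators `D_n` on `L²(I)` are uniformly
bounded. -/
noncomputable def modeMultiplier (h₁ : a₁ < b₁) (h₂ : a₂ < b₂) (σ τ : Bool)
    (D : ℕ × ℕ → L2I →ₗ[ℂ] L2I) {B : ℝ} (hD : ∀ n v, ‖D n v‖ ≤ B * ‖v‖) :
    L2Q a₁ b₁ a₂ b₂ →ₗ[ℂ] L2Q a₁ b₁ a₂ b₂ where
  toFun f := (orthogonalFamily_modeEmb h₁ h₂ σ τ).linearIsometry ⟨_, memℓp_modeCoeff h₁ h₂ hD f⟩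
  map_add' f g := by
    rw [← map_add]
    congr 1
    ext1
    funext n
    simp only [map_add, lp.coeFn_add, Pi.add_apply]
  map_smul' c f := by
    rw [RingHom.id_apply, ← map_smul]
    congr 1
    ext1
    funext n
    simp

section

variable (h₁ : a₁ < b₁) (h₂ : a₂ < b₂) {σ τ : Bool} {D D' : ℕ × ℕ → L2I →ₗ[ℂ] L2I} {B B' : ℝ}
  (hD : ∀ n v, ‖D n v‖ ≤ B * ‖v‖) (hD' : ∀ n v, ‖D' n v‖ ≤ B' * ‖v‖)

lemma hasSum_modeMultiplier (f : L2Q a₁ b₁ a₂ b₂) :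
    HasSum (fun n => (modeTensor σ τ n (D n (modeCoeff h₁ h₂ f n)) : L2Q a₁ b₁ a₂ b₂))
      (modeMultiplier h₁ h₂ σ τ D hD f) :=
  (orthogonalFamily_modeEmb h₁ h₂ σ τ).hasSum_linearIsometry ⟨_, memℓp_modeCoeff h₁ h₂ hD f⟩

lemma norm_modeMultiplier_le (hB : 0 ≤ B) (f : L2Q a₁ b₁ a₂ b₂) :
    ‖modeMultiplier h₁ h₂ σ τ D hD f‖ ≤ B * ‖f‖ := by
  refine le_of_sq_le_sq ?_ (by positivity)
  have e : ‖modeMultiplier h₁ h₂ σ τ D hD f‖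
      = ‖(⟨_, memℓp_modeCoeff h₁ h₂ hD f⟩ : lp (fun _ : ℕ × ℕ => L2I) 2)‖ :=
    (orthogonalFamily_modeEmb h₁ h₂ σ τ).linearIsometry.norm_map _
  have h := lp.hasSum_norm (p := 2) (by norm_num)
    (⟨_, memℓp_modeCoeff h₁ h₂ hD f⟩ : lp (fun _ : ℕ × ℕ => L2I) 2)
  simp only [ENNReal.toReal_ofNat, Real.rpow_ofNat] at h
  rw [e, mul_pow]
  refine hasSum_le (fun n => ?_) h ((hasSum_norm_modeCoeff h₁ h₂ f).mul_left (B ^ 2))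
  rw [← mul_pow]
  exact pow_le_pow_left₀ (norm_nonneg _) (hD _ _) 2

lemma inner_modeMultiplier (h : ∀ n v w, inner ℂ (D n v) w = inner ℂ v (D' n w))
    (f g : L2Q a₁ b₁ a₂ b₂) :
    inner ℂ (modeMultiplier h₁ h₂ true true D hD f) g
      = inner ℂ f (modeMultiplier h₁ h₂ true true D' hD' g) := by
  have key : ∀ (x : lp (fun _ : ℕ × ℕ => L2I) 2),
      modeCoeff h₁ h₂ ((orthogonalFamily_modeEmb h₁ h₂ true true).linearIsometry x) = x :=
    fun x => (modeCoeff h₁ h₂).apply_symm_apply x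
  rw [← (modeCoeff h₁ h₂).inner_map_map, ← (modeCoeff h₁ h₂).inner_map_map f]
  change inner ℂ (modeCoeff h₁ h₂ ((orthogonalFamily_modeEmb h₁ h₂ true true).linearIsometry _)) _
    = inner ℂ _ (modeCoeff h₁ h₂ ((orthogonalFamily_modeEmb h₁ h₂ true true).linearIsometry _))
  rw [key, key, lp.inner_eq_tsum, lp.inner_eq_tsum]
  exact tsum_congr fun n => h n _ _

lemma hasWeakDeriv_modeMultiplier_fst
    (h : ∀ n v, HasWeakDeriv intervalI 1 (D n v) (D' n v)) (f : L2Q a₁ b₁ a₂ b₂) :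
    HasWeakDeriv (boxQ a₁ b₁ a₂ b₂) (frame3 0) (modeMultiplier h₁ h₂ σ τ D hD f)
      (modeMultiplier h₁ h₂ σ τ D' hD' f) := by
  refine HasWeakDeriv.of_hasSum volume_boxQ_ne_top (hasSum_modeMultiplier h₁ h₂ hD f)
    (hasSum_modeMultiplier h₁ h₂ hD' f) fun n => ?_
  refine (HasWeakDeriv.tensor_left (U := intervalI) (U' := rectQ' a₁ b₁ a₂ b₂)
    (L2I.integrable _) (L2I.integrable _) ((memLp_mode σ τ n 1).integrable le_rfl) (h n _)).congr
    (coeFn_modeTensor σ τ n _).symm (coeFn_modeTensor σ τ n _).symm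

lemma hasWeakDeriv_mode_fst (n : ℕ × ℕ) :
    HasWeakDeriv (rectQ' a₁ b₁ a₂ b₂) (1, 0) (fun x => (mode a₁ b₁ a₂ b₂ σ τ n x : ℂ))
      (fun x => ((trigSign σ * freq a₁ b₁ n.1 : ℝ) : ℂ) * (mode a₁ b₁ a₂ b₂ (!σ) τ n x : ℂ)) := by
  have hc : ContDiff ℝ ∞ fun x => (mode a₁ b₁ a₂ b₂ σ τ n x : ℂ) :=
    Complex.ofRealCLM.contDiff.comp (contDiff_mode σ τ n)
  convert hasWeakDeriv_of_contDiff (hc.of_le (by simp)) ((1 : ℝ), (0 : ℝ)) using 1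
  ext ⟨x, y⟩
  rw [← fderiv_slice_left (hc.differentiable (by simp)), fderiv_apply_one_eq_deriv]
  simp only [mode]
  rw [(((hasDerivAt_trig σ a₁ b₁ n.1 x).mul_const _).const_mul _).ofReal_comp.deriv]
  push_cast; ring

lemma hasWeakDeriv_mode_snd (n : ℕ × ℕ) :
    HasWeakDeriv (rectQ' a₁ b₁ a₂ b₂) (0, 1) (fun x => (mode a₁ b₁ a₂ b₂ σ τ n x : ℂ))
      (fun x => ((trigSign τ * freq a₂ b₂ n.2 : ℝ) : ℂ) * (mode a₁ b₁ a₂ b₂ σ (!τ) n x : ℂ)) := by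
  have hc : ContDiff ℝ ∞ fun x => (mode a₁ b₁ a₂ b₂ σ τ n x : ℂ) :=
    Complex.ofRealCLM.contDiff.comp (contDiff_mode σ τ n)
  convert hasWeakDeriv_of_contDiff (hc.of_le (by simp)) ((0 : ℝ), (1 : ℝ)) using 1
  ext ⟨x, y⟩
  rw [← fderiv_slice_right (hc.differentiable (by simp)), fderiv_apply_one_eq_deriv]
  simp only [mode]
  rw [(((hasDerivAt_trig τ a₂ b₂ n.2 y).const_mul _).const_mul _).ofReal_comp.deriv]
  push_cast; ring

lemma coeFn_modeTensor_smul (n : ℕ × ℕ) (c : ℂ) (v : L2I) :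
    (fun x : ℝ × ℝ × ℝ => v x.1 * (c * (mode a₁ b₁ a₂ b₂ σ τ n x.2 : ℂ)))
      =ᵐ[volume.restrict (boxQ a₁ b₁ a₂ b₂)] (modeTensor σ τ n (c • v) : L2Q a₁ b₁ a₂ b₂) := by
  rw [map_smul]
  filter_upwards [coeFn_modeTensor (a₁ := a₁) (b₁ := b₁) (a₂ := a₂) (b₂ := b₂) σ τ n v,
    Lp.coeFn_smul c (modeTensor σ τ n v : L2Q a₁ b₁ a₂ b₂)] with x h1 h2
  rw [h2, Pi.smul_apply, h1, smul_eq_mul]; ring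

lemma hasWeakDeriv_modeMultiplier_snd (hD' : ∀ n v, ‖D' n v‖ ≤ B' * ‖v‖)
    (h : ∀ n v, D' n v = ((trigSign σ * freq a₁ b₁ n.1 : ℝ) : ℂ) • D n v) (f : L2Q a₁ b₁ a₂ b₂) :
    HasWeakDeriv (boxQ a₁ b₁ a₂ b₂) (frame3 1) (modeMultiplier h₁ h₂ σ τ D hD f)
      (modeMultiplier h₁ h₂ (!σ) τ D' hD' f) := by
  refine HasWeakDeriv.of_hasSum volume_boxQ_ne_top (hasSum_modeMultiplier h₁ h₂ hD f)
    (hasSum_modeMultiplier h₁ h₂ hD' f) fun n => ?_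
  rw [h]
  exact (HasWeakDeriv.tensor_right (U := intervalI) (U' := rectQ' a₁ b₁ a₂ b₂)
    (L2I.integrable _) ((memLp_mode σ τ n 1).integrable le_rfl)
    (((memLp_mode (!σ) τ n 1).integrable le_rfl).const_mul _) (hasWeakDeriv_mode_fst n)).congr
    (coeFn_modeTensor σ τ n _).symm (coeFn_modeTensor_smul n _ _)

lemma hasWeakDeriv_modeMultiplier_trd (hD' : ∀ n v, ‖D' n v‖ ≤ B' * ‖v‖)
    (h : ∀ n v, D' n v = ((trigSign τ * freq a₂ b₂ n.2 : ℝ) : ℂ) • D n v) (f : L2Q a₁ b₁ a₂ b₂) :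
    HasWeakDeriv (boxQ a₁ b₁ a₂ b₂) (frame3 2) (modeMultiplier h₁ h₂ σ τ D hD f)
      (modeMultiplier h₁ h₂ σ (!τ) D' hD' f) := by
  refine HasWeakDeriv.of_hasSum volume_boxQ_ne_top (hasSum_modeMultiplier h₁ h₂ hD f)
    (hasSum_modeMultiplier h₁ h₂ hD' f) fun n => ?_
  rw [h]
  exact (HasWeakDeriv.tensor_right (U := intervalI) (U' := rectQ' a₁ b₁ a₂ b₂)
    (L2I.integrable _) ((memLp_mode σ τ n 1).integrable le_rfl)
    (((memLp_mode σ (!τ) n 1).integrable le_rfl).const_mul _) (hasWeakDeriv_mode_snd n)).congr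
    (coeFn_modeTensor σ τ n _).symm (coeFn_modeTensor_smul n _ _)

end

/-! ### The weak Laplacian and its conjugation by an exponential -/

lemma HasWeakDeriv.add {V : Type*} [NormedAddCommGroup V] [NormedSpace ℝ V]
    [FiniteDimensional ℝ V] [MeasureSpace V] [BorelSpace V] {U : Set V} {e : V}
    {u g u' g' : V → ℂ} (h : HasWeakDeriv U e u g) (h' : HasWeakDeriv U e u' g') :
    HasWeakDeriv U e (fun x => u x + u' x) (fun x => g x + g' x) := by
  refine ⟨h.1.add h'.1, h.2.1.add h'.2.1, fun φ hφ => ?_⟩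
  have hφ' := hφ.fderiv_apply e
  simp_rw [add_mul]
  rw [integral_add (hφ'.integrableOn_mul h.1) (hφ'.integrableOn_mul h'.1),
    integral_add (hφ.integrableOn_mul h.2.1) (hφ.integrableOn_mul h'.2.1), h.2.2 φ hφ,
    h'.2.2 φ hφ, neg_add]

lemma hasWeakLaplacian_of_hasWeakDeriv {V ι : Type*} [Fintype ι] [NormedAddCommGroup V]
    [NormedSpace ℝ V] [FiniteDimensional ℝ V] [MeasureSpace V] [BorelSpace V] {U : Set V}
    {e : ι → V} {u : V → ℂ} {g h : ι → V → ℂ} (hu : LocallyIntegrableOn u U)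
    (h1 : ∀ i, HasWeakDeriv U (e i) u (g i)) (h2 : ∀ i, HasWeakDeriv U (e i) (g i) (h i)) :
    HasWeakLaplacian U e u (fun x => ∑ i, h i x) := by
  refine ⟨hu, ?_, fun φ hφ => ?_⟩
  · have : ∀ s : Finset ι, LocallyIntegrableOn (fun x => ∑ i ∈ s, h i x) U := by
      classical
      intro s
      induction s using Finset.induction_on with
      | empty => exact (integrable_zero V ℂ volume).integrableOn.locallyIntegrableOn
      | insert i s hi ih =>
        simp_rw [Finset.sum_insert hi]
        exact (h2 i).2.1.add ih
    exact this _
  · have hφ' := fun i => hφ.fderiv_apply (e i)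
    simp only [classicalLaplacian, Finset.mul_sum, Finset.sum_mul]
    rw [integral_finsetSum _ fun i _ => ((hφ' i).fderiv_apply (e i)).integrableOn_mul hu,
      integral_finsetSum _ fun i _ => hφ.integrableOn_mul (h2 i).2.1]
    refine Finset.sum_congr rfl fun i _ => ?_
    rw [(h1 i).2.2 _ (hφ' i), (h2 i).2.2 _ hφ, neg_neg]

lemma contDiff_exp_fst (l : ℝ) : ContDiff ℝ ∞ fun x : ℝ × ℝ × ℝ => (Real.exp (l * x.1) : ℂ) :=
  Complex.ofRealCLM.contDiff.comp (Real.contDiff_exp.comp (contDiff_const.mul contDiff_fst))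

lemma fderiv_exp_fst (l : ℝ) (x e : ℝ × ℝ × ℝ) :
    fderiv ℝ (fun x : ℝ × ℝ × ℝ => (Real.exp (l * x.1) : ℂ)) x e
      = ((l * e.1 : ℝ) : ℂ) * (Real.exp (l * x.1) : ℂ) := by
  have h : HasFDerivAt (fun x : ℝ × ℝ × ℝ => Real.exp (l * x.1))
      (Real.exp (l * x.1) • (l • ContinuousLinearMap.fst ℝ ℝ (ℝ × ℝ))) x :=
    ((ContinuousLinearMap.fst ℝ ℝ (ℝ × ℝ)).hasFDerivAt.const_mul l).exp
  have h' := (Complex.ofRealCLM.hasFDerivAt.comp x h).fderiv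
  simp only [Function.comp_def, Complex.ofRealCLM_apply] at h'
  rw [h']
  simp; ring

/-- The conjugated Laplacian of a function with weak derivatives of second order, by expanding
`e^{l x₁} Δ e^{-l x₁} = Δ - 2 l ∂₁ + l²`. -/
lemma hasWeakConjLaplacian_of_hasWeakDeriv {Q : Set (ℝ × ℝ × ℝ)} (hQ : IsOpen Q) (l : ℝ)
    {u f : ℝ × ℝ × ℝ → ℂ} {g h : Fin 3 → ℝ × ℝ × ℝ → ℂ} (h1 : ∀ i, HasWeakDeriv Q (frame3 i) u (g i))
    (h2 : ∀ i, HasWeakDeriv Q (frame3 i) (g i) (h i))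
    (hf : ∀ᵐ x ∂volume.restrict Q,
      -(h 0 x + h 1 x + h 2 x) + 2 * l * g 0 x - l ^ 2 * u x = f x) :
    HasWeakConjLaplacian Q l u f := by
  have hρ := contDiff_exp_fst (-l)
  have hρ' : ∀ i, ContDiff ℝ ∞ fun x : ℝ × ℝ × ℝ =>
      fderiv ℝ (fun x : ℝ × ℝ × ℝ => (Real.exp (-l * x.1) : ℂ)) x (frame3 i) := fun i =>
    (hρ.fderiv_right (by simp)).clm_apply contDiff_const
  refine ⟨_, hasWeakLaplacian_of_hasWeakDeriv ((h1 0).smooth_mul hQ hρ).1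
    (fun i => (h1 i).smooth_mul hQ hρ)
    fun i => ((h2 i).smooth_mul hQ hρ).add ((h1 i).smooth_mul hQ (hρ' i)), ?_⟩
  filter_upwards [hf] with x hx
  have hexp : (Real.exp (l * x.1) : ℂ) * (Real.exp (-l * x.1) : ℂ) = 1 := by
    rw [← Complex.ofReal_mul, ← Real.exp_add]; simp
  have hd : ∀ i : Fin 3, fderiv ℝ (fun x : ℝ × ℝ × ℝ => fderiv ℝ (fun x : ℝ × ℝ × ℝ =>
      (Real.exp (-l * x.1) : ℂ)) x (frame3 i)) x (frame3 i)
      = ((-l * (frame3 i).1 : ℝ) : ℂ) * (((-l * (frame3 i).1 : ℝ) : ℂ) * (Real.exp (-l * x.1) : ℂ)) := by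
    intro i
    simp_rw [fderiv_exp_fst]
    rw [fderiv_const_mul ((contDiff_exp_fst (-l)).differentiable (by simp) x),
      smul_apply, fderiv_exp_fst, smul_eq_mul]
  simp only [hd]
  simp only [fderiv_exp_fst, Fin.sum_univ_three, frame3, Matrix.cons_val_zero, Matrix.cons_val_one,
    Matrix.cons_val, mul_zero, Complex.ofReal_zero, zero_mul, add_zero, mul_one]
  rw [← hx, ← one_mul (-(h 0 x + h 1 x + h 2 x) + 2 * l * g 0 x - l ^ 2 * u x), ← hexp]
  push_cast; ring

/-! ### The solution operator -/

section

variable (h₁ : a₁ < b₁) (h₂ : a₂ < b₂) {l : ℝ}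

/-- `greenOp` at the frequency of the mode `n`. -/
noncomputable def modeGreen (l : ℝ) (n : ℕ × ℕ) : L2I →ₗ[ℂ] L2I := greenOp l (modeFreq_pos h₁ h₂ n)

/-- `greenDerivOp` at the frequency of the mode `n`. -/
noncomputable def modeGreenDeriv (hl : l ≠ 0) (n : ℕ × ℕ) : L2I →ₗ[ℂ] L2I :=
  greenDerivOp hl (modeFreq_pos h₁ h₂ n)

lemma norm_modeGreen_le (hl : l ≠ 0) (n : ℕ × ℕ) (v : L2I) :
    ‖modeGreen h₁ h₂ l n v‖ ≤ 4 / |l| * ‖v‖ := norm_greenOp_le hl _ v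

/-- The right inverse of `e^{l x₁} (-Δ) e^{-l x₁}` on `L²(Q)`: separation of variables in the
Dirichlet modes of the rectangle, the equation for each coefficient being solved by its Green
kernel. -/
noncomputable def solutionOp (hl : l ≠ 0) : L2Q a₁ b₁ a₂ b₂ →ₗ[ℂ] L2Q a₁ b₁ a₂ b₂ :=
  modeMultiplier h₁ h₂ true true (modeGreen h₁ h₂ l) (norm_modeGreen_le h₁ h₂ hl)

lemma abs_trigSign (σ : Bool) : |trigSign σ| = 1 := by cases σ <;> simp [trigSign]

lemma freq_fst_le_modeFreq (n : ℕ × ℕ) : |freq a₁ b₁ n.1| ≤ modeFreq a₁ b₁ a₂ b₂ n :=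
  Real.abs_le_sqrt (le_add_of_nonneg_right (sq_nonneg _))

lemma freq_snd_le_modeFreq (n : ℕ × ℕ) : |freq a₂ b₂ n.2| ≤ modeFreq a₁ b₁ a₂ b₂ n :=
  Real.abs_le_sqrt (le_add_of_nonneg_left (sq_nonneg _))

lemma norm_ofReal_smul_le {c μ B : ℝ} {v w : L2I} (hc : |c| ≤ μ) (h : μ * ‖v‖ ≤ B * ‖w‖) :
    ‖(c : ℂ) • v‖ ≤ B * ‖w‖ := by
  rw [norm_smul, Complex.norm_real, Real.norm_eq_abs]
  exact (mul_le_mul_of_nonneg_right hc (norm_nonneg _)).trans h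

/-- The weak derivatives of `solutionOp f` of first and second order, with the bounds that do not
depend on `l` and the differential equation. -/
lemma exists_derivatives_solutionOp (hl : l ≠ 0) (f : L2Q a₁ b₁ a₂ b₂) :
    ∃ (g : Fin 3 → L2Q a₁ b₁ a₂ b₂) (h : Fin 3 → Fin 3 → L2Q a₁ b₁ a₂ b₂),
      (∀ i, HasWeakDeriv (boxQ a₁ b₁ a₂ b₂) (frame3 i) (solutionOp h₁ h₂ hl f) (g i)) ∧
      (∀ i j, HasWeakDeriv (boxQ a₁ b₁ a₂ b₂) (frame3 j) (g i) (h i j)) ∧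
      (∀ i, ‖g i‖ ≤ 6 * ‖f‖) ∧
      -(h 0 0 + h 1 1 + h 2 2) + ((2 * l : ℝ) : ℂ) • g 0
        - ((l ^ 2 : ℝ) : ℂ) • solutionOp h₁ h₂ hl f = f := by
  set K : ℝ := 12 * |l| + 4 with hK
  set μ := modeFreq a₁ b₁ a₂ b₂ with hμ
  have hμ0 : ∀ n, 0 < μ n := modeFreq_pos h₁ h₂
  set G := modeGreen h₁ h₂ l with hG
  set G' := modeGreenDeriv h₁ h₂ hl with hG'
  have bG : ∀ n v, ‖G n v‖ ≤ 4 / |l| * ‖v‖ := norm_modeGreen_le h₁ h₂ hl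
  have bμG : ∀ n v, μ n * ‖G n v‖ ≤ 1 * ‖v‖ := fun n v =>
    (mul_norm_greenOp_le l (hμ0 n) v).trans_eq (one_mul _).symm
  have bμμG : ∀ n v, μ n * μ n * ‖G n v‖ ≤ K * ‖v‖ := fun n v => by
    rw [← sq]; exact sq_mul_norm_greenOp_le l (hμ0 n) v
  have bG' : ∀ n v, ‖G' n v‖ ≤ 6 * ‖v‖ := fun n v => norm_greenDerivOp_le hl (hμ0 n) v
  have bμG' : ∀ n v, μ n * ‖G' n v‖ ≤ K * ‖v‖ := fun n v => mul_norm_greenDerivOp_le hl (hμ0 n) v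
  -- the frequencies with the signs produced by differentiating a sine or a cosine
  set c := fun (σ : Bool) (n : ℕ × ℕ) => trigSign σ * freq a₁ b₁ n.1 with hc
  set d := fun (τ : Bool) (n : ℕ × ℕ) => trigSign τ * freq a₂ b₂ n.2 with hd
  have hcμ : ∀ σ n, |c σ n| ≤ μ n := fun σ n => by
    rw [abs_mul, abs_trigSign, one_mul]; exact freq_fst_le_modeFreq n
  have hdμ : ∀ τ n, |d τ n| ≤ μ n := fun τ n => by
    rw [abs_mul, abs_trigSign, one_mul]; exact freq_snd_le_modeFreq n
  have two : ∀ {x y : ℝ} {n : ℕ × ℕ} {v : L2I}, |x| ≤ μ n → |y| ≤ μ n →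
      ‖(x : ℂ) • (y : ℂ) • G n v‖ ≤ K * ‖v‖ := fun {x y n v} hx hy => by
    rw [smul_smul, ← Complex.ofReal_mul]
    refine norm_ofReal_smul_le ?_ (bμμG n v)
    rw [abs_mul]
    exact mul_le_mul hx hy (abs_nonneg _) (hμ0 n).le
  have b1 : ∀ n v, ‖((c true n : ℂ) • G n) v‖ ≤ 1 * ‖v‖ := fun n v =>
    norm_ofReal_smul_le (hcμ _ n) (bμG n v)
  have b2 : ∀ n v, ‖((d true n : ℂ) • G n) v‖ ≤ 1 * ‖v‖ := fun n v =>
    norm_ofReal_smul_le (hdμ _ n) (bμG n v)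
  set H : ℕ × ℕ → L2I →ₗ[ℂ] L2I := fun n => ((2 * l : ℝ) : ℂ) • G' n
    + ((μ n ^ 2 - l ^ 2 : ℝ) : ℂ) • G n - LinearMap.id with hH
  have b00 : ∀ n v, ‖H n v‖ ≤ (|2 * l| * 6 + (K + l ^ 2 * (4 / |l|)) + 1) * ‖v‖ := fun n v => by
    have e : H n v = ((2 * l : ℝ) : ℂ) • G' n v + (((μ n ^ 2 : ℝ) : ℂ) • G n v
        - ((l ^ 2 : ℝ) : ℂ) • G n v) - v := by
      rw [← sub_smul, ← Complex.ofReal_sub]; rfl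
    have n1 : ‖((2 * l : ℝ) : ℂ) • G' n v‖ ≤ |2 * l| * (6 * ‖v‖) := by
      rw [norm_smul, Complex.norm_real]
      exact mul_le_mul_of_nonneg_left (bG' n v) (norm_nonneg _)
    have n2 : ‖((μ n ^ 2 : ℝ) : ℂ) • G n v‖ ≤ K * ‖v‖ :=
      norm_ofReal_smul_le (by rw [abs_of_nonneg (sq_nonneg _), sq]) (bμμG n v)
    have n3 : ‖((l ^ 2 : ℝ) : ℂ) • G n v‖ ≤ l ^ 2 * (4 / |l| * ‖v‖) := by
      rw [norm_smul, Complex.norm_real, Real.norm_of_nonneg (sq_nonneg _)]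
      exact mul_le_mul_of_nonneg_left (bG n v) (sq_nonneg _)
    rw [e]
    refine (norm_sub_le _ _).trans ?_
    have := (norm_add_le (((2 * l : ℝ) : ℂ) • G' n v) (((μ n ^ 2 : ℝ) : ℂ) • G n v
        - ((l ^ 2 : ℝ) : ℂ) • G n v)).trans (add_le_add_right (norm_sub_le _ _) _)
    linarith
  have b01 : ∀ n v, ‖((c true n : ℂ) • G' n) v‖ ≤ K * ‖v‖ := fun n v =>
    norm_ofReal_smul_le (hcμ _ n) (bμG' n v)
  have b02 : ∀ n v, ‖((d true n : ℂ) • G' n) v‖ ≤ K * ‖v‖ := fun n v =>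
    norm_ofReal_smul_le (hdμ _ n) (bμG' n v)
  have b11 : ∀ n v, ‖((c false n : ℂ) • (c true n : ℂ) • G n) v‖ ≤ K * ‖v‖ := fun n v =>
    two (hcμ _ n) (hcμ _ n)
  have b12 : ∀ n v, ‖((d true n : ℂ) • (c true n : ℂ) • G n) v‖ ≤ K * ‖v‖ := fun n v =>
    two (hdμ _ n) (hcμ _ n)
  have b21 : ∀ n v, ‖((c true n : ℂ) • (d true n : ℂ) • G n) v‖ ≤ K * ‖v‖ := fun n v =>
    two (hcμ _ n) (hdμ _ n)
  have b22 : ∀ n v, ‖((d false n : ℂ) • (d true n : ℂ) • G n) v‖ ≤ K * ‖v‖ := fun n v =>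
    two (hdμ _ n) (hdμ _ n)
  have w0 : ∀ n v, HasWeakDeriv intervalI 1 (G n v) (G' n v) := fun n v =>
    hasWeakDeriv_greenOp hl (hμ0 n) v
  have w00 : ∀ n v, HasWeakDeriv intervalI 1 (G' n v) (H n v) := fun n v =>
    hasWeakDeriv_greenDerivOp hl (hμ0 n) v
  have wc : ∀ {D D' : ℕ × ℕ → L2I →ₗ[ℂ] L2I} (x : ℕ × ℕ → ℝ),
      (∀ n v, HasWeakDeriv intervalI 1 (D n v) (D' n v)) →
      ∀ n v, HasWeakDeriv intervalI 1 (((x n : ℂ) • D n) v) (((x n : ℂ) • D' n) v) := by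
    intro D D' x h n v
    have := (h n v).smooth_mul isOpen_Ioo (contDiff_const (c := (x n : ℂ)))
    refine this.congr (Lp.coeFn_smul (x n : ℂ) (D n v)).symm ?_
    refine EventuallyEq.trans (ae_of_all _ fun t => ?_) (Lp.coeFn_smul (x n : ℂ) (D' n v)).symm
    simp
  refine ⟨![modeMultiplier h₁ h₂ true true G' bG' f, modeMultiplier h₁ h₂ false true _ b1 f,
      modeMultiplier h₁ h₂ true false _ b2 f],
    ![![modeMultiplier h₁ h₂ true true H b00 f, modeMultiplier h₁ h₂ false true _ b01 f,
        modeMultiplier h₁ h₂ true false _ b02 f],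
      ![modeMultiplier h₁ h₂ false true _ b01 f, modeMultiplier h₁ h₂ true true _ b11 f,
        modeMultiplier h₁ h₂ false false _ b12 f],
      ![modeMultiplier h₁ h₂ true false _ b02 f, modeMultiplier h₁ h₂ false false _ b21 f,
        modeMultiplier h₁ h₂ true true _ b22 f]], ?_, ?_, ?_, ?_⟩
  · intro i
    fin_cases i
    · exact hasWeakDeriv_modeMultiplier_fst h₁ h₂ _ _ w0 f
    · exact hasWeakDeriv_modeMultiplier_snd h₁ h₂ _ _ (fun n v => rfl) f
    · exact hasWeakDeriv_modeMultiplier_trd h₁ h₂ _ _ (fun n v => rfl) f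
  · intro i j
    fin_cases i <;> fin_cases j
    · exact hasWeakDeriv_modeMultiplier_fst h₁ h₂ _ _ w00 f
    · exact hasWeakDeriv_modeMultiplier_snd h₁ h₂ _ _ (fun n v => rfl) f
    · exact hasWeakDeriv_modeMultiplier_trd h₁ h₂ _ _ (fun n v => rfl) f
    · exact hasWeakDeriv_modeMultiplier_fst h₁ h₂ _ _ (wc _ w0) f
    · exact hasWeakDeriv_modeMultiplier_snd h₁ h₂ _ _ (fun n v => rfl) f
    · exact hasWeakDeriv_modeMultiplier_trd h₁ h₂ _ _ (fun n v => rfl) f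
    · exact hasWeakDeriv_modeMultiplier_fst h₁ h₂ _ _ (wc _ w0) f
    · exact hasWeakDeriv_modeMultiplier_snd h₁ h₂ _ _ (fun n v => rfl) f
    · exact hasWeakDeriv_modeMultiplier_trd h₁ h₂ _ _ (fun n v => rfl) f
  · have one : ∀ {x : ℝ}, x ≤ 1 * ‖f‖ → x ≤ 6 * ‖f‖ := fun h =>
      h.trans (mul_le_mul_of_nonneg_right (by norm_num) (norm_nonneg _))
    intro i
    fin_cases i
    · exact norm_modeMultiplier_le h₁ h₂ bG' (by norm_num) f
    · exact one (norm_modeMultiplier_le h₁ h₂ b1 zero_le_one f)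
    · exact one (norm_modeMultiplier_le h₁ h₂ b2 zero_le_one f)
  · refine HasSum.unique ?_ (hasSum_modeCoeff h₁ h₂ f)
    have := (((hasSum_modeMultiplier (σ := true) (τ := true) h₁ h₂ b00 f).add
      (hasSum_modeMultiplier (σ := true) (τ := true) h₁ h₂ b11 f)).add
      (hasSum_modeMultiplier (σ := true) (τ := true) h₁ h₂ b22 f)).neg.add
      ((hasSum_modeMultiplier (σ := true) (τ := true) h₁ h₂ bG' f).const_smul ((2 * l : ℝ) : ℂ))
    refine HasSum.congr_fun (this.sub ((hasSum_modeMultiplier (σ := true) (τ := true) h₁ h₂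
      bG f).const_smul ((l ^ 2 : ℝ) : ℂ))) fun n => ?_
    generalize modeCoeff h₁ h₂ f n = w
    have lin : ∀ (a b : ℂ) (x y z p q : L2I), -(modeTensor true true n x + modeTensor true true n y
          + modeTensor true true n z) + a • modeTensor true true n p - b • modeTensor true true n q
        = (modeTensor true true n (-(x + y + z) + a • p - b • q) : L2Q a₁ b₁ a₂ b₂) := by
      intros
      simp only [map_sub, map_add, map_neg, map_smul]
    rw [lin]
    congr 1
    simp only [hH, LinearMap.add_apply, LinearMap.sub_apply, LinearMap.smul_apply, LinearMap.id_apply,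
      smul_smul, ← Complex.ofReal_mul]
    have e1 : c false n * c true n = - freq a₁ b₁ n.1 ^ 2 := by simp [hc, trigSign]; ring
    have e2 : d false n * d true n = - freq a₂ b₂ n.2 ^ 2 := by simp [hd, trigSign]; ring
    rw [e1, e2, hμ, modeFreq_sq]
    push_cast
    module

end

section

variable (h₁ : a₁ < b₁) (h₂ : a₂ < b₂) {l : ℝ}

lemma memH2_solutionOp (hl : l ≠ 0) (f : L2Q a₁ b₁ a₂ b₂) :
    MemH2 (boxQ a₁ b₁ a₂ b₂) frame3 (solutionOp h₁ h₂ hl f) := by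
  obtain ⟨g, h, hg, hh, -, -⟩ := exists_derivatives_solutionOp h₁ h₂ hl f
  exact ⟨Lp.memLp _, fun i => g i, fun i j => h i j, fun i => ⟨Lp.memLp _, hg i⟩,
    fun i j => ⟨Lp.memLp _, hh i j⟩⟩

lemma hasWeakConjLaplacian_solutionOp (hl : l ≠ 0) (f : L2Q a₁ b₁ a₂ b₂) :
    HasWeakConjLaplacian (boxQ a₁ b₁ a₂ b₂) l (solutionOp h₁ h₂ hl f) f := by
  obtain ⟨g, h, hg, hh, -, e⟩ := exists_derivatives_solutionOp h₁ h₂ hl f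
  refine hasWeakConjLaplacian_of_hasWeakDeriv isOpen_boxQ l hg (fun i => hh i i) ?_
  set u := solutionOp h₁ h₂ hl f
  filter_upwards [Lp.coeFn_sub (-(h 0 0 + h 1 1 + h 2 2) + ((2 * l : ℝ) : ℂ) • g 0)
      (((l ^ 2 : ℝ) : ℂ) • u), Lp.coeFn_add (-(h 0 0 + h 1 1 + h 2 2)) (((2 * l : ℝ) : ℂ) • g 0),
    Lp.coeFn_neg (h 0 0 + h 1 1 + h 2 2), Lp.coeFn_add (h 0 0 + h 1 1) (h 2 2),
    Lp.coeFn_add (h 0 0) (h 1 1), Lp.coeFn_smul ((2 * l : ℝ) : ℂ) (g 0),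
    Lp.coeFn_smul ((l ^ 2 : ℝ) : ℂ) u] with x e1 e2 e3 e4 e5 e6 e7
  rw [e] at e1
  rw [e1, Pi.sub_apply, e2, Pi.add_apply, e3, Pi.neg_apply, e4, Pi.add_apply, e5, Pi.add_apply,
    e6, e7, Pi.smul_apply, Pi.smul_apply, smul_eq_mul, smul_eq_mul]
  push_cast; ring

lemma norm_solutionOp_le (hl : l ≠ 0) (f : L2Q a₁ b₁ a₂ b₂) :
    ‖solutionOp h₁ h₂ hl f‖ ≤ 4 / |l| * ‖f‖ :=
  norm_modeMultiplier_le h₁ h₂ _ (by positivity) f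

lemma h1Norm_solutionOp_le (hl : l ≠ 0) (hl4 : 4 ≤ |l|) (f : L2Q a₁ b₁ a₂ b₂) :
    h1Norm (boxQ a₁ b₁ a₂ b₂) frame3 (solutionOp h₁ h₂ hl f) ≤ ENNReal.ofReal (11 * ‖f‖) := by
  obtain ⟨g, h, hg, -, hb, -⟩ := exists_derivatives_solutionOp h₁ h₂ hl f
  have hu : ‖solutionOp h₁ h₂ hl f‖ ≤ 1 * ‖f‖ := by
    refine (norm_solutionOp_le h₁ h₂ hl f).trans ?_
    gcongr
    rwa [div_le_one (by linarith)]
  have toE : ∀ {w : L2Q a₁ b₁ a₂ b₂} {B : ℝ}, ‖w‖ ≤ B →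
      eLpNorm w 2 (volume.restrict (boxQ a₁ b₁ a₂ b₂)) ≤ ENNReal.ofReal B := fun {w B} hw => by
    rw [← ENNReal.ofReal_toReal (Lp.eLpNorm_ne_top w)]
    exact ENNReal.ofReal_le_ofReal hw
  refine (iInf₂_le (fun i => (g i : ℝ × ℝ × ℝ → ℂ)) hg).trans ?_
  calc _ ≤ (ENNReal.ofReal (1 * ‖f‖) ^ 2 + ∑ _i : Fin 3, ENNReal.ofReal (6 * ‖f‖) ^ 2) ^ (1 / 2 : ℝ) := by
        gcongr with i
        · exact toE hu
        · exact toE (hb i)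
    _ ≤ (ENNReal.ofReal (11 * ‖f‖) ^ 2) ^ (1 / 2 : ℝ) := by
        gcongr
        rw [Finset.sum_const, Finset.card_univ, Fintype.card_fin, nsmul_eq_mul,
          ← ENNReal.ofReal_pow (by positivity), ← ENNReal.ofReal_pow (by positivity),
          ← ENNReal.ofReal_pow (by positivity), ← ENNReal.ofReal_natCast,
          ← ENNReal.ofReal_mul (by positivity), ← ENNReal.ofReal_add (by positivity) (by positivity)]
        refine ENNReal.ofReal_le_ofReal ?_
        push_cast
        nlinarith [sq_nonneg ‖f‖]
    _ = ENNReal.ofReal (11 * ‖f‖) := by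
        rw [← ENNReal.rpow_natCast_mul]; norm_num

lemma inner_solutionOp (hl : l ≠ 0) (f g : L2Q a₁ b₁ a₂ b₂) :
    inner ℂ (solutionOp h₁ h₂ hl f) g = inner ℂ f (solutionOp h₁ h₂ (neg_ne_zero.2 hl) g) :=
  inner_modeMultiplier h₁ h₂ _ _ (fun n => inner_greenOp (modeFreq_pos h₁ h₂ n)) f g

lemma classicalLaplacian_conj {V ι : Type*} [NormedAddCommGroup V] [NormedSpace ℝ V] [Fintype ι]
    (e : ι → V) (φ : V → ℂ) (x : V) : classicalLaplacian e (fun y => (starRingEnd ℂ) (φ y)) x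
      = (starRingEnd ℂ) (classicalLaplacian e φ x) := by
  have h : ∀ (φ : V → ℂ) (x v : V), fderiv ℝ (fun y => (starRingEnd ℂ) (φ y)) x v
      = (starRingEnd ℂ) (fderiv ℝ φ x v) := fun φ x v => by
    have := Complex.conjCLE.comp_fderiv (f := φ) (x := x)
    have := congrArg (fun L : V →L[ℝ] ℂ => L v) this
    exact this
  simp only [classicalLaplacian, h, map_sum]

/-- The operator is also a left inverse on test functions. Its adjoint is the operator for `-l`,
which is a right inverse of the formal adjoint `e^{-l x₁} (-Δ) e^{l x₁}`. -/
lemma solutionOp_conjLaplacian (hl : l ≠ 0) {φ : ℝ × ℝ × ℝ → ℂ}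
    (hφ : IsTestFunction (boxQ a₁ b₁ a₂ b₂) φ) {g : L2Q a₁ b₁ a₂ b₂}
    (hg : g =ᵐ[volume.restrict (boxQ a₁ b₁ a₂ b₂)] conjLaplacian l φ) :
    solutionOp h₁ h₂ hl g =ᵐ[volume.restrict (boxQ a₁ b₁ a₂ b₂)] φ := by
  have hφL := hφ.memLp 2
  suffices h : solutionOp h₁ h₂ hl g = hφL.toLp by
    rw [h]; exact hφL.coeFn_toLp
  refine ext_inner_right ℂ fun h => ?_
  rw [inner_solutionOp]
  obtain ⟨G, hG, hGh⟩ := hasWeakConjLaplacian_solutionOp h₁ h₂ (neg_ne_zero.2 hl) h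
  set w := solutionOp h₁ h₂ (neg_ne_zero.2 hl) h
  have hχ : IsTestFunction (boxQ a₁ b₁ a₂ b₂) fun x => (Real.exp (-l * x.1) : ℂ) * (starRingEnd ℂ) (φ x) :=
    hφ.conj.mul_left (contDiff_exp_fst (-l))
  have e := hG.2.2 _ hχ
  have hconj : ∀ x, classicalLaplacian frame3
      (fun x => (Real.exp (-l * x.1) : ℂ) * (starRingEnd ℂ) (φ x)) x
      = (starRingEnd ℂ) (classicalLaplacian frame3 (fun x => (Real.exp (-l * x.1) : ℂ) * φ x) x) := by
    intro x
    rw [← classicalLaplacian_conj]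
    simp only [map_mul, Complex.conj_ofReal]
  rw [L2.inner_def, L2.inner_def]
  calc ∫ x in boxQ a₁ b₁ a₂ b₂, inner ℂ (g x) (w x)
      = ∫ x in boxQ a₁ b₁ a₂ b₂, -((Real.exp (- -l * x.1) : ℂ) * w x * classicalLaplacian frame3
        (fun x => (Real.exp (-l * x.1) : ℂ) * (starRingEnd ℂ) (φ x)) x) := by
        refine integral_congr_ae (hg.mono fun x hx => ?_)
        simp only [hx, RCLike.inner_apply, conjLaplacian, hconj, map_mul, map_neg, Complex.conj_ofReal,
          neg_neg]
        ring
    _ = ∫ x in boxQ a₁ b₁ a₂ b₂, -(G x * ((Real.exp (-l * x.1) : ℂ) * (starRingEnd ℂ) (φ x))) := by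
        rw [integral_neg, e, integral_neg]
    _ = ∫ x in boxQ a₁ b₁ a₂ b₂, inner ℂ (hφL.toLp φ x) (h x) := by
        refine integral_congr_ae ?_
        filter_upwards [hφL.coeFn_toLp, hGh] with x h1 h2
        rw [h1, ← h2, RCLike.inner_apply]; ring

end

/-! ### Summation over the modes -/

/-- The terms depend only on `n₁ + n₂`, and `s + 1` of them belong to the value `s`; this cancels
the denominator and leaves a geometric sum. -/
lemma sum_exp_neg_div_le {c ε : ℝ} (hc : 0 < c) (hε : 0 < ε) (N : Finset (ℕ × ℕ)) :
    ∑ n ∈ N, Real.exp (-(c * (n.1 + n.2 + 1) * ε)) / (c * (n.1 + n.2 + 1)) ≤ 1 / (c ^ 2 * ε) := by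
  set F : ℕ → ℝ := fun s => Real.exp (-(c * (s + 1) * ε)) / (c * (s + 1)) with hF
  have hF0 : ∀ s, 0 ≤ F s := fun s => by positivity
  set S := N.sup (fun n => n.1 + n.2) + 1
  have hmaps : ∀ n ∈ N, n.1 + n.2 ∈ Finset.range S := fun n hn => Finset.mem_range.2
    (Nat.lt_succ_of_le (Finset.le_sup (f := fun n : ℕ × ℕ => n.1 + n.2) hn))
  set x := Real.exp (-(c * ε)) with hx
  have hx0 : 0 < x := Real.exp_pos _
  have hx1 : x < 1 := Real.exp_lt_one_iff.2 (neg_lt_zero.2 (by positivity))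
  have hF' : ∀ s : ℕ, (s + 1) * F s = x ^ (s + 1) / c := fun s => by
    rw [hF, hx, ← Real.exp_nat_mul]
    push_cast
    field_simp
  calc ∑ n ∈ N, Real.exp (-(c * (n.1 + n.2 + 1) * ε)) / (c * (n.1 + n.2 + 1))
      = ∑ n ∈ N, F (n.1 + n.2) := by simp only [hF]; push_cast; rfl
    _ = ∑ s ∈ Finset.range S, ∑ n ∈ N with n.1 + n.2 = s, F (n.1 + n.2) :=
        (Finset.sum_fiberwise_of_maps_to hmaps _).symm
    _ ≤ ∑ s ∈ Finset.range S, (s + 1) * F s := by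
        refine Finset.sum_le_sum fun s _ => ?_
        rw [Finset.sum_congr rfl fun n hn => by rw [(Finset.mem_filter.1 hn).2], Finset.sum_const,
          nsmul_eq_mul]
        refine mul_le_mul_of_nonneg_right ?_ (hF0 s)
        have : (N.filter fun n => n.1 + n.2 = s) ⊆ Finset.HasAntidiagonal.antidiagonal s := fun n hn =>
          Finset.HasAntidiagonal.mem_antidiagonal.2 (Finset.mem_filter.1 hn).2
        have := Finset.card_le_card this
        rw [Finset.Nat.card_antidiagonal] at this
        exact_mod_cast this
    _ = x / c * ∑ s ∈ Finset.range S, x ^ s := by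
        rw [Finset.mul_sum]
        exact Finset.sum_congr rfl fun s _ => by rw [hF' s]; ring
    _ ≤ x / c * (1 / (1 - x)) := by
        gcongr
        rw [le_div_iff₀ (by linarith), mul_comm, mul_neg_geom_sum]
        linarith [pow_pos hx0 S]
    _ ≤ 1 / (c ^ 2 * ε) := by
        have h1 : x * (c * ε + 1) ≤ 1 := by
          calc x * (c * ε + 1) ≤ x * Real.exp (c * ε) := by
                gcongr; exact Real.add_one_le_exp _
            _ = 1 := by rw [hx, ← Real.exp_add]; simp
        rw [div_mul_div_comm, mul_one, div_le_div_iff₀ (by have := sub_pos.2 hx1; positivity)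
          (by positivity)]
        nlinarith [mul_pos hc hε]

/-- The lower bound `c (j + k + 1)` for the frequency of the mode `(j, k)`. -/
lemma exists_le_modeFreq (h₁ : a₁ < b₁) (h₂ : a₂ < b₂) :
    ∃ c : ℝ, 0 < c ∧ ∀ n : ℕ × ℕ, c * (n.1 + n.2 + 1) ≤ modeFreq a₁ b₁ a₂ b₂ n := by
  have hL₁ := sub_pos.2 h₁
  have hL₂ := sub_pos.2 h₂
  refine ⟨min (Real.pi / (b₁ - a₁)) (Real.pi / (b₂ - a₂)) / 2, by positivity, fun n => ?_⟩
  have f1 := (le_abs_self _).trans (freq_fst_le_modeFreq (a₁ := a₁) (b₁ := b₁) (a₂ := a₂) (b₂ := b₂) n)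
  have f2 := (le_abs_self _).trans (freq_snd_le_modeFreq (a₁ := a₁) (b₁ := b₁) (a₂ := a₂) (b₂ := b₂) n)
  have m1 := min_le_left (Real.pi / (b₁ - a₁)) (Real.pi / (b₂ - a₂))
  have m2 := min_le_right (Real.pi / (b₁ - a₁)) (Real.pi / (b₂ - a₂))
  have m0 : 0 < min (Real.pi / (b₁ - a₁)) (Real.pi / (b₂ - a₂)) := by positivity
  have e1 : freq a₁ b₁ n.1 = (n.1 + 1) * (Real.pi / (b₁ - a₁)) := by rw [freq]; ring
  have e2 : freq a₂ b₂ n.2 = (n.2 + 1) * (Real.pi / (b₂ - a₂)) := by rw [freq]; ring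
  have g1 := mul_le_mul_of_nonneg_left m1 (by positivity : (0 : ℝ) ≤ n.1 + 1)
  have g2 := mul_le_mul_of_nonneg_left m2 (by positivity : (0 : ℝ) ≤ n.2 + 1)
  linarith

/-- The kernel in the form used for summation. When `μ ≤ 2 |l|` the second factor is bounded below,
and beyond that the kernel decays exponentially. -/
lemma abs_greenKernel_zero_le_exp_div {l μ t : ℝ} (hl : 2 ≤ |l|) (hμ : 0 < μ) (ht : |t| ≤ 1) :
    |greenKernel 0 l μ t| ≤ Real.exp 2 * (Real.exp (-(μ * (|t| / |l|))) / μ) := by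
  have hL : 0 < |l| := by linarith
  have ht0 := abs_nonneg t
  refine (abs_greenKernel_zero_le hμ l t).trans ?_
  have key : Real.exp (-(|(|l| - μ)| * |t|)) ≤ Real.exp 2 * Real.exp (-(μ * (|t| / |l|))) := by
    rw [← Real.exp_add]
    refine Real.exp_le_exp.2 ?_
    have e : μ * (|t| / |l|) = μ / |l| * |t| := by ring
    rw [e]
    rcases le_total μ (2 * |l|) with h | h
    · have h1 : μ / |l| ≤ 2 := by rwa [div_le_iff₀ hL]
      have h2 : μ / |l| * |t| ≤ 2 * 1 := by gcongr
      have := mul_nonneg (abs_nonneg (|l| - μ)) ht0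
      linarith
    · rw [abs_of_nonpos (by linarith)]
      have h1 : μ / |l| ≤ -(|l| - μ) := by
        rw [div_le_iff₀ hL]
        nlinarith
      have := mul_le_mul_of_nonneg_right h1 ht0
      linarith
  calc _ ≤ (Real.exp 2 * Real.exp (-(μ * (|t| / |l|)))) / (2 * μ) := by gcongr
    _ = Real.exp 2 * (Real.exp (-(μ * (|t| / |l|))) / μ) / 2 := by field_simp
    _ ≤ _ := half_le_self (by positivity)

/-- The factor `|l|` is not optimal, but for `p' ≤ 4` it is absorbed by the bound `2 / |l|` for the
kernels in the interpolation. -/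
lemma exists_sum_abs_greenKernel_le (h₁ : a₁ < b₁) (h₂ : a₂ < b₂) :
    ∃ A : ℝ, 0 < A ∧ ∀ l t : ℝ, 2 ≤ |l| → 0 < |t| → |t| ≤ 1 → ∀ N : Finset (ℕ × ℕ),
      ∑ n ∈ N, |greenKernel 0 l (modeFreq a₁ b₁ a₂ b₂ n) t| ≤ A * |l| / |t| := by
  obtain ⟨c, hc, hcμ⟩ := exists_le_modeFreq h₁ h₂
  refine ⟨Real.exp 2 / c ^ 2, by positivity, fun l t hl ht ht1 N => ?_⟩
  have hL : 0 < |l| := by linarith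
  calc _ ≤ ∑ n ∈ N, Real.exp 2 *
        (Real.exp (-(c * (n.1 + n.2 + 1) * (|t| / |l|))) / (c * (n.1 + n.2 + 1))) := by
        refine Finset.sum_le_sum fun n _ => ?_
        refine (abs_greenKernel_zero_le_exp_div hl (modeFreq_pos h₁ h₂ n) ht1).trans ?_
        gcongr <;> exact hcμ n
    _ ≤ Real.exp 2 * (1 / (c ^ 2 * (|t| / |l|))) := by
        rw [← Finset.mul_sum]
        gcongr
        exact sum_exp_neg_div_le hc (by positivity) N
    _ = _ := by field_simp

/-! ### A weighted Hausdorff–Young inequality -/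

lemma MeasureTheory.MemLp.toReal_eLpNorm_eq {Y : Type*} [MeasurableSpace Y] {ν : Measure Y} {p : ℝ}
    (hp : 0 < p) {f : Y → ℂ} (hf : MemLp f (ENNReal.ofReal p) ν) :
    (eLpNorm f (ENNReal.ofReal p) ν).toReal = (∫ y, ‖f y‖ ^ p ∂ν) ^ (1 / p) := by
  rw [hf.eLpNorm_eq_integral_rpow_norm (by simpa using hp) ENNReal.ofReal_ne_top,
    ENNReal.toReal_ofReal hp.le, ENNReal.toReal_ofReal (by positivity), one_div]

section

variable {Y ι : Type*} [MeasurableSpace Y] {ν : Measure Y} [IsFiniteMeasure ν] {φ : ι → Y → ℝ}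
  {M : ℝ}

lemma memLp_sum_mul (hφ : ∀ n, Measurable (φ n)) (hM : ∀ n y, |φ n y| ≤ M) (N : Finset ι)
    (c : ι → ℂ) (p : ℝ≥0∞) : MemLp (fun y => ∑ n ∈ N, c n * (φ n y : ℂ)) p ν := by
  refine memLp_finsetSum N fun n _ => MemLp.const_mul ?_ _
  exact MemLp.of_bound (Complex.measurable_ofReal.comp (hφ n)).aestronglyMeasurable M
    (ae_of_all _ fun y => by simpa using hM n y)

/-- For a bounded orthonormal system `φ_n`, the `ℓ²` norm of the coefficients of `g`, weighted by
`w`, is controlled by an `L^p` norm of `g` with `p < 2`. The function `∑ w_n ḡ_n φ_n`, by means of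
which the left-hand side is written as a pairing with `g`, is bounded in `L²` by `S = sup w` and in
`L^∞` by `W = ∑ w`; its norm in the dual space `L^{p'}` is interpolated between these two. -/
lemma sqrt_sum_mul_norm_sq_le [DecidableEq ι] (hφ : ∀ n, Measurable (φ n)) (hM : ∀ n y, |φ n y| ≤ M)
    (hM0 : 0 ≤ M) (horth : ∀ n m, ∫ y, φ n y * φ m y ∂ν = if n = m then 1 else 0)
    {p p' : ℝ} (hp : p.HolderConjugate p') (hp' : 2 ≤ p') (N : Finset ι) {w : ι → ℝ} {S W : ℝ}
    (hw : ∀ n, 0 ≤ w n) (hS : ∀ n, w n ≤ S) (hS0 : 0 ≤ S) (hW : ∑ n ∈ N, w n ≤ W) {g : Y → ℂ}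
    (hg : MemLp g (ENNReal.ofReal p) ν) :
    √(∑ n ∈ N, w n * ‖∫ y, g y * (φ n y : ℂ) ∂ν‖ ^ 2)
      ≤ (M ^ 2 * W) ^ (1 / 2 - 1 / p') * S ^ (1 / p') * (eLpNorm g (ENNReal.ofReal p) ν).toReal := by
  have hp0 : 0 < p := hp.pos
  have hp0' : 0 < p' := hp.symm.pos
  set gc : ι → ℂ := fun n => ∫ y, g y * (φ n y : ℂ) ∂ν with hgc
  set X := ∑ n ∈ N, w n * ‖gc n‖ ^ 2 with hX
  have hX0 : 0 ≤ X := Finset.sum_nonneg fun n _ => mul_nonneg (hw n) (sq_nonneg _)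
  have hW0 : 0 ≤ W := (Finset.sum_nonneg fun n _ => hw n).trans hW
  set u : Y → ℂ := fun y => ∑ n ∈ N, (w n * (starRingEnd ℂ) (gc n)) * (φ n y : ℂ) with hu
  have hup : ∀ p, MemLp u p ν := fun p => memLp_sum_mul hφ hM N _ p
  have hgi : Integrable g ν := hg.integrable (by
    rw [← ENNReal.ofReal_one]; exact ENNReal.ofReal_le_ofReal hp.lt.le)
  have hφb : ∀ n, AEStronglyMeasurable (fun y => (φ n y : ℂ)) ν := fun n =>
    (Complex.measurable_ofReal.comp (hφ n)).aestronglyMeasurable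
  have hpair : ∫ y, g y * u y ∂ν = (X : ℂ) := by
    have e : ∀ y, g y * u y = ∑ n ∈ N, (w n * (starRingEnd ℂ) (gc n)) * (g y * (φ n y : ℂ)) := fun y => by
      rw [hu, Finset.mul_sum]
      exact Finset.sum_congr rfl fun n _ => by ring
    simp_rw [e]
    rw [integral_finsetSum _ fun n _ => (hgi.mul_bdd (c := M) (hφb n)
      (ae_of_all _ fun y => by simpa using hM n y)).const_mul _, hX]
    push_cast
    refine Finset.sum_congr rfl fun n _ => ?_
    rw [integral_const_mul, mul_assoc, ← Complex.conj_mul']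
  have hL2 : ∫ y, ‖u y‖ ^ 2 ∂ν ≤ S * X := by
    have e : ∀ y, ((‖u y‖ ^ 2 : ℝ) : ℂ) = ∑ n ∈ N, ∑ m ∈ N, ((w n * gc n) *
        (w m * (starRingEnd ℂ) (gc m))) * ((φ n y * φ m y : ℝ) : ℂ) := fun y => by
      push_cast
      rw [← Complex.conj_mul', hu, map_sum, Finset.sum_mul_sum]
      refine Finset.sum_congr rfl fun n _ => Finset.sum_congr rfl fun m _ => ?_
      simp only [map_mul, Complex.conj_ofReal, Complex.conj_conj]
      ring
    have hi : ∀ n m, Integrable (fun y => ((φ n y * φ m y : ℝ) : ℂ)) ν := fun n m =>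
      Integrable.ofReal (Integrable.of_bound ((hφ n).mul (hφ m)).aestronglyMeasurable (M * M)
        (ae_of_all _ fun y => by
          change ‖φ n y * φ m y‖ ≤ _
          rw [norm_mul]
          exact mul_le_mul (hM n y) (hM m y) (norm_nonneg _) hM0))
    have e2 : ((∫ y, ‖u y‖ ^ 2 ∂ν : ℝ) : ℂ) = ((∑ n ∈ N, w n ^ 2 * ‖gc n‖ ^ 2 : ℝ) : ℂ) := by
      rw [← integral_complex_ofReal]
      simp_rw [e]
      rw [integral_finsetSum _ fun n _ => integrable_finsetSum _ fun m _ => (hi n m).const_mul _]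
      rw [Complex.ofReal_sum]
      refine Finset.sum_congr rfl fun n hn => ?_
      rw [integral_finsetSum _ fun m _ => (hi n m).const_mul _]
      simp_rw [integral_const_mul, integral_complex_ofReal, horth]
      rw [Finset.sum_eq_single n (fun m _ hm => by simp [hm.symm]) (fun h => absurd hn h), if_pos rfl,
        Complex.ofReal_one, mul_one, Complex.ofReal_mul, Complex.ofReal_pow, Complex.ofReal_pow,
        ← Complex.mul_conj']
      ring
    rw [Complex.ofReal_inj.1 e2, hX, Finset.mul_sum]
    refine Finset.sum_le_sum fun n _ => ?_
    have := mul_le_mul_of_nonneg_right (hS n) (mul_nonneg (hw n) (sq_nonneg ‖gc n‖))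
    linarith
  have hsup : ∀ y, ‖u y‖ ≤ √(M ^ 2 * W * X) := by
    intro y
    refine Real.le_sqrt_of_sq_le ?_
    have h1 : ‖u y‖ ≤ M * ∑ n ∈ N, √(w n) * (√(w n) * ‖gc n‖) := by
      refine (norm_sum_le _ _).trans ?_
      rw [Finset.mul_sum]
      refine Finset.sum_le_sum fun n _ => ?_
      rw [norm_mul, norm_mul, Complex.norm_real, Complex.norm_real, RCLike.norm_conj,
        Real.norm_of_nonneg (hw n), ← mul_assoc √(w n), Real.mul_self_sqrt (hw n), mul_comm]
      exact mul_le_mul_of_nonneg_right (hM n y) (mul_nonneg (hw n) (norm_nonneg _))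
    have h2 := Finset.sum_mul_sq_le_sq_mul_sq N (fun n => √(w n)) (fun n => √(w n) * ‖gc n‖)
    simp only [mul_pow, Real.sq_sqrt (hw _)] at h2
    calc ‖u y‖ ^ 2 ≤ (M * ∑ n ∈ N, √(w n) * (√(w n) * ‖gc n‖)) ^ 2 :=
          pow_le_pow_left₀ (norm_nonneg _) h1 2
      _ = M ^ 2 * (∑ n ∈ N, √(w n) * (√(w n) * ‖gc n‖)) ^ 2 := by ring
      _ ≤ M ^ 2 * (W * X) := by
          gcongr
          exact h2.trans (mul_le_mul_of_nonneg_right hW hX0)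
      _ = _ := by ring
  have hp'2 : 0 ≤ p' - 2 := by linarith
  have hLp' : ∫ y, ‖u y‖ ^ p' ∂ν ≤ √(M ^ 2 * W * X) ^ (p' - 2) * (S * X) := by
    calc ∫ y, ‖u y‖ ^ p' ∂ν ≤ ∫ y, √(M ^ 2 * W * X) ^ (p' - 2) * ‖u y‖ ^ 2 ∂ν := by
          refine integral_mono_of_nonneg (ae_of_all _ fun y => by positivity)
            (((memLp_two_iff_integrable_sq_norm (hup 2).1).1 (hup 2)).const_mul _)
            (ae_of_all _ fun y => ?_)
          simp only
          rcases (norm_nonneg (u y)).eq_or_lt with h | h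
          · rw [← h, Real.zero_rpow hp0'.ne']; positivity
          · calc ‖u y‖ ^ p' = ‖u y‖ ^ (p' - 2) * ‖u y‖ ^ 2 := by
                  rw [← Real.rpow_natCast, ← Real.rpow_add h]; norm_num
              _ ≤ _ := by
                  gcongr
                  exact hsup y
      _ = √(M ^ 2 * W * X) ^ (p' - 2) * ∫ y, ‖u y‖ ^ 2 ∂ν := integral_const_mul _ _
      _ ≤ _ := by gcongr
  have main : X ≤ (eLpNorm g (ENNReal.ofReal p) ν).toReal *
      (√(M ^ 2 * W * X) ^ (p' - 2) * (S * X)) ^ (1 / p') := by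
    calc X = ‖∫ y, g y * u y ∂ν‖ := by rw [hpair, Complex.norm_real, Real.norm_of_nonneg hX0]
      _ ≤ ∫ y, ‖g y‖ * ‖u y‖ ∂ν := by
          refine (norm_integral_le_integral_norm _).trans_eq ?_
          simp_rw [norm_mul]
      _ ≤ (∫ y, ‖g y‖ ^ p ∂ν) ^ (1 / p) * (∫ y, ‖u y‖ ^ p' ∂ν) ^ (1 / p') :=
          integral_mul_norm_le_Lp_mul_Lq hp hg (hup _)
      _ ≤ _ := by
          rw [hg.toReal_eLpNorm_eq hp0]
          gcongr
  have e : (√(M ^ 2 * W * X) ^ (p' - 2) * (S * X)) ^ (1 / p')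
      = (M ^ 2 * W) ^ (1 / 2 - 1 / p') * S ^ (1 / p') * √X := by
    rcases hX0.eq_or_lt with h | h
    · rw [← h]; simp [hp0'.ne']
    · have e1 : (√(M ^ 2 * W * X) ^ (p' - 2)) ^ (1 / p') = (M ^ 2 * W * X) ^ (1 / 2 - 1 / p') := by
        rw [Real.sqrt_eq_rpow, ← Real.rpow_mul (by positivity), ← Real.rpow_mul (by positivity)]
        congr 1
        field_simp
      have e2 : √X = X ^ (1 / 2 - 1 / p') * X ^ (1 / p') := by
        rw [Real.sqrt_eq_rpow, ← Real.rpow_add h]; ring_nf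
      rw [Real.mul_rpow (by positivity) (by positivity), e1, e2, Real.mul_rpow hS0 hX0,
        Real.mul_rpow (by positivity) hX0]
      ring
  rw [e] at main
  rcases hX0.eq_or_lt with h | h
  · rw [← h, Real.sqrt_zero]; positivity
  · have hs := Real.sqrt_pos.2 h
    refine le_of_mul_le_mul_right ?_ hs
    rw [Real.mul_self_sqrt hX0]
    linarith

/-- The bilinear form of the multiplier `w` in a bounded orthonormal system is bounded on `L^p` by
the interpolation between `ℓ²` and `L¹`. -/
lemma sum_mul_norm_mul_norm_le [DecidableEq ι] (hφ : ∀ n, Measurable (φ n)) (hM : ∀ n y, |φ n y| ≤ M)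
    (hM0 : 0 ≤ M) (horth : ∀ n m, ∫ y, φ n y * φ m y ∂ν = if n = m then 1 else 0)
    {p p' : ℝ} (hp : p.HolderConjugate p') (hp' : 2 ≤ p') (N : Finset ι) {w : ι → ℝ} {S W : ℝ}
    (hw : ∀ n, 0 ≤ w n) (hS : ∀ n, w n ≤ S) (hS0 : 0 ≤ S) (hW : ∑ n ∈ N, w n ≤ W) {f g : Y → ℂ}
    (hf : MemLp f (ENNReal.ofReal p) ν) (hg : MemLp g (ENNReal.ofReal p) ν) :
    ∑ n ∈ N, w n * (‖∫ y, f y * (φ n y : ℂ) ∂ν‖ * ‖∫ y, g y * (φ n y : ℂ) ∂ν‖)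
      ≤ (M ^ 2 * W) ^ (1 - 2 / p') * S ^ (2 / p') * ((eLpNorm f (ENNReal.ofReal p) ν).toReal *
        (eLpNorm g (ENNReal.ofReal p) ν).toReal) := by
  have hW0 : 0 ≤ W := (Finset.sum_nonneg fun n _ => hw n).trans hW
  have hf' := sqrt_sum_mul_norm_sq_le hφ hM hM0 horth hp hp' N hw hS hS0 hW hf
  have hg' := sqrt_sum_mul_norm_sq_le hφ hM hM0 horth hp hp' N hw hS hS0 hW hg
  have hp0' : 0 < p' := hp.symm.pos
  have e1 : (M ^ 2 * W) ^ (1 - 2 / p') = (M ^ 2 * W) ^ (1 / 2 - 1 / p') * (M ^ 2 * W) ^ (1 / 2 - 1 / p') := by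
    have : 0 ≤ 1 / 2 - 1 / p' := by
      rw [sub_nonneg]; gcongr
    rw [← Real.rpow_add_of_nonneg (by positivity) this this]; ring_nf
  have e2 : S ^ (2 / p') = S ^ (1 / p') * S ^ (1 / p') := by
    rw [← Real.rpow_add_of_nonneg hS0 (by positivity) (by positivity)]; ring_nf
  have cs := Real.sum_mul_le_sqrt_mul_sqrt N (fun n => √(w n) * ‖∫ y, f y * (φ n y : ℂ) ∂ν‖)
    (fun n => √(w n) * ‖∫ y, g y * (φ n y : ℂ) ∂ν‖)
  simp only [mul_pow, Real.sq_sqrt (hw _)] at cs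
  calc _ = ∑ n ∈ N, √(w n) * ‖∫ y, f y * (φ n y : ℂ) ∂ν‖ * (√(w n) * ‖∫ y, g y * (φ n y : ℂ) ∂ν‖) := by
        refine Finset.sum_congr rfl fun n _ => ?_
        nth_rw 1 [← Real.mul_self_sqrt (hw n)]; ring
    _ ≤ _ := cs
    _ ≤ _ := mul_le_mul hf' hg' (Real.sqrt_nonneg _) (by positivity)
    _ = _ := by rw [e1, e2]; ring

end

/-! ### A singular integral on the interval -/

lemma lintegral_abs_rpow_neg_le {β : ℝ} (hβ : β < 1) :
    ∫⁻ t in Ioo (-1 : ℝ) 1, ENNReal.ofReal (|t| ^ (-β)) ≤ ENNReal.ofReal (2 / (1 - β)) := by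
  have hi : IntervalIntegrable (fun t : ℝ => |t| ^ (-β)) volume 0 1 := by
    refine (intervalIntegral.intervalIntegrable_rpow' (r := -β) (by linarith)).congr fun t ht => ?_
    rw [uIoc_of_le zero_le_one] at ht
    simp only [abs_of_pos ht.1]
  have hi' : IntervalIntegrable (fun t : ℝ => |t| ^ (-β)) volume (-1) 0 := by
    have := (IntervalIntegrable.iff_comp_neg (by simp)).1 hi.symm
    simpa using this
  have e2 : ∫ t in (0 : ℝ)..1, |t| ^ (-β) = 1 / (1 - β) := by
    have : ∫ t in (0 : ℝ)..1, |t| ^ (-β) = ∫ t in (0 : ℝ)..1, t ^ (-β) :=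
      intervalIntegral.integral_congr fun t ht => by
        rw [uIcc_of_le zero_le_one] at ht
        simp only [abs_of_nonneg ht.1]
    rw [this, integral_rpow (Or.inl (by linarith)), Real.one_rpow, Real.zero_rpow (by linarith)]
    ring_nf
  have e1 : ∫ t in (-1 : ℝ)..0, |t| ^ (-β) = 1 / (1 - β) := by
    have := intervalIntegral.integral_comp_neg (a := 0) (b := 1) fun t : ℝ => |t| ^ (-β)
    simp only [abs_neg, neg_zero] at this
    rw [← this, e2]
  have hint : IntegrableOn (fun t : ℝ => |t| ^ (-β)) (Ioo (-1) 1) :=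
    ((intervalIntegrable_iff_integrableOn_Ioc_of_le (by norm_num)).1 (hi'.trans hi)).mono_set
      Ioo_subset_Ioc_self
  rw [← ofReal_integral_eq_lintegral_ofReal hint (ae_of_all _ fun t => by positivity),
    ← integral_Ioc_eq_integral_Ioo, ← intervalIntegral.integral_of_le (by norm_num),
    ← intervalIntegral.integral_add_adjacent_intervals hi' hi, e1, e2]
  exact ENNReal.ofReal_le_ofReal (le_of_eq (by ring))

/-! ### The mixed norm estimate -/

/-- The interpolated bound for the Green kernels at distance `t`. The powers of `L` combine to
`L ^ (1 - 4 / s)`, which is where `s ≤ 4` enters. -/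
lemma interpolated_bound_le {B L t s : ℝ} (hB : 0 < B) (hL : 1 ≤ L) (ht : 0 < t) (hs : 2 < s)
    (hs4 : s ≤ 4) :
    (B * L / t) ^ (1 - 2 / s) * (2 / L) ^ (2 / s) ≤ 2 * max 1 B * t ^ (-(1 - 2 / s)) := by
  have hL0 : 0 < L := by linarith
  have hs0 : 0 < s := by linarith
  have hτ0 : 0 ≤ 1 - 2 / s := by rw [sub_nonneg, div_le_one hs0]; exact hs.le
  have h1 : B ^ (1 - 2 / s) ≤ max 1 B := by
    calc B ^ (1 - 2 / s) ≤ max 1 B ^ (1 - 2 / s) := by gcongr; exact le_max_right _ _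
      _ ≤ max 1 B ^ (1 : ℝ) := by
        gcongr
        · exact le_max_left _ _
        · have : 0 ≤ 2 / s := by positivity
          linarith
      _ = _ := Real.rpow_one _
  have h2 : (2 : ℝ) ^ (2 / s) ≤ 2 := by
    calc (2 : ℝ) ^ (2 / s) ≤ 2 ^ (1 : ℝ) := by
          gcongr
          · norm_num
          · rw [div_le_one hs0]; exact hs.le
      _ = 2 := Real.rpow_one _
  have h3 : L ^ (1 - 2 / s) / L ^ (2 / s) ≤ 1 := by
    rw [← Real.rpow_sub hL0]
    refine Real.rpow_le_one_of_one_le_of_nonpos hL ?_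
    have : 1 / 2 ≤ 2 / s := by rw [div_le_div_iff₀ (by norm_num) hs0]; linarith
    linarith
  rw [Real.div_rpow (by positivity) ht.le, Real.mul_rpow hB.le hL0.le, Real.div_rpow (by norm_num)
    hL0.le, Real.rpow_neg ht.le]
  calc _ = (2 ^ (2 / s) * B ^ (1 - 2 / s)) * (L ^ (1 - 2 / s) / L ^ (2 / s))
        * (t ^ (1 - 2 / s))⁻¹ := by ring
    _ ≤ (2 * max 1 B) * 1 * (t ^ (1 - 2 / s))⁻¹ := by gcongr
    _ = _ := by rw [mul_one]

/-- The converse of Hölder's inequality. -/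
lemma MeasureTheory.MemLp.eLpNorm_le_of_forall_integral_mul {Y : Type*} [MeasurableSpace Y]
    {ν : Measure Y} {p p' : ℝ} (hp : p.HolderConjugate p') {u : Y → ℂ}
    (hu : MemLp u (ENNReal.ofReal p') ν) {K : ℝ≥0∞}
    (h : ∀ g : Y → ℂ, MemLp g (ENNReal.ofReal p) ν →
      ‖∫ y, u y * g y ∂ν‖ₑ ≤ K * eLpNorm g (ENNReal.ofReal p) ν) :
    eLpNorm u (ENNReal.ofReal p') ν ≤ K := by
  have hp0 := hp.pos
  have hp0' := hp.symm.pos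
  have hp1' := hp.symm.lt
  set Z := ∫ y, ‖u y‖ ^ p' ∂ν with hZ
  have hZ0 : 0 ≤ Z := integral_nonneg fun y => by positivity
  have eu : eLpNorm u (ENNReal.ofReal p') ν = ENNReal.ofReal (Z ^ (1 / p')) := by
    rw [hu.eLpNorm_eq_integral_rpow_norm (by simpa using hp0') ENNReal.ofReal_ne_top,
      ENNReal.toReal_ofReal hp0'.le, one_div]
  set g : Y → ℂ := fun y => (starRingEnd ℂ) (u y) * ((‖u y‖ ^ (p' - 2) : ℝ) : ℂ) with hg
  have gn : ∀ y, ‖g y‖ ^ p = ‖u y‖ ^ p' := by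
    intro y
    have e : ‖g y‖ = ‖u y‖ ^ (p' - 1) := by
      rw [hg]
      simp only [norm_mul, RCLike.norm_conj, Complex.norm_real]
      rw [Real.norm_of_nonneg (by positivity)]
      rcases (norm_nonneg (u y)).eq_or_lt with h0 | h0
      · rw [← h0, zero_mul, Real.zero_rpow (by linarith)]
      · nth_rw 1 [← Real.rpow_one ‖u y‖]
        rw [← Real.rpow_add h0]; ring_nf
    rw [e, ← Real.rpow_mul (norm_nonneg _)]
    congr 1
    have := hp.mul_eq_add
    linarith
  have gm : AEStronglyMeasurable g ν := by
    have := hu.1.aemeasurable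
    refine AEMeasurable.aestronglyMeasurable ?_
    exact (Complex.continuous_conj.measurable.comp_aemeasurable this).mul
      (Complex.measurable_ofReal.comp_aemeasurable (this.norm.pow_const _))
  have gL : MemLp g (ENNReal.ofReal p) ν := by
    rw [← integrable_norm_rpow_iff gm (by simpa using hp0) ENNReal.ofReal_ne_top,
      ENNReal.toReal_ofReal hp0.le]
    simp_rw [gn]
    have := (integrable_norm_rpow_iff hu.1 (by simpa using hp0') ENNReal.ofReal_ne_top).2 hu
    rwa [ENNReal.toReal_ofReal hp0'.le] at this
  have eg : eLpNorm g (ENNReal.ofReal p) ν = ENNReal.ofReal (Z ^ (1 / p)) := by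
    rw [gL.eLpNorm_eq_integral_rpow_norm (by simpa using hp0) ENNReal.ofReal_ne_top,
      ENNReal.toReal_ofReal hp0.le, one_div, hZ]
    simp_rw [gn]
  have hpair : ∫ y, u y * g y ∂ν = (Z : ℂ) := by
    rw [hZ, ← integral_complex_ofReal]
    congr 1; ext y
    rw [hg]
    simp only
    rw [← mul_assoc, Complex.mul_conj', ← Complex.ofReal_pow, ← Complex.ofReal_mul]
    congr 1
    rcases (norm_nonneg (u y)).eq_or_lt with h0 | h0
    · rw [← h0, Real.zero_rpow hp0'.ne']; simp
    · rw [← Real.rpow_natCast, ← Real.rpow_add h0]; norm_num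
  rcases hZ0.eq_or_lt with h0 | h0
  · rw [eu, ← h0, Real.zero_rpow (by positivity), ENNReal.ofReal_zero]
    exact zero_le
  · have key := h g gL
    have hne : ENNReal.ofReal (Z ^ (1 / p)) ≠ 0 := by simpa using Real.rpow_pos_of_pos h0 _
    rw [hpair, eg, ← ofReal_norm, Complex.norm_real, Real.norm_of_nonneg hZ0] at key
    have eZ : ENNReal.ofReal Z = ENNReal.ofReal (Z ^ (1 / p')) * ENNReal.ofReal (Z ^ (1 / p)) := by
      rw [← ENNReal.ofReal_mul (by positivity), ← Real.rpow_add h0, one_div, one_div,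
        hp.symm.inv_add_inv_eq_one, Real.rpow_one]
    rw [eu]
    rw [eZ] at key
    exact (ENNReal.mul_le_mul_iff_left hne ENNReal.ofReal_ne_top).1 key

/-- The coefficients are given by integration over the slices. -/
lemma coeFn_modeCoeff (h₁ : a₁ < b₁) (h₂ : a₂ < b₂) (f : L2Q a₁ b₁ a₂ b₂) (n : ℕ × ℕ) :
    modeCoeff h₁ h₂ f n =ᵐ[volume.restrict intervalI]
      fun x => ∫ y in rectQ' a₁ b₁ a₂ b₂, f (x, y) * (mode a₁ b₁ a₂ b₂ true true n y : ℂ) := by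
  have hinner : ∀ v : L2I, inner ℂ (modeTensor true true n v) f = inner ℂ v (modeCoeff h₁ h₂ f n) := by
    intro v
    have := (innerSL ℂ (modeTensor true true n v : L2Q a₁ b₁ a₂ b₂)).hasSum (hasSum_modeCoeff h₁ h₂ f)
    refine HasSum.unique this ?_
    simp only [innerSL_apply_apply, inner_modeTensor h₁ h₂]
    have := hasSum_single (f := fun m => if n = m then inner ℂ v (modeCoeff h₁ h₂ f m) else 0) n
      fun m hm => if_neg hm.symm
    rwa [if_pos rfl] at this
  have hfm : Integrable (fun x : ℝ × ℝ × ℝ => f x * (mode a₁ b₁ a₂ b₂ true true n x.2 : ℂ))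
      ((volume.restrict intervalI).prod (volume.restrict (rectQ' a₁ b₁ a₂ b₂))) :=
    f.integrable.mul_bdd (c := 2 / √((b₁ - a₁) * (b₂ - a₂)))
      (memLp_mode true true n 2).1.comp_snd (ae_of_all _ fun y => by simpa using abs_mode_le _ _ _ _)
  refine Integrable.ae_eq_of_forall_setIntegral_eq _ _ (L2I.integrable _) hfm.integral_prod_left
    fun s hs _ => ?_
  have hs1 : MemLp (s.indicator fun _ => (1 : ℂ)) 2 (volume.restrict intervalI) :=
    (memLp_const 1).indicator hs
  have := hinner hs1.toLp
  rw [inner_modeTensor_left, L2.inner_def] at this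
  rw [← integral_indicator hs, ← integral_indicator hs]
  refine Eq.trans ?_ (this.symm.trans ?_)
  · refine integral_congr_ae (hs1.coeFn_toLp.mono fun x hx => ?_)
    simp only [hx, RCLike.inner_apply]
    by_cases hxs : x ∈ s <;> simp [hxs]
  · refine integral_congr_ae (hs1.coeFn_toLp.mono fun x hx => ?_)
    simp only [hx]
    by_cases hxs : x ∈ s <;> simp [hxs]

lemma ae_memLp_slice (f : L2Q a₁ b₁ a₂ b₂) : ∀ᵐ x ∂volume.restrict intervalI,
    MemLp (fun y => f (x, y)) 2 (volume.restrict (rectQ' a₁ b₁ a₂ b₂)) := by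
  have hi := integrable_boxQ_iff.1
    ((memLp_two_iff_integrable_sq_norm (Lp.aestronglyMeasurable f)).1 (Lp.memLp f))
  refine hi.prod_right_ae.mono fun x hx => ?_
  exact (memLp_two_iff_integrable_sq_norm ((Lp.stronglyMeasurable f).comp_measurable
    measurable_prodMk_left).aestronglyMeasurable).2 hx

lemma measurable_eLpNorm_slice {p : ℝ} (hp : 0 < p) (f : L2Q a₁ b₁ a₂ b₂) :
    Measurable fun x => eLpNorm (fun y => f (x, y)) (ENNReal.ofReal p)
      (volume.restrict (rectQ' a₁ b₁ a₂ b₂)) := by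
  simp_rw [eLpNorm_eq_lintegral_rpow_enorm_toReal (ENNReal.ofReal_pos.2 hp).ne' ENNReal.ofReal_ne_top]
  refine Measurable.pow_const (Measurable.lintegral_prod_right'
    (f := fun z : ℝ × ℝ × ℝ => ‖f z‖ₑ ^ (ENNReal.ofReal p).toReal) ?_) _
  exact (Lp.stronglyMeasurable f).measurable.enorm.pow_const _

section

variable (h₁ : a₁ < b₁) (h₂ : a₂ < b₂) {l : ℝ}

/-- Partial sums of the mode expansion of `solutionOp f` on the slice over `x`, paired with a
function `g` on the rectangle. Written as an integral over `I`, the pairing is estimated for each `y`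
by the weighted Hausdorff–Young inequality with the weights `|κ_n(x - y)|`. -/
lemma enorm_integral_sum_kernelConv_mul_le {A : ℝ} (hA0 : 0 < A)
    (hA : ∀ t : ℝ, 0 < |t| → |t| ≤ 1 → ∀ N : Finset (ℕ × ℕ),
      ∑ n ∈ N, |greenKernel 0 l (modeFreq a₁ b₁ a₂ b₂ n) t| ≤ A * |l| / |t|)
    (hl : 1 ≤ |l|) {p p' : ℝ} (hp : p.HolderConjugate p') (hp2 : 2 < p') (hp4 : p' ≤ 4)
    (f : L2Q a₁ b₁ a₂ b₂) {x : ℝ} (hx : x ∈ intervalI) (N : Finset (ℕ × ℕ)) {g : ℝ × ℝ → ℂ}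
    (hg : MemLp g (ENNReal.ofReal p) (volume.restrict (rectQ' a₁ b₁ a₂ b₂))) :
    ‖∫ z in rectQ' a₁ b₁ a₂ b₂, (∑ n ∈ N, kernelConv (greenKernel 0 l (modeFreq a₁ b₁ a₂ b₂ n))
        (modeCoeff h₁ h₂ f n) x * (mode a₁ b₁ a₂ b₂ true true n z : ℂ)) * g z‖ₑ ≤
      (∫⁻ y in intervalI, ENNReal.ofReal
        (2 * max 1 ((2 / √((b₁ - a₁) * (b₂ - a₂))) ^ 2 * A) * |x - y| ^ (-(1 - 2 / p'))) *
        eLpNorm (fun z => f (y, z)) (ENNReal.ofReal p) (volume.restrict (rectQ' a₁ b₁ a₂ b₂))) *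
      eLpNorm g (ENNReal.ofReal p) (volume.restrict (rectQ' a₁ b₁ a₂ b₂)) := by
  have hL₁ := sub_pos.2 h₁
  have hL₂ := sub_pos.2 h₂
  have hl0 : l ≠ 0 := abs_pos.1 (by linarith)
  set κ : ℕ × ℕ → ℝ → ℝ := fun n => greenKernel 0 l (modeFreq a₁ b₁ a₂ b₂ n) with hκ
  set φ : ℕ × ℕ → ℝ × ℝ → ℝ := fun n => mode a₁ b₁ a₂ b₂ true true n with hφ
  set M := 2 / √((b₁ - a₁) * (b₂ - a₂)) with hM
  have hM0 : 0 < M := by positivity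
  have hφm : ∀ n, Measurable (φ n) := fun n => (continuous_mode true true n).measurable
  have hφM : ∀ n y, |φ n y| ≤ M := fun n y => abs_mode_le true true n y
  have hk : ∀ n, IsBoundedKernel (κ n) := fun n => isBoundedKernel_green_zero (modeFreq_pos h₁ h₂ n) l
  have hgi : Integrable g (volume.restrict (rectQ' a₁ b₁ a₂ b₂)) := hg.integrable (by
    rw [← ENNReal.ofReal_one]; exact ENNReal.ofReal_le_ofReal hp.lt.le)
  have hgφ : ∀ n, Integrable (fun z => g z * (φ n z : ℂ)) (volume.restrict (rectQ' a₁ b₁ a₂ b₂)) :=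
    fun n => hgi.mul_bdd (c := M) (memLp_mode true true n 2).1
      (ae_of_all _ fun y => by simpa using hφM n y)
  set G : ℕ × ℕ → ℂ := fun n => ∫ z in rectQ' a₁ b₁ a₂ b₂, g z * (φ n z : ℂ) with hG
  have e1 : ∫ z in rectQ' a₁ b₁ a₂ b₂, (∑ n ∈ N, kernelConv (κ n) (modeCoeff h₁ h₂ f n) x *
      (φ n z : ℂ)) * g z = ∫ y in intervalI, ∑ n ∈ N, (κ n (x - y) : ℂ) * modeCoeff h₁ h₂ f n y * G n := by
    rw [integral_finsetSum _ fun n _ => ((hk n).integrable_mul (L2I.integrable _) x).mul_const _]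
    have : ∀ z, (∑ n ∈ N, kernelConv (κ n) (modeCoeff h₁ h₂ f n) x * (φ n z : ℂ)) * g z
        = ∑ n ∈ N, kernelConv (κ n) (modeCoeff h₁ h₂ f n) x * (g z * (φ n z : ℂ)) := fun z => by
      rw [Finset.sum_mul]
      exact Finset.sum_congr rfl fun n _ => by ring
    simp_rw [this]
    rw [integral_finsetSum _ fun n _ => (hgφ n).const_mul _]
    refine Finset.sum_congr rfl fun n _ => ?_
    rw [integral_const_mul, integral_mul_const, kernelConv]
  rw [e1, ← lintegral_mul_const']
  swap; · exact hg.2.ne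
  refine (enorm_integral_le_lintegral_enorm _).trans (lintegral_mono_ae ?_)
  have hne : ∀ᵐ y ∂(volume : Measure ℝ).restrict intervalI, y ≠ x :=
    ae_restrict_of_ae (Measure.ae_ne volume x)
  filter_upwards [ae_all_iff.2 (coeFn_modeCoeff h₁ h₂ f), ae_memLp_slice f, hne,
    ae_restrict_mem measurableSet_intervalI] with y hy hfy hyx hyI
  have ht : 0 < |x - y| := abs_pos.2 (sub_ne_zero.2 hyx.symm)
  have ht1 : |x - y| ≤ 1 := by
    have := sub_mem_of_mem_intervalI hx hyI
    exact abs_le.2 ⟨this.1.le, this.2.le⟩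
  have hfp : MemLp (fun z => f (y, z)) (ENNReal.ofReal p) (volume.restrict (rectQ' a₁ b₁ a₂ b₂)) :=
    hfy.mono_exponent (by
      rw [← ENNReal.ofReal_ofNat]
      refine ENNReal.ofReal_le_ofReal ?_
      have h := hp.symm.conjugate_eq
      rw [h, div_le_iff₀ (by linarith)]
      linarith)
  have key := sum_mul_norm_mul_norm_le hφm hφM hM0.le (integral_mode_mul_mode h₁ h₂ true true) hp hp2.le N
    (w := fun n => |κ n (x - y)|) (fun n => abs_nonneg _)
    (fun n => abs_greenKernel_zero_le_inv_abs hl0 (modeFreq_pos h₁ h₂ n) (x - y)) (by positivity)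
    (hA _ ht ht1 N) hfp hg
  have hconst := interpolated_bound_le (B := M ^ 2 * A) (by positivity) hl ht hp2 hp4
  rw [← ofReal_norm, ← ENNReal.ofReal_toReal hfp.2.ne, ← ENNReal.ofReal_toReal hg.2.ne,
    ← ENNReal.ofReal_mul (by positivity), ← ENNReal.ofReal_mul (by positivity)]
  refine ENNReal.ofReal_le_ofReal ?_
  calc _ ≤ ∑ n ∈ N, |κ n (x - y)| * (‖∫ z in rectQ' a₁ b₁ a₂ b₂, f (y, z) * (φ n z : ℂ)‖ * ‖G n‖) := by
        refine (norm_sum_le _ _).trans_eq (Finset.sum_congr rfl fun n _ => ?_)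
        rw [norm_mul, norm_mul, hy n, Complex.norm_real, Real.norm_eq_abs, mul_assoc]
    _ ≤ _ := key
    _ ≤ _ := by
        rw [mul_assoc (2 * _ * _)]
        have : M ^ 2 * (A * |l| / |x - y|) = M ^ 2 * A * |l| / |x - y| := by ring
        rw [this]
        gcongr

/-- The singular factor `|x - y| ^ (-(1 - 2 / p'))` is integrated by Hölder's inequality. The
exponents are matched so that its power `q'` is `|x - y| ^ (-β)` with `β < 1`. -/
lemma lintegral_rpow_mul_eLpNorm_le {p p' q q' β D : ℝ} (hp0 : 0 < p) (hq : q.HolderConjugate q')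
    (hβ : β < 1) (hβq : (1 - 2 / p') * q' = β) (hD : 0 ≤ D) (f : L2Q a₁ b₁ a₂ b₂)
    {x : ℝ} (hx : x ∈ intervalI) :
    ∫⁻ y in intervalI, ENNReal.ofReal (D * |x - y| ^ (-(1 - 2 / p'))) *
        eLpNorm (fun z => f (y, z)) (ENNReal.ofReal p) (volume.restrict (rectQ' a₁ b₁ a₂ b₂)) ≤
      ENNReal.ofReal (D * (2 / (1 - β)) ^ (1 / q')) *
        mixedNorm intervalI (rectQ' a₁ b₁ a₂ b₂) q p f := by
  have hq0' := hq.symm.pos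
  have hm : Measurable fun y : ℝ => ENNReal.ofReal (|x - y| ^ (-(1 - 2 / p'))) := by fun_prop
  have h1 := ENNReal.lintegral_mul_le_Lp_mul_Lq (volume.restrict intervalI) hq.symm hm.aemeasurable
    (measurable_eLpNorm_slice hp0 f).aemeasurable
  have h2 : ∫⁻ y in intervalI, ENNReal.ofReal (|x - y| ^ (-(1 - 2 / p'))) ^ q' ≤
      ENNReal.ofReal (2 / (1 - β)) := by
    refine le_trans (le_of_eq ?_) ((setLIntegral_sub_left_le
      (fun t => ENNReal.ofReal (|t| ^ (-β))) hx).trans (lintegral_abs_rpow_neg_le hβ))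
    refine lintegral_congr fun y => ?_
    rw [ENNReal.ofReal_rpow_of_nonneg (by positivity) hq0'.le, ← Real.rpow_mul (abs_nonneg _),
      neg_mul, hβq]
  have h3 : 0 ≤ 2 / (1 - β) := div_nonneg (by norm_num) (by linarith)
  simp_rw [ENNReal.ofReal_mul hD, mul_assoc]
  rw [lintegral_const_mul' _ _ ENNReal.ofReal_ne_top,
    ← ENNReal.ofReal_rpow_of_nonneg h3 (by positivity)]
  gcongr
  refine h1.trans ?_
  rw [mixedNorm]
  gcongr

/-- The partial sums of the mode expansion are bounded in `L^{p'}` on every slice by the mixed norm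
of `f`; the bound passes to the limit by Fatou's lemma, and integrating it over `I`, which has
length one, does not change it. -/
lemma mixedNorm_solutionOp_le {A : ℝ} (hA0 : 0 < A)
    (hA : ∀ t : ℝ, 0 < |t| → |t| ≤ 1 → ∀ N : Finset (ℕ × ℕ),
      ∑ n ∈ N, |greenKernel 0 l (modeFreq a₁ b₁ a₂ b₂ n) t| ≤ A * |l| / |t|)
    (hl0 : l ≠ 0) (hl : 1 ≤ |l|) {p p' q q' β : ℝ} (hp : p.HolderConjugate p') (hp2 : 2 < p')
    (hp4 : p' ≤ 4) (hq : q.HolderConjugate q') (hβ : β < 1) (hβq : (1 - 2 / p') * q' = β)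
    (f : L2Q a₁ b₁ a₂ b₂) :
    mixedNorm intervalI (rectQ' a₁ b₁ a₂ b₂) q' p' (solutionOp h₁ h₂ hl0 f) ≤
      ENNReal.ofReal (2 * max 1 ((2 / √((b₁ - a₁) * (b₂ - a₂))) ^ 2 * A) *
        (2 / (1 - β)) ^ (1 / q')) * mixedNorm intervalI (rectQ' a₁ b₁ a₂ b₂) q p f := by
  set B := ENNReal.ofReal (2 * max 1 ((2 / √((b₁ - a₁) * (b₂ - a₂))) ^ 2 * A) *
        (2 / (1 - β)) ^ (1 / q')) * mixedNorm intervalI (rectQ' a₁ b₁ a₂ b₂) q p f with hB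
  set κ : ℕ × ℕ → ℝ → ℝ := fun n => greenKernel 0 l (modeFreq a₁ b₁ a₂ b₂ n) with hκ
  set U : Finset (ℕ × ℕ) → ℝ → ℝ × ℝ → ℂ := fun N x z => ∑ n ∈ N,
    kernelConv (κ n) (modeCoeff h₁ h₂ f n) x * (mode a₁ b₁ a₂ b₂ true true n z : ℂ) with hU
  have hUp : ∀ N x p, MemLp (U N x) p (volume.restrict (rectQ' a₁ b₁ a₂ b₂)) := fun N x p =>
    memLp_sum_mul (fun n => (continuous_mode true true n).measurable)
      (fun n y => abs_mode_le true true n y) N _ p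
  have hUB : ∀ x ∈ intervalI, ∀ N,
      eLpNorm (U N x) (ENNReal.ofReal p') (volume.restrict (rectQ' a₁ b₁ a₂ b₂)) ≤ B :=
    fun x hx N => ((hUp N x _).eLpNorm_le_of_forall_integral_mul hp fun g hg =>
      enorm_integral_sum_kernelConv_mul_le h₁ h₂ hA0 hA hl hp hp2 hp4 f hx N hg).trans
      (lintegral_rpow_mul_eLpNorm_le hp.pos hq hβ hβq (by positivity) f hx)
  -- Along a subsequence the partial sums converge almost everywhere.
  obtain ⟨N, -, hN⟩ := (tendstoInMeasure_of_tendsto_Lp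
    (hasSum_modeMultiplier (σ := true) (τ := true) h₁ h₂ (norm_modeGreen_le h₁ h₂ hl0) f)).exists_seq_tendsto_ae'
  have hcoe : ∀ n, ∀ᵐ z ∂volume.restrict (boxQ a₁ b₁ a₂ b₂),
      (modeTensor true true n (modeGreen h₁ h₂ l n (modeCoeff h₁ h₂ f n)) : L2Q a₁ b₁ a₂ b₂) z =
        kernelConv (κ n) (modeCoeff h₁ h₂ f n) z.1 * (mode a₁ b₁ a₂ b₂ true true n z.2 : ℂ) := by
    intro n
    have h := (Measure.quasiMeasurePreserving_fst (μ := volume.restrict intervalI)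
      (ν := volume.restrict (rectQ' a₁ b₁ a₂ b₂))).ae (coeFn_convOp (isBoundedKernel_green_zero
        (modeFreq_pos h₁ h₂ n) l) (modeCoeff h₁ h₂ f n))
    filter_upwards [coeFn_modeTensor true true n (modeGreen h₁ h₂ l n (modeCoeff h₁ h₂ f n)),
      ae_boxQ_iff.2 h] with z hz hz'
    rw [hz]
    congr 1
  have hlim : ∀ᵐ z ∂volume.restrict (boxQ a₁ b₁ a₂ b₂),
      Tendsto (fun i => U (N i) z.1 z.2) atTop (𝓝 (solutionOp h₁ h₂ hl0 f z)) := by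
    filter_upwards [hN, ae_all_iff.2 hcoe, ae_all_iff.2 fun i => Lp.coeFn_fun_finsetSum (N i) fun n =>
      (modeTensor true true n (modeGreen h₁ h₂ l n (modeCoeff h₁ h₂ f n)) : L2Q a₁ b₁ a₂ b₂)]
      with z h1 h2 h3
    refine h1.congr fun i => ?_
    rw [h3 i]
    exact Finset.sum_congr rfl fun n _ => h2 n
  have hslice : ∀ᵐ x ∂volume.restrict intervalI, eLpNorm (fun z => solutionOp h₁ h₂ hl0 f (x, z))
      (ENNReal.ofReal p') (volume.restrict (rectQ' a₁ b₁ a₂ b₂)) ≤ B := by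
    filter_upwards [Measure.ae_ae_of_ae_prod (ae_boxQ_iff.1 hlim),
      ae_restrict_mem measurableSet_intervalI] with x hx hxI
    refine (Lp.eLpNorm_lim_le_liminf_eLpNorm (fun i => (hUp (N i) x 2).1) _ hx).trans ?_
    exact liminf_le_of_le (by isBoundedDefault) fun b hb =>
      let ⟨i, hi⟩ := hb.exists
      hi.trans (hUB x hxI _)
  have hq0' := hq.symm.pos
  calc _ ≤ (∫⁻ _ in intervalI, B ^ q') ^ (1 / q') := by
        rw [mixedNorm]
        refine ENNReal.rpow_le_rpow ?_ (by positivity)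
        exact lintegral_mono_ae (hslice.mono fun x hx => ENNReal.rpow_le_rpow hx hq0'.le)
    _ = B := by
        rw [lintegral_const, measure_univ, mul_one, ← ENNReal.rpow_mul, mul_one_div_cancel hq0'.ne',
          ENNReal.rpow_one]

end

theorem proposition1 (a₁ b₁ a₂ b₂ : ℝ) (h₁ : a₁ < b₁) (h₂ : a₂ < b₂) :
    ∃ C₀ : ℝ, 0 < C₀ ∧ ∃ C : ℝ → ℝ, (∀ α : ℝ, 0 < α → α < 1 / 2 → 0 < C α) ∧
      ∀ l : ℝ, 4 ≤ |l| → ¬ IsDirichletEigenvalue (rectQ' a₁ b₁ a₂ b₂) frame2 (l ^ 2) →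
        ∃ E : L2Q a₁ b₁ a₂ b₂ →ₗ[ℂ] L2Q a₁ b₁ a₂ b₂,
          (∀ f : L2Q a₁ b₁ a₂ b₂, MemH2 (boxQ a₁ b₁ a₂ b₂) frame3 (E f)) ∧
          (∀ f : L2Q a₁ b₁ a₂ b₂, HasWeakConjLaplacian (boxQ a₁ b₁ a₂ b₂) l (E f) f) ∧
          (∀ φ : ℝ × ℝ × ℝ → ℂ, IsTestFunction (boxQ a₁ b₁ a₂ b₂) φ →
            ∀ g : L2Q a₁ b₁ a₂ b₂,
              g =ᵐ[volume.restrict (boxQ a₁ b₁ a₂ b₂)] conjLaplacian l φ →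
              E g =ᵐ[volume.restrict (boxQ a₁ b₁ a₂ b₂)] φ) ∧
          (∀ f : L2Q a₁ b₁ a₂ b₂, ‖E f‖ ≤ C₀ * |l|⁻¹ * ‖f‖) ∧
          (∀ f : L2Q a₁ b₁ a₂ b₂,
            h1Norm (boxQ a₁ b₁ a₂ b₂) frame3 (E f) ≤ ENNReal.ofReal (C₀ * ‖f‖)) ∧
          (∀ α r p p' θ q q' : ℝ, 0 < α → α < 1 / 2 → 2 < r → r < 2 / α - 2 →
            p' = 2 + α * (r - 2) → p.HolderConjugate p' →
            θ = α * r / p' → q' = 1 / θ → q.HolderConjugate q' →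
            ∀ f : L2Q a₁ b₁ a₂ b₂,
              mixedNorm intervalI (rectQ' a₁ b₁ a₂ b₂) q' p' (E f) ≤
                ENNReal.ofReal (C α) * mixedNorm intervalI (rectQ' a₁ b₁ a₂ b₂) q p f) := by
  obtain ⟨A, hA0, hA⟩ := exists_sum_abs_greenKernel_le h₁ h₂
  set K := 2 * max 1 ((2 / √((b₁ - a₁) * (b₂ - a₂))) ^ 2 * A) with hK
  have hK0 : 0 < K := by positivity
  refine ⟨11, by norm_num, fun α => K * (2 / α), fun α hα _ => by positivity, fun l hl4 _ => ?_⟩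
  have hl0 : l ≠ 0 := abs_pos.1 (by linarith)
  refine ⟨solutionOp h₁ h₂ hl0, fun f => memH2_solutionOp h₁ h₂ hl0 f,
    fun f => hasWeakConjLaplacian_solutionOp h₁ h₂ hl0 f,
    fun φ hφ g hg => solutionOp_conjLaplacian h₁ h₂ hl0 hφ hg, fun f => ?_,
    fun f => h1Norm_solutionOp_le h₁ h₂ hl0 hl4 f, ?_⟩
  · refine (norm_solutionOp_le h₁ h₂ hl0 f).trans ?_
    rw [div_eq_mul_inv]
    gcongr
    norm_num
  intro α r p p' θ q q' hα hα2 hr hrα hp' hp hθ hq' hq f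
  have hαr : α * r < 2 - 2 * α := by
    rw [lt_sub_iff_add_lt, lt_div_iff₀ hα] at hrα
    linarith
  have hp2 : 2 < p' := by
    have := mul_pos hα (sub_pos.2 hr)
    linarith
  -- This upper bound is what the condition `r < 2 / α - 2` provides.
  have hp4 : p' ≤ 4 := by linarith
  have hr0 : 0 < r := by linarith
  have hβ : (1 - 2 / p') * q' = 1 - 2 / r := by
    rw [hq', hθ]
    field_simp
    rw [hp']; ring
  have hq1 : 1 / q' ≤ 1 := by
    rw [div_le_one hq.symm.pos]
    exact hq.symm.lt.le
  refine (mixedNorm_solutionOp_le h₁ h₂ hA0 (fun t => hA l t (by linarith)) hl0 (by linarith) hp hp2 hp4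
    hq (sub_lt_self 1 (by positivity)) hβ f).trans ?_
  -- The singular integral contributes the factor `r ^ (1 / q')`, and `r < 2 / α`.
  gcongr
  refine mul_le_mul_of_nonneg_left ?_ hK0.le
  calc (2 / (1 - (1 - 2 / r))) ^ (1 / q') = r ^ (1 / q') := by
        congr 1
        field_simp; ring
    _ ≤ r ^ (1 : ℝ) := by
        gcongr
        linarith
    _ ≤ 2 / α := by rw [Real.rpow_one]; linarith
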